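/- **Setting.** An action of a group $Q$ on a set $\Omega$ is *2-by-block-transitive* if there is a $Q$-invariant equivalence relation on $\Omega$ with at least two classes (blocks) such that $Q$ is transitive on distant pairs, i.e. on the ordered pairs of points lying in different blocks; it is *sharply* 2-by-block-transitive if moreover, for any two distant pairs, exactly one element of $Q$ maps the first to the second. Let $q=p^e$ with $p$ prime and $e\ge 1$, let $V=\mathbb F_q^3$ with standard basis $v_0,v_1,v_2$, let $\alpha_i=\langle v_i\rangle$, and let $Z$ be the group of nonzero scalar maps. Let $Z\,\mathrm{SL}_3(q)\le G\le \Gamma\mathrm L_3(q)$, put $\overline G=\langle \mathrm{GL}_3(q),G\rangle$ and $e_G=|G:G\cap \mathrm{GL}_3(q)|$, and let $W$ be the subgroup of $G$ fixing $\alpha_0$ and $V/\alpha_0$ pointwise. Let $s$ be the linear map that swaps $v_0,v_1$ and sends $v_2$ to $-v_2$. Regard $\mathrm{GL}_2(q)$ as the group of linear maps fixing $v_0$ and preserving $\langle v_1,v_2\rangle$, let $\hat x_0\in\mathrm{GL}_2(q)$ be a Singer cycle (an element of order $q^2-1$), and let $x_0=\hat x_0^{\,q+1}$. Let $R=WZ\langle\hat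 x_0\rangle$, and let $y_0\in\overline G$ be such that $y_0$ fixes the vectors $v_0$ and $v_1$, preserves the plane $\langle v_1,v_2\rangle$, and satisfies $\mathrm N_{\overline G(\alpha_0)}(R)=R\langle y_0\rangle$, where $\overline G(\alpha_0)$ is the stabilizer of the line $\alpha_0$ in $\overline G$. Let $t_G$ be the least positive integer with $x_0^{t_G}\in G$, let $0\le r_G<t_G$ be such that $y:=x_0^{r_G}y_0\in G$, and let $\hat x=\hat x_0^{\,t_G}$. Put $L^{\Gamma\mathrm L_1}=WZ\langle\hat x,y\rangle$, and let $\mathcal H$ be the set of subgroups $L$ of $L^{\Gamma\mathrm L_1}$ such that $Z\le L$ and $G$ has 2-by-block-transitive action on $G/L$. **Proposition.** $L^{\Gamma\mathrm L_1}=WZ\rtimes\langle\hat x,y\rangle$, and $\mathcal H$ consists exactly of the groups of the form $$L=WZ\rtimes\langle \hat x^{d_x},\ \hat x^{d_x-1}y^{d_y}\rangle,$$ where $d_x,d_y\in\{1,2\}$ and $d_xd_y=|L^{\Gamma\mathrm L_1}:L|\le 2$, such that 1. if $e_G$ is even, then $d_x=d_y=1$; 2. if $p=2$, then $d_x=1$;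 3. if $t_G=3$, then $r_G\ne 0$, $e_G$ is a multiple of $3$ and $p^{e/e_G}\equiv 1 \pmod 3$. In particular $0\le|\mathcal H|\le 3$. Moreover, if $L\in\mathcal H$, then $$|L\cap sLs:Z|=\frac{4e_G}{|L^{\Gamma\mathrm L_1}:L|^2\,t_G},$$ and this is also the order modulo $Z$ of the stabilizer in $G$ of any distant pair of $G/L$; and the action of $G/Z$ on $G/L$ is sharply 2-by-block-transitive if and only if $e_G=t_G$ and $d_xd_y=2$. Here $e_G=t_G$ is equivalent to $|G|=|\mathrm{GL}_3(q)|$. -/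

import Mathlib

open scoped Pointwise

namespace PlaneField

/-! ### Two-by-block-transitive actions -/

section Actions

variable (Q Ω : Type*) [Group Q] [MulAction Q Ω]

/-- The action of `Q` on `Ω` is 2-by-block-transitive with respect to the equivalence relation `r`:
`r` is `Q`-invariant, it has at least two classes (blocks), and `Q` is transitive on distant pairs,
that is, on the ordered pairs of points that lie in different blocks. -/
structure IsTwoByBlockTransitive (r : Setoid Ω) : Prop where
  invariant : ∀ (g : Q) (a b : Ω), r a b → r (g • a) (g • b)
  two_blocks : ∃ a b : Ω, ¬ r a b
  transitive : ∀ a b c d : Ω, ¬ r a b → ¬ r c d → ∃ g : Q, g • a = c ∧ g • b = d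

/-- The action of `Q` on `Ω` is sharply 2-by-block-transitive with respect to `r`: moreover the
element that carries one distant pair to another one is unique. -/
structure IsSharplyTwoByBlockTransitive (r : Setoid Ω) : Prop
    extends IsTwoByBlockTransitive Q Ω r where
  sharp : ∀ a b c d : Ω, ¬ r a b → ¬ r c d → ∃! g : Q, g • a = c ∧ g • b = d

/-- `Q` has 2-by-block-transitive action on `Ω`. -/
def HasTwoByBlockTransitiveAction : Prop :=
  ∃ r : Setoid Ω, IsTwoByBlockTransitive Q Ω r

/-- `Q` has sharply 2-by-block-transitive action on `Ω`. -/
def HasSharplyTwoByBlockTransitiveAction : Prop :=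
  ∃ r : Setoid Ω, IsSharplyTwoByBlockTransitive Q Ω r

end Actions

/-- For a normal subgroup `N` of `G` contained in `L`, the induced action of `G ⧸ N` on the coset
space `G ⧸ L`. -/
@[reducible] def quotientAction {G : Type*} [Group G] (N L : Subgroup G) (hN : N.Normal)
    (h : N ≤ L) : MulAction (G ⧸ N) (G ⧸ L) :=
  MulAction.compHom (G ⧸ L)
    (QuotientGroup.lift N (MulAction.toPermHom G (G ⧸ L)) (by
      intro n hn
      ext x
      induction x using QuotientGroup.induction_on with
      | H g =>
        change ((n * g : G) : G ⧸ L) = (g : G ⧸ L)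
        rw [eq_comm, QuotientGroup.eq]
        have := hN.conj_mem n hn g⁻¹
        rw [inv_inv, mul_assoc] at this
        exact h this))

/-- `N` is a normal subgroup of `G`, contained in `L`, and the action of `G ⧸ N` on `G ⧸ L` is
sharply 2-by-block-transitive. -/
def QuotientActsSharply {G : Type*} [Group G] (N L : Subgroup G) : Prop :=
  ∃ (hN : N.Normal) (h : N ≤ L),
    letI := quotientAction N L hN h
    HasSharplyTwoByBlockTransitiveAction (G ⧸ N) (G ⧸ L)

/-- `L` is the internal semidirect product `N ⋊ H`. -/
structure IsInternalSemidirect {Γ : Type*} [Group Γ] (N H L : Subgroup Γ) : Prop where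
  sup_eq : N ⊔ H = L
  normalizes : H ≤ Subgroup.normalizer (N : Set Γ)
  disjoint : Disjoint N H

/-! ### Semilinear groups on the three-dimensional space -/

section Semilinear

variable (F : Type*) [Field F]

/-- The standard three-dimensional space over `F`. All the groups below are groups of permutations
of it. -/
abbrev V : Type _ := Fin 3 → F

/-- The standard basis vectors `v₀, v₁, v₂`. -/
def v (i : Fin 3) : V F := Pi.single i 1

/-- The standard line `αᵢ` spanned by `vᵢ`. -/
def line (i : Fin 3) : Submodule F (V F) := Submodule.span F {v F i}

/-- The plane spanned by `v₁` and `v₂`. -/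
def plane : Submodule F (V F) := Submodule.span F {v F 1, v F 2}

/-- The semilinear group: additive bijections `f` with `f (a v) = σ(a) f(v)` for some field
automorphism `σ`. -/
def GammaL : Subgroup (Equiv.Perm (V F)) where
  carrier := {f | (∀ u w, f (u + w) = f u + f w) ∧
    ∃ σ : F ≃+* F, ∀ (a : F) (u : V F), f (a • u) = σ a • f u}
  one_mem' := ⟨fun _ _ => rfl, RingEquiv.refl F, fun _ _ => rfl⟩
  mul_mem' := by
    rintro f g ⟨hf, σ, hσ⟩ ⟨hg, τ, hτ⟩
    refine ⟨fun u w => ?_, τ.trans σ, fun a u => ?_⟩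
    · simp [Equiv.Perm.mul_apply, hf, hg]
    · simp [Equiv.Perm.mul_apply, hσ, hτ]
  inv_mem' := by
    rintro f ⟨hf, σ, hσ⟩
    refine ⟨fun u w => ?_, σ.symm, fun a u => ?_⟩
    · rw [Equiv.Perm.inv_eq_iff_eq, hf]
      simp
    · rw [Equiv.Perm.inv_eq_iff_eq, hσ]
      simp

/-- The general linear group. -/
def linearGroup : Subgroup (Equiv.Perm (V F)) := (MulAction.toPermHom (V F ≃ₗ[F] V F) (V F)).range

/-- The special linear group. -/
noncomputable def specialLinearGroup : Subgroup (Equiv.Perm (V F)) :=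
  (LinearEquiv.det (R := F) (M := V F)).ker.map (MulAction.toPermHom (V F ≃ₗ[F] V F) (V F))

/-- The group `Z` of nonzero scalar transformations. -/
def Z : Subgroup (Equiv.Perm (V F)) := (MulAction.toPermHom Fˣ (V F)).range

/-- The linear map that swaps `v₀` and `v₁` and sends `v₂` to `-v₂`. -/
def s : Equiv.Perm (V F) :=
  Function.Involutive.toPerm (fun u => ![u 1, u 0, -u 2]) (by
    intro u
    ext i
    fin_cases i <;> simp)

variable {F}

/-- The subgroup of `G` that fixes `α₀` and `V / α₀` pointwise. -/
def W (G : Subgroup (Equiv.Perm (V F))) : Subgroup (Equiv.Perm (V F)) where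
  carrier := {g | g ∈ G ∧ (∀ u ∈ line F 0, g u = u) ∧ ∀ u, g u - u ∈ line F 0}
  one_mem' := ⟨G.one_mem, fun _ _ => rfl, fun u => by simp⟩
  mul_mem' := by
    rintro f g ⟨hf, hf₀, hf₁⟩ ⟨hg, hg₀, hg₁⟩
    refine ⟨G.mul_mem hf hg, fun u hu => ?_, fun u => ?_⟩
    · rw [Equiv.Perm.mul_apply, hg₀ u hu, hf₀ u hu]
    · have := (line F 0).add_mem (hf₁ (g u)) (hg₁ u)
      simpa [Equiv.Perm.mul_apply] using this
  inv_mem' := by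
    rintro f ⟨hf, hf₀, hf₁⟩
    refine ⟨G.inv_mem hf, fun u hu => ?_, fun u => ?_⟩
    · rw [Equiv.Perm.inv_eq_iff_eq, hf₀ u hu]
    · have := (line F 0).neg_mem (hf₁ (f⁻¹ u))
      simpa using this

/-- The largest order of a field automorphism induced by `G`, that is, the index in `G` of its
linear part `G ∩ GL₃(F)`. -/
noncomputable def fieldIndex (G : Subgroup (Equiv.Perm (V F))) : ℕ := (linearGroup F).relIndex G

/-- `c` is a Singer cycle of `GL₂(q)`, where `q = |F|` and `GL₂(q)` is regarded as the group of
linear maps that fix `v₀` and preserve the plane `⟨v₁, v₂⟩`: an element of it of order `q² - 1`. -/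
structure IsSingerCycle (c : Equiv.Perm (V F)) : Prop where
  linear : c ∈ linearGroup F
  fixes : c (v F 0) = v F 0
  plane : c ∈ MulAction.stabilizer (Equiv.Perm (V F)) (plane F : Set (V F))
  order : orderOf c = Nat.card F ^ 2 - 1

/-- `y` is a field automorphism adapted to the Singer cycle `c`. Write `Ḡ = ⟨GL₃(q), G⟩` and
`R = WZ⟨c⟩`. Then `y` is an element of `Ḡ` that fixes `v₀` and `v₁`, preserves `⟨v₁, v₂⟩`, and
generates the normalizer of `R` in the stabilizer `Ḡ(α₀)` modulo `R`. -/
structure IsAdaptedFieldAut (G : Subgroup (Equiv.Perm (V F)))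
    (c y : Equiv.Perm (V F)) : Prop where
  mem : y ∈ linearGroup F ⊔ G
  fixes_zero : y (v F 0) = v F 0
  fixes_one : y (v F 1) = v F 1
  plane : y ∈ MulAction.stabilizer (Equiv.Perm (V F)) (plane F : Set (V F))
  normalizer :
    ((linearGroup F ⊔ G) ⊓ MulAction.stabilizer (Equiv.Perm (V F)) (line F 0 : Set (V F))) ⊓
        Subgroup.normalizer
          ((W G ⊔ Z F ⊔ Subgroup.zpowers c : Subgroup (Equiv.Perm (V F))) :
            Set (Equiv.Perm (V F))) =
      W G ⊔ Z F ⊔ Subgroup.zpowers c ⊔ Subgroup.zpowers y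

/-- The group `L^{ΓL₁} = WZ⟨x̂, y⟩`. -/
def LGammaL (G : Subgroup (Equiv.Perm (V F))) (x y : Equiv.Perm (V F)) :
    Subgroup (Equiv.Perm (V F)) :=
  W G ⊔ Z F ⊔ Subgroup.closure {x, y}

/-- The class `𝓗` of the subgroups `L` of `L^{ΓL₁}` such that `Z ≤ L` and such that `G` has
2-by-block-transitive action on `G / L`. -/
def pointStabilizers (G : Subgroup (Equiv.Perm (V F)))
    (x y : Equiv.Perm (V F)) : Set (Subgroup (Equiv.Perm (V F))) :=
  {L | L ≤ LGammaL G x y ∧ Z F ≤ L ∧ HasTwoByBlockTransitiveAction G (G ⧸ L.subgroupOf G)}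

/-- `L = WZ ⋊ ⟨x̂ ^ d_x, x̂ ^ (d_x - 1) y ^ d_y⟩` where `d_x, d_y ∈ {1, 2}` and
`d_x d_y = |L^{ΓL₁} : L| ≤ 2`. -/
structure HasForm (G : Subgroup (Equiv.Perm (V F))) (x y : Equiv.Perm (V F))
    (L : Subgroup (Equiv.Perm (V F))) (dx dy : ℕ) : Prop where
  dx_mem : dx = 1 ∨ dx = 2
  dy_mem : dy = 1 ∨ dy = 2
  semidirect : IsInternalSemidirect (W G ⊔ Z F)
    (Subgroup.closure {x ^ dx, x ^ (dx - 1) * y ^ dy}) L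
  index : dx * dy = L.relIndex (LGammaL G x y)
  le_two : dx * dy ≤ 2

end Semilinear

end PlaneField

/-! Put q = |F| and M = L^{ΓL₁}. The Singer cycle turns V/α₀ into the quadratic extension E of F, on
which it acts as multiplication by a generator ζ of the multiplicative group
(`IsSingerCycle.exists_model`). In these terms M consists of the elements of G that act on V/α₀ as z
↦ a τ(z) with τ an automorphism of E (`mem_LGammaL_iff`). The automorphism τ₀ of y₀ has order 2e_G,
and its e_G-th power is the conjugation ι of E over F.

Every L ≤ M lies in the stabilizer of α₀, a maximal subgroup of G. This forces the blocks, so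
2-by-block-transitivity says that each element of G moving α₀ lies in LsL
(`mem_pointStabilizers_iff`).

The case L = M. In Ḡ each element that moves α₀ is n₁ s n₂ with both n₁, n₂ semilinear over E
(`exists_factor`). The freedom in this factorization consists of the δ for which δ and sδs are both
semilinear over E. Those that are E-linear on V/α₀ form Z⟨ε⟩ for a certain ε in SL₃(q), so they lie
in G (`mem_of_acts_one`), and every power of y₀ can be corrected by W to such a δ
(`exists_transvec_pair`). Hence M is transitive if and only if every x₀^i has some x₀^i y₀^j in G.
Determinants give t ∈ {1, 3}, and y₀ acts on ⟨x₀⟩ by a power map, so this is arithmetic modulo 3 and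
yields condition 3 (`forall_iff`, `exponent_modEq_iff`).

The case L ≤ M. Here L is transitive if and only if M is and M ⊆ L·sLs. If d and sds lie in M, then
d⁻¹·sds lies in Z ∪ Zη, where η induces ι on both structures; so |M : L| ≤ 2. A subgroup of index
two works exactly when η ∉ L: since ε·sεs ∈ Zη, exactly one of ε, sεs is then in L. A subgroup of
index two that contains Z also contains W, which consists of commutators with x, and it contains x².
Modulo these η is y^{e_G}, so the condition reads y ∉ L and e_G odd (`isTransitiveOn_iff_of_le`).
Modulo WZ this leaves ⟨x, y²⟩ and ⟨x², xy⟩.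

Orders. M ∩ sMs has order 2·(2e_G/t) modulo Z (`relIndex_Z_pair`), and M ⊆ L·sLs makes L ∩ sLs of
index |M : L|² in it (`relIndex_pair`). Sharpness means L ∩ sLs = Z. -/

namespace PlaneField

/-! ### 2-by-block-transitive coset actions in terms of double cosets -/

section Blocks

variable {G : Type*} [Group G]

/-- The block of the trivial coset in a 2-by-block-transitive action on `G ⧸ L` is `M / L`. -/
structure IsBlockSubgroup (L M : Subgroup G) : Prop where
  le : L ≤ M
  ne_top : M ≠ ⊤
  double : ∀ g h, g ∉ M → h ∉ M → ∃ a ∈ L, ∃ b ∈ L, h = a * g * b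

theorem IsTwoByBlockTransitive.exists_block {L : Subgroup G} {r : Setoid (G ⧸ L)}
    (h : IsTwoByBlockTransitive G (G ⧸ L) r) :
    ∃ M, IsBlockSubgroup L M ∧ ∀ a b : G, r (a : G ⧸ L) (b : G ⧸ L) ↔ a⁻¹ * b ∈ M := by
  have key : ∀ g a b : G, r (a : G ⧸ L) (b : G ⧸ L) →
      r ((g * a : G) : G ⧸ L) ((g * b : G) : G ⧸ L) := fun g a b hab => h.invariant g _ _ hab
  let M : Subgroup G :=
    { carrier := {g | r ((1 : G) : G ⧸ L) (g : G ⧸ L)}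
      one_mem' := r.refl _
      mul_mem' := by
        intro a b ha hb
        refine r.trans ha ?_
        simpa using key a 1 b hb
      inv_mem' := by
        intro a ha
        simpa using r.symm (key a⁻¹ 1 a ha) }
  have hM : ∀ a b : G, r (a : G ⧸ L) (b : G ⧸ L) ↔ a⁻¹ * b ∈ M := by
    intro a b
    constructor
    · intro hab
      simpa [M] using key a⁻¹ a b hab
    · intro hab
      simpa [M] using key a 1 (a⁻¹ * b) hab
  refine ⟨M, ⟨?_, ?_, ?_⟩, hM⟩
  · intro l hl
    have : ((1 : G) : G ⧸ L) = (l : G ⧸ L) := by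
      rw [QuotientGroup.eq]; simpa using hl
    change r _ _
    rw [this]
  · intro htop
    obtain ⟨a, b, hab⟩ := h.two_blocks
    induction a using QuotientGroup.induction_on with
    | H a =>
      induction b using QuotientGroup.induction_on with
      | H b => exact hab ((hM a b).2 (by rw [htop]; trivial))
  · intro g k hg hk
    obtain ⟨a, ha, hb⟩ := h.transitive ((1 : G) : G ⧸ L) (g : G ⧸ L) ((1 : G) : G ⧸ L) (k : G ⧸ L)
      hg hk
    have ha' : ((a * 1 : G) : G ⧸ L) = ((1 : G) : G ⧸ L) := ha
    have hb' : ((a * g : G) : G ⧸ L) = (k : G ⧸ L) := hb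
    rw [QuotientGroup.eq] at ha' hb'
    refine ⟨a, by simpa using ha', _, hb', by group⟩

theorem IsBlockSubgroup.exists_setoid {L M : Subgroup G} (h : IsBlockSubgroup L M) :
    ∃ r : Setoid (G ⧸ L), IsTwoByBlockTransitive G (G ⧸ L) r := by
  let f : G ⧸ L → G ⧸ M := Subgroup.quotientMapOfLE h.le
  have hf : ∀ a : G, f (a : G ⧸ L) = (a : G ⧸ M) := fun a => rfl
  refine ⟨Setoid.ker f, ?_, ?_, ?_⟩
  · intro g a b hab
    induction a using QuotientGroup.induction_on with
    | H a =>
      induction b using QuotientGroup.induction_on with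
      | H b =>
        rw [Setoid.ker_def, hf, hf] at hab
        change ((g * a : G) : G ⧸ M) = ((g * b : G) : G ⧸ M)
        rw [QuotientGroup.eq] at hab ⊢
        simpa [mul_assoc] using hab
  · obtain ⟨g, hg⟩ : ∃ g, g ∉ M := by
      by_contra hcon
      push Not at hcon
      exact h.ne_top ((Subgroup.eq_top_iff' M).2 hcon)
    refine ⟨((1 : G) : G ⧸ L), (g : G ⧸ L), ?_⟩
    rw [Setoid.ker_def, hf, hf, QuotientGroup.eq]
    simpa using hg
  · intro a b c d
    induction a using QuotientGroup.induction_on with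
    | H a =>
    induction b using QuotientGroup.induction_on with
    | H b =>
    induction c using QuotientGroup.induction_on with
    | H c =>
    induction d using QuotientGroup.induction_on with
    | H d =>
      rw [Setoid.ker_def, Setoid.ker_def, hf, hf, hf, hf, QuotientGroup.eq, QuotientGroup.eq]
      intro hab hcd
      obtain ⟨l, hl, m, hm, hlm⟩ := h.double _ _ hab hcd
      refine ⟨c * l * a⁻¹, ?_, ?_⟩
      · change ((c * l * a⁻¹ * a : G) : G ⧸ L) = _
        rw [eq_comm, QuotientGroup.eq]
        simpa using hl
      · change ((c * l * a⁻¹ * b : G) : G ⧸ L) = _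
        rw [QuotientGroup.eq]
        have : d = c * (l * (a⁻¹ * b) * m) := by rw [← hlm]; group
        rw [this]
        have : (c * l * a⁻¹ * b)⁻¹ * (c * (l * (a⁻¹ * b) * m)) = m := by group
        rwa [this]

/-- If a point stabilizer lies in a maximal subgroup, then this subgroup determines the blocks. -/
theorem IsBlockSubgroup.eq_of_maximal {L M P : Subgroup G} (h : IsBlockSubgroup L M)
    (hLP : L ≤ P) (hP : P ≠ ⊤) (hmax : ∀ K : Subgroup G, P ≤ K → K = P ∨ K = ⊤) : M = P := by
  by_cases hPM : P ≤ M
  · exact (hmax M hPM).resolve_right h.ne_top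
  · exfalso
    obtain ⟨g, hgP, hgM⟩ := SetLike.not_le_iff_exists.1 hPM
    -- Everything outside `M` lies in LgL ⊆ P, so the group would be the union of the two proper
    -- subgroups `M` and `P`.
    have hsub : ∀ k, k ∉ M → k ∈ P := by
      intro k hk
      obtain ⟨a, ha, b, hb, rfl⟩ := h.double g k hgM hk
      exact P.mul_mem (P.mul_mem (hLP ha) hgP) (hLP hb)
    obtain ⟨b, hb⟩ : ∃ b, b ∉ P := by
      by_contra hcon
      push Not at hcon
      exact hP ((Subgroup.eq_top_iff' P).2 hcon)
    have hbM : b ∈ M := by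
      by_contra hbM
      exact hb (hsub b hbM)
    have h1 : g * b ∉ M := fun hh => hgM ((Subgroup.mul_mem_cancel_right M hbM).1 hh)
    exact hb ((Subgroup.mul_mem_cancel_left P hgP).1 (hsub _ h1))

theorem mem_stabilizer_coset {L : Subgroup G} (a k : G) :
    k ∈ MulAction.stabilizer G (a : G ⧸ L) ↔ a⁻¹ * k * a ∈ L := by
  rw [MulAction.mem_stabilizer_iff]
  change ((k * a : G) : G ⧸ L) = _ ↔ _
  rw [eq_comm, QuotientGroup.eq, mul_assoc]

/-- The stabilizer of a pair of distant points is conjugate to that of a standard distant pair. -/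
theorem IsBlockSubgroup.exists_stabilizer_eq {L P : Subgroup G} (h : IsBlockSubgroup L P)
    {s : G} (hs : s ∉ P) (a b : G) (hab : a⁻¹ * b ∉ P) :
    ∃ g : G, MulAction.stabilizer G (a : G ⧸ L) ⊓ MulAction.stabilizer G (b : G ⧸ L) =
      (L ⊓ L.map (MulAut.conj s).toMonoidHom).map (MulAut.conj g).toMonoidHom := by
  obtain ⟨l, hl, m, hm, hlm⟩ := h.double s _ hs hab
  refine ⟨a * l, ?_⟩
  have hb : b = a * l * s * m := by
    have : b = a * (a⁻¹ * b) := by group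
    rw [this, hlm]; group
  have conj_mem : ∀ {H : Subgroup G} {n : G} (k : G), n ∈ H → (n⁻¹ * k * n ∈ H ↔ k ∈ H) := by
    intro H n k hn
    rw [Subgroup.mul_mem_cancel_right _ hn, Subgroup.mul_mem_cancel_left _ (H.inv_mem hn)]
  have mem_conj : ∀ (H : Subgroup G) (n k : G),
      k ∈ H.map (MulAut.conj n).toMonoidHom ↔ n⁻¹ * k * n ∈ H := by
    intro H n k
    constructor
    · rintro ⟨x, hx, rfl⟩
      simpa [mul_assoc] using hx
    · intro hk
      exact ⟨_, hk, by simp [mul_assoc]⟩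
  ext k
  rw [Subgroup.mem_inf, mem_stabilizer_coset, mem_stabilizer_coset, mem_conj, Subgroup.mem_inf,
    mem_conj]
  refine and_congr ?_ ?_
  · rw [show (a * l)⁻¹ * k * (a * l) = l⁻¹ * (a⁻¹ * k * a) * l by group, conj_mem _ hl]
  · rw [hb, show (a * l * s * m)⁻¹ * k * (a * l * s * m) =
      m⁻¹ * (s⁻¹ * ((a * l)⁻¹ * k * (a * l)) * s) * m by group, conj_mem _ hm]

/-- The elements carrying one distant pair to another form a coset of the stabilizer of the pair, a
conjugate of L ∩ sLs⁻¹; uniqueness modulo the normal subgroup `N` says that this stabilizer lies in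
`N`. Sharpness may refer to any block system, hence `hP`. -/
theorem quotientActsSharply_iff {N L P : Subgroup G} (hN : N.Normal) (hNL : N ≤ L)
    (h : IsBlockSubgroup L P) (hP : ∀ M, IsBlockSubgroup L M → M = P) {s : G} (hs : s ∉ P) :
    QuotientActsSharply N L ↔ L ⊓ L.map (MulAut.conj s).toMonoidHom ≤ N := by
  let _ := quotientAction N L hN hNL
  constructor
  · rintro ⟨_, _, r, hr⟩
    have hr' : IsTwoByBlockTransitive G (G ⧸ L) r := by
      refine ⟨fun g a b hab => hr.invariant (g : G ⧸ N) a b hab, hr.two_blocks, ?_⟩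
      intro a b c d hab hcd
      obtain ⟨g, hg⟩ := hr.transitive a b c d hab hcd
      induction g using QuotientGroup.induction_on with
      | H g => exact ⟨g, hg⟩
    obtain ⟨M, hM, hrM⟩ := hr'.exists_block
    obtain rfl := hP M hM
    have hd : ¬ r ((1 : G) : G ⧸ L) (s : G ⧸ L) := by rw [hrM]; simpa using hs
    obtain ⟨g, -, hg⟩ := hr.sharp _ _ _ _ hd hd
    rintro k ⟨hk, l, hl, rfl⟩
    have h1 := hg ((MulAut.conj s l : G) : G ⧸ N) ⟨by
      change (((MulAut.conj s l) * 1 : G) : G ⧸ L) = _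
      rw [eq_comm, QuotientGroup.eq]
      simpa using hk, by
      change (((MulAut.conj s l) * s : G) : G ⧸ L) = _
      rw [eq_comm, QuotientGroup.eq]
      simpa [mul_assoc] using hl⟩
    have h2 := hg ((1 : G) : G ⧸ N) ⟨by
      change ((1 * 1 : G) : G ⧸ L) = _
      simp, by
      change ((1 * s : G) : G ⧸ L) = _
      simp⟩
    have h3 := h2.trans h1.symm
    rw [QuotientGroup.eq] at h3
    simpa using h3
  · intro hle
    obtain ⟨r, hr⟩ := h.exists_setoid
    obtain ⟨M, hM, hrM⟩ := hr.exists_block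
    obtain rfl := hP M hM
    refine ⟨hN, hNL, r, ⟨?_, hr.two_blocks, ?_⟩, ?_⟩
    · intro g a b hab
      induction g using QuotientGroup.induction_on with
      | H g => exact hr.invariant g a b hab
    · intro a b c d hab hcd
      obtain ⟨g, hg⟩ := hr.transitive a b c d hab hcd
      exact ⟨(g : G ⧸ N), hg⟩
    · intro a b c d hab hcd
      obtain ⟨g, hg⟩ := hr.transitive a b c d hab hcd
      refine ⟨(g : G ⧸ N), hg, ?_⟩
      intro k hk
      induction k using QuotientGroup.induction_on with
      | H k =>
        have hk1 : k • a = c := hk.1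
        have hk2 : k • b = d := hk.2
        have hmem : k⁻¹ * g ∈ MulAction.stabilizer G a ⊓ MulAction.stabilizer G b := by
          rw [Subgroup.mem_inf, MulAction.mem_stabilizer_iff, MulAction.mem_stabilizer_iff,
            mul_smul, mul_smul, hg.1, hg.2, ← hk1, ← hk2]
          simp
        rw [QuotientGroup.eq]
        induction a using QuotientGroup.induction_on with
        | H a =>
        induction b using QuotientGroup.induction_on with
        | H b =>
          rw [hrM] at hab
          obtain ⟨n, hn⟩ := h.exists_stabilizer_eq hs a b hab
          rw [hn] at hmem
          obtain ⟨z, hz, hz'⟩ := hmem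
          rw [← hz']
          exact hN.conj_mem z (hle hz) n

/-- If `M = L B` then `L ∩ B` has the same index in `B` as `L` in `M`. -/
theorem relIndex_eq_of_mul {L B M : Subgroup G} (hB : B ≤ M)
    (h : ∀ m ∈ M, ∃ l ∈ L, ∃ b ∈ B, m = l * b) : L.relIndex B = L.relIndex M := by
  let f : (B ⧸ L.subgroupOf B) → (M ⧸ L.subgroupOf M) :=
    Quotient.map' (Subgroup.inclusion hB) (by
      intro a b hab
      rw [QuotientGroup.leftRel_apply] at hab ⊢
      exact hab)
  have hf : Function.Bijective f := by
    constructor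
    · intro a b
      induction a using QuotientGroup.induction_on with
      | H a =>
      induction b using QuotientGroup.induction_on with
      | H b =>
        intro hab
        have hab' : ((Subgroup.inclusion hB a : M) : M ⧸ L.subgroupOf M) =
          ((Subgroup.inclusion hB b : M) : M ⧸ L.subgroupOf M) := hab
        rw [QuotientGroup.eq] at hab' ⊢
        exact hab'
    · intro a
      induction a using QuotientGroup.induction_on with
      | H a =>
        obtain ⟨l, hl, b, hb, hlb⟩ := h _ (M.inv_mem a.2)
        refine ⟨((⟨b⁻¹, B.inv_mem hb⟩ : B) : B ⧸ L.subgroupOf B), ?_⟩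
        change ((Subgroup.inclusion hB ⟨b⁻¹, B.inv_mem hb⟩ : M) : M ⧸ L.subgroupOf M) = _
        rw [eq_comm, QuotientGroup.eq, Subgroup.mem_subgroupOf]
        simpa [hlb] using hl
  exact Nat.card_congr (Equiv.ofBijective f hf)

end Blocks

/-! ### Linear maps as permutations, and their determinants -/

section Linear

variable {F : Type*} [Field F]

theorem mem_linearGroup_iff {g : Equiv.Perm (V F)} :
    g ∈ linearGroup F ↔ ∃ A : Matrix (Fin 3) (Fin 3) F, ∀ u, g u = A.mulVec u := by
  constructor
  · rintro ⟨f, rfl⟩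
    refine ⟨LinearMap.toMatrix' (f : V F →ₗ[F] V F), fun u => ?_⟩
    rw [LinearMap.toMatrix'_mulVec]
    rfl
  · rintro ⟨A, hA⟩
    refine ⟨LinearEquiv.ofBijective (Matrix.mulVecLin A) ?_, ?_⟩
    · have : ⇑(Matrix.mulVecLin A) = g := by
        ext u : 1
        simp [hA]
      rw [this]
      exact g.bijective
    · ext u : 1
      simp [hA]

/-- `g` is the linear map with determinant `d`. -/
def HasDet (g : Equiv.Perm (V F)) (d : F) : Prop :=
  ∃ A : Matrix (Fin 3) (Fin 3) F, A.det = d ∧ ∀ u, g u = A.mulVec u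

theorem mem_linearGroup_iff_hasDet {g : Equiv.Perm (V F)} :
    g ∈ linearGroup F ↔ ∃ d, HasDet g d := by
  rw [mem_linearGroup_iff]
  constructor
  · rintro ⟨A, hA⟩
    exact ⟨_, A, rfl, hA⟩
  · rintro ⟨d, A, -, hA⟩
    exact ⟨A, hA⟩

theorem HasDet.mul {g h : Equiv.Perm (V F)} {a b : F} (hg : HasDet g a) (hh : HasDet h b) :
    HasDet (g * h) (a * b) := by
  obtain ⟨A, rfl, hA⟩ := hg
  obtain ⟨B, rfl, hB⟩ := hh
  exact ⟨A * B, Matrix.det_mul A B, fun u => by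
    rw [Equiv.Perm.mul_apply, hB, hA, Matrix.mulVec_mulVec]⟩

theorem HasDet.one : HasDet (1 : Equiv.Perm (V F)) 1 :=
  ⟨1, Matrix.det_one, fun u => by simp⟩

theorem HasDet.unique {g : Equiv.Perm (V F)} {a b : F} (hg : HasDet g a) (hh : HasDet g b) :
    a = b := by
  obtain ⟨A, rfl, hA⟩ := hg
  obtain ⟨B, rfl, hB⟩ := hh
  congr 1
  refine Matrix.ext_of_mulVec_single fun i => ?_
  rw [← hA, ← hB]

theorem HasDet.ne_zero {g : Equiv.Perm (V F)} {a : F} (hg : HasDet g a) : a ≠ 0 := by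
  have : g⁻¹ ∈ linearGroup F := (linearGroup F).inv_mem (mem_linearGroup_iff_hasDet.2 ⟨a, hg⟩)
  obtain ⟨b, hb⟩ := mem_linearGroup_iff_hasDet.1 this
  have h1 := hg.mul hb
  rw [mul_inv_cancel] at h1
  intro h0
  have := h1.unique HasDet.one
  rw [h0, zero_mul] at this
  exact zero_ne_one this

theorem HasDet.inv {g : Equiv.Perm (V F)} {a : F} (hg : HasDet g a) : HasDet g⁻¹ a⁻¹ := by
  have : g⁻¹ ∈ linearGroup F := (linearGroup F).inv_mem (mem_linearGroup_iff_hasDet.2 ⟨a, hg⟩)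
  obtain ⟨b, hb⟩ := mem_linearGroup_iff_hasDet.1 this
  have h1 := hg.mul hb
  rw [mul_inv_cancel] at h1
  rwa [← eq_inv_of_mul_eq_one_right (h1.unique HasDet.one)]

theorem HasDet.pow {g : Equiv.Perm (V F)} {a : F} (hg : HasDet g a) (n : ℕ) :
    HasDet (g ^ n) (a ^ n) := by
  induction n with
  | zero => simpa using HasDet.one
  | succ n ih => rw [pow_succ, pow_succ]; exact ih.mul hg

theorem mem_specialLinearGroup_iff {g : Equiv.Perm (V F)} :
    g ∈ specialLinearGroup F ↔ HasDet g 1 := by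
  constructor
  · rintro ⟨f, hf, rfl⟩
    refine ⟨LinearMap.toMatrix' (f : V F →ₗ[F] V F), ?_, fun u => ?_⟩
    · rw [LinearMap.det_toMatrix', ← LinearEquiv.coe_det]
      have : LinearEquiv.det f = 1 := hf
      rw [this]
      rfl
    · rw [LinearMap.toMatrix'_mulVec]
      rfl
  · rintro ⟨A, hdet, hA⟩
    have hfun : ⇑(Matrix.mulVecLin A) = g := by
      ext u : 1
      simp [hA]
    refine ⟨LinearEquiv.ofBijective (Matrix.mulVecLin A) ?_, ?_, ?_⟩
    · rw [hfun]
      exact g.bijective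
    · change LinearEquiv.det _ = 1
      rw [← Units.val_inj, LinearEquiv.coe_det]
      have : ((LinearEquiv.ofBijective (Matrix.mulVecLin A) (by
          rw [hfun]; exact g.bijective) : V F ≃ₗ[F] V F) : V F →ₗ[F] V F) = Matrix.toLin' A := by
        ext; simp
      rw [this, LinearMap.det_toLin', hdet]
      rfl
    · ext u : 1
      simp [hA]

theorem mem_Z_iff {g : Equiv.Perm (V F)} : g ∈ Z F ↔ ∃ a : F, a ≠ 0 ∧ ∀ u, g u = a • u := by
  constructor
  · rintro ⟨a, rfl⟩
    exact ⟨a, a.ne_zero, fun u => rfl⟩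
  · rintro ⟨a, ha, h⟩
    exact ⟨Units.mk0 a ha, by ext u : 1; rw [h]; rfl⟩

/-- The scalar map `a`. -/
def scalar (a : F) (ha : a ≠ 0) : Equiv.Perm (V F) :=
  MulAction.toPermHom Fˣ (V F) (Units.mk0 a ha)

theorem scalar_apply (a : F) (ha : a ≠ 0) (u : V F) : scalar a ha u = a • u := rfl

theorem scalar_mem (a : F) (ha : a ≠ 0) : scalar a ha ∈ Z F := ⟨_, rfl⟩

theorem hasDet_scalar (a : F) (ha : a ≠ 0) : HasDet (scalar a ha) (a ^ 3) :=
  ⟨a • 1, by simp, fun u => by rw [scalar_apply]; simp [Matrix.smul_mulVec]⟩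

/-- A linear map whose determinant is a cube lies in `Z SL₃`. -/
theorem HasDet.mem_of_cube {g : Equiv.Perm (V F)} {a : F} (hg : HasDet g (a ^ 3)) :
    g ∈ Z F ⊔ specialLinearGroup F := by
  have ha : a ≠ 0 := by
    rintro rfl
    exact hg.ne_zero (by simp)
  have h1 := (hasDet_scalar a ha).inv.mul hg
  rw [inv_mul_cancel₀ (pow_ne_zero 3 ha)] at h1
  have : g = scalar a ha * ((scalar a ha)⁻¹ * g) := by group
  rw [this]
  exact Subgroup.mul_mem_sup (scalar_mem a ha) (mem_specialLinearGroup_iff.2 h1)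

end Linear

/-! ### The Singer cycle as multiplication in a quadratic extension -/

section Model

universe w

variable {F : Type w} [Field F]

theorem mem_line_zero {u : V F} : u ∈ line F 0 ↔ u 1 = 0 ∧ u 2 = 0 := by
  rw [line, Submodule.mem_span_singleton]
  constructor
  · rintro ⟨a, rfl⟩
    simp [v]
  · rintro ⟨h1, h2⟩
    refine ⟨u 0, ?_⟩
    ext i
    fin_cases i <;> simp [v, h1, h2]

theorem mem_plane {u : V F} : u ∈ plane F ↔ u 0 = 0 := by
  rw [plane, Submodule.mem_span_pair]
  constructor
  · rintro ⟨a, b, rfl⟩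
    simp [v]
  · intro h
    refine ⟨u 1, u 2, ?_⟩
    ext i
    fin_cases i <;> simp [v, h]

variable {E : Type w} [Field E] [Algebra F E]

/-- The projection of `V` along `α₀` onto the quadratic extension with basis `1, θ`. -/
def proj (θ : E) (u : V F) : E := algebraMap F E (u 1) + algebraMap F E (u 2) * θ

theorem proj_add (θ : E) (u w : V F) : proj θ (u + w) = proj θ u + proj θ w := by
  simp [proj]; ring

theorem proj_smul (θ : E) (a : F) (u : V F) :
    proj θ (a • u) = algebraMap F E a * proj θ u := by
  simp [proj]; ring

/-- The Singer cycle `c` acts on `⟨v₁, v₂⟩` as multiplication by the generator `ζ` of the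
multiplicative group of the quadratic extension `E` with basis `1, θ`. -/
structure SingerModel (θ ζ : E) (c : Equiv.Perm (V F)) : Prop where
  span : ∀ z : E, ∃ a b : F, z = algebraMap F E a + algebraMap F E b * θ
  indep : ∀ a b : F, algebraMap F E a + algebraMap F E b * θ = 0 → a = 0 ∧ b = 0
  gen : ∀ z : E, z ≠ 0 → ∃ i : ℕ, z = ζ ^ i
  ne_zero : ζ ≠ 0
  zero_coord : ∀ u, c u 0 = u 0
  proj : ∀ u, proj θ (c u) = ζ * proj θ u

/-- The algebra of matrices `a + b B`. -/
def matrixAlgebra (B : Matrix (Fin 2) (Fin 2) F) : Subalgebra F (Matrix (Fin 2) (Fin 2) F) where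
  carrier := {X | ∃ a b : F, X = a • 1 + b • B}
  mul_mem' := by
    rintro _ _ ⟨a, b, rfl⟩ ⟨a', b', rfl⟩
    refine ⟨a * a' - b * b' * (B 0 0 * B 1 1 - B 0 1 * B 1 0),
      a * b' + b * a' + b * b' * (B 0 0 + B 1 1), ?_⟩
    ext i j
    fin_cases i <;> fin_cases j <;> simp [Matrix.mul_apply, Fin.sum_univ_two] <;> ring
  add_mem' := by
    rintro _ _ ⟨a, b, rfl⟩ ⟨a', b', rfl⟩
    exact ⟨a + a', b + b', by rw [add_smul, add_smul]; abel⟩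
  algebraMap_mem' := fun a => ⟨a, 0, by simp [Algebra.algebraMap_eq_smul_one]⟩

theorem mem_matrixAlgebra_self (B : Matrix (Fin 2) (Fin 2) F) : B ∈ matrixAlgebra B :=
  ⟨0, 1, by simp⟩

/-- The coordinates in `⟨v₁, v₂⟩`. -/
def planeCoord (u : V F) : Fin 2 → F := ![u 1, u 2]

theorem IsSingerCycle.exists_matrix {c : Equiv.Perm (V F)} (hc : IsSingerCycle c) :
    ∃ B : Matrix (Fin 2) (Fin 2) F, ∀ u, c u 0 = u 0 ∧ planeCoord (c u) = B.mulVec (planeCoord u) := by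
  obtain ⟨A, hA⟩ := mem_linearGroup_iff.1 hc.linear
  have h0 := hc.fixes
  have hp : ∀ u : V F, u 0 = 0 → c u 0 = 0 := by
    intro u hu
    have h1 := hc.plane
    rw [MulAction.mem_stabilizer_iff] at h1
    have h2 : c u ∈ c • (PlaneField.plane F : Set (V F)) := Set.smul_mem_smul_set (mem_plane.2 hu)
    rw [h1] at h2
    exact mem_plane.1 h2
  have e1 := hp (v F 1) (by simp [v])
  have e2 := hp (v F 2) (by simp [v])
  rw [hA] at h0 e1 e2
  have a0 := congrFun h0 0
  have a1 := congrFun h0 1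
  have a2 := congrFun h0 2
  simp [v] at a0 a1 a2 e1 e2
  refine ⟨!![A 1 1, A 1 2; A 2 1, A 2 2], fun u => ⟨?_, ?_⟩⟩
  · rw [hA]
    simp [Matrix.mulVec, dotProduct, Fin.sum_univ_three, a0, e1, e2]
  · ext i
    rw [hA]
    fin_cases i <;>
      simp [planeCoord, Matrix.mulVec, dotProduct, Fin.sum_univ_three, Fin.sum_univ_two, a1, a2]

/-- The 2 × 2 matrix B of `c` has order q² - 1, so 0 and its powers are q² different elements of
F[B] = {a + bB}, which has at most q² elements. Hence F[B] consists of 0 and the powers of B and is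
a field. Evaluation at the first basis vector identifies it with the plane. -/
theorem IsSingerCycle.exists_model [Finite F] {c : Equiv.Perm (V F)} (hc : IsSingerCycle c) :
    ∃ (E : Type w) (_ : Field E) (_ : Algebra F E) (_ : Finite E) (θ ζ : E),
      SingerModel θ ζ c := by
  obtain ⟨B, hB⟩ := hc.exists_matrix
  have hq : 2 ≤ Nat.card F := Finite.one_lt_card
  have hpow : ∀ (i : ℕ) u, (c ^ i) u 0 = u 0 ∧
      planeCoord ((c ^ i) u) = (B ^ i).mulVec (planeCoord u) := by
    intro i
    induction i with
    | zero => simp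
    | succ i ih =>
      intro u
      rw [pow_succ', pow_succ', Equiv.Perm.mul_apply]
      refine ⟨by rw [(hB _).1, (ih u).1], ?_⟩
      rw [(hB _).2, (ih u).2, Matrix.mulVec_mulVec]
  have hone : ∀ i : ℕ, B ^ i = 1 → Nat.card F ^ 2 - 1 ∣ i := by
    intro i hi
    rw [← hc.order, orderOf_dvd_iff_pow_eq_one]
    ext u j
    have h1 := (hpow i u).1
    have h2 := (hpow i u).2
    rw [hi, Matrix.one_mulVec] at h2
    have h3 := congrFun h2 0
    have h4 := congrFun h2 1
    simp only [planeCoord, Matrix.cons_val_zero, Matrix.cons_val_one] at h3 h4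
    fin_cases j
    · exact h1
    · exact h3
    · exact h4
  have hone' : B ^ (Nat.card F ^ 2 - 1) = 1 := by
    refine Matrix.ext_of_mulVec_single fun i => ?_
    have := (hpow (Nat.card F ^ 2 - 1) ![0, (Pi.single i 1 : Fin 2 → F) 0, (Pi.single i 1 : Fin 2 → F) 1]).2
    rw [← hc.order, pow_orderOf_eq_one] at this
    rw [← hc.order, Matrix.one_mulVec]
    have hs : planeCoord ![0, (Pi.single i 1 : Fin 2 → F) 0, (Pi.single i 1 : Fin 2 → F) 1] =
        (Pi.single i 1 : Fin 2 → F) := by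
      ext j; fin_cases j <;> rfl
    rw [Equiv.Perm.one_apply, hs] at this
    exact this.symm
  have hq2 : 1 < Nat.card F ^ 2 := by nlinarith
  have hunit : IsUnit B := IsUnit.of_pow_eq_one hone' (by omega)
  have hBpow : ∀ i j : ℕ, B ^ i = B ^ j → i ≤ j → Nat.card F ^ 2 - 1 ∣ j - i := by
    intro i j hij hle
    apply hone
    have : B ^ j = B ^ i * B ^ (j - i) := by rw [← pow_add]; congr 1; omega
    rw [this] at hij
    exact ((hunit.pow i).mul_left_cancel (by rw [mul_one]; exact hij)).symm
  let S := matrixAlgebra B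
  let b : S := ⟨B, mem_matrixAlgebra_self B⟩
  -- The value at `none` is 0, so that the source has exactly q² elements.
  let f : Option (Fin (Nat.card F ^ 2 - 1)) → S := fun o => o.elim 0 (fun i => b ^ (i : ℕ))
  have hbne : ∀ i : ℕ, b ^ i ≠ 0 := by
    intro i h
    have : B ^ i = 0 := congrArg Subtype.val h
    exact (hunit.pow i).ne_zero this
  have hfinj : Function.Injective f := by
    rintro (_ | i) (_ | j) h
    · rfl
    · exact absurd h.symm (hbne j)
    · exact absurd h (hbne i)
    · have h' : B ^ (i : ℕ) = B ^ (j : ℕ) := congrArg Subtype.val h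
      have hi := i.2
      have hj := j.2
      congr 1
      ext
      rcases le_total (i : ℕ) j with hle | hle
      · have := Nat.eq_zero_of_dvd_of_lt (hBpow _ _ h' hle) (by omega)
        omega
      · have := Nat.eq_zero_of_dvd_of_lt (hBpow _ _ h'.symm hle) (by omega)
        omega
  have hcard : Nat.card S ≤ Nat.card F ^ 2 := by
    have : Nat.card (F × F) = Nat.card F ^ 2 := by rw [Nat.card_prod, sq]
    rw [← this]
    refine Nat.card_le_card_of_surjective
      (fun x : F × F => (⟨x.1 • 1 + x.2 • B, x.1, x.2, rfl⟩ : S)) ?_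
    rintro ⟨_, a, b, rfl⟩
    exact ⟨(a, b), rfl⟩
  have hfbij : Function.Bijective f := by
    refine hfinj.bijective_of_nat_card_le ?_
    rw [Nat.card_eq_fintype_card (α := Option _), Fintype.card_option, Fintype.card_fin]
    omega
  have hgen : ∀ z : S, z ≠ 0 → ∃ i : ℕ, z = b ^ i := by
    intro z hz
    obtain ⟨o, ho⟩ := hfbij.2 z
    rcases o with _ | i
    · exact absurd ho.symm hz
    · exact ⟨i, ho.symm⟩
  have hbq : b ^ (Nat.card F ^ 2 - 1) = 1 := Subtype.ext hone'
  have hfield : IsField S := by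
    refine ⟨⟨0, 1, ?_⟩, ?_, ?_⟩
    · have := hbne 0
      rw [pow_zero] at this
      exact this.symm
    · intro x y
      by_cases hx : x = 0
      · simp [hx]
      by_cases hy : y = 0
      · simp [hy]
      obtain ⟨i, rfl⟩ := hgen x hx
      obtain ⟨j, rfl⟩ := hgen y hy
      rw [← pow_add, ← pow_add, add_comm]
    · intro x hx
      obtain ⟨i, rfl⟩ := hgen x hx
      -- The inverse b^{-i}, with a multiple of q² - 1 added to keep the exponent natural.
      refine ⟨b ^ (i * (Nat.card F ^ 2 - 1) - i), ?_⟩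
      rw [← pow_add, Nat.add_sub_cancel', mul_comm, pow_mul, hbq, one_pow]
      exact Nat.le_mul_of_pos_right _ (by omega)
  let e1 : Fin 2 → F := Pi.single 0 1
  have hinj : ∀ z : S, (z : Matrix (Fin 2) (Fin 2) F).mulVec e1 = 0 → z = 0 := by
    intro z hz
    by_contra hne
    obtain ⟨i, rfl⟩ := hgen z hne
    have h1 : (B ^ i).mulVec e1 = 0 := hz
    have hdet := (Matrix.isUnit_iff_isUnit_det _).1 (hunit.pow i)
    have h2 := Matrix.eq_zero_of_mulVec_eq_zero hdet.ne_zero h1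
    have := congrFun h2 0
    simp [e1] at this
  have hbij : Function.Bijective (fun z : S => (z : Matrix (Fin 2) (Fin 2) F).mulVec e1) := by
    refine Function.Injective.bijective_of_nat_card_le ?_ ?_
    · intro x y hxy
      have : (x - y : S) = 0 := by
        apply hinj
        simp only at hxy
        rw [AddSubgroupClass.coe_sub, Matrix.sub_mulVec, hxy, sub_self]
      exact sub_eq_zero.1 this
    · rw [Nat.card_fun, Nat.card_eq_fintype_card (α := Fin 2), Fintype.card_fin,
        ← Nat.card_congr (Equiv.ofBijective f hfbij), Nat.card_eq_fintype_card (α := Option _),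
        Fintype.card_option, Fintype.card_fin]
      omega
  -- θ is the field element that maps the first basis vector to the second, so a + bθ evaluates to
  -- (a, b).
  obtain ⟨θ, hθ⟩ := hbij.2 (Pi.single 1 1)
  have hcomb : ∀ a b : F, ((algebraMap F S a + algebraMap F S b * θ : S) :
      Matrix (Fin 2) (Fin 2) F).mulVec e1 = ![a, b] := by
    intro a b
    have : ((algebraMap F S a + algebraMap F S b * θ : S) : Matrix (Fin 2) (Fin 2) F) =
        a • 1 + b • (θ : Matrix (Fin 2) (Fin 2) F) := by
      rw [Algebra.algebraMap_eq_smul_one, Algebra.algebraMap_eq_smul_one, smul_mul_assoc, one_mul]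
      rfl
    simp only at hθ
    rw [this, Matrix.add_mulVec, Matrix.smul_mulVec, Matrix.smul_mulVec, hθ, Matrix.one_mulVec]
    ext i
    fin_cases i <;> simp [e1]
  let : Field S := hfield.toField
  refine ⟨S, hfield.toField, (inferInstanceAs (Algebra F S)), inferInstance, θ, b, ?_, ?_, hgen, ?_,
    fun u => (hB u).1, ?_⟩
  · intro z
    refine ⟨(z : Matrix (Fin 2) (Fin 2) F).mulVec e1 0, (z : Matrix (Fin 2) (Fin 2) F).mulVec e1 1, ?_⟩
    refine hbij.1 ?_
    refine Eq.trans ?_ (hcomb _ _).symm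
    ext i
    fin_cases i <;> rfl
  · intro a b hab
    have h1 := hcomb a b
    have h2 : ((algebraMap F S a + algebraMap F S b * θ : S) : Matrix (Fin 2) (Fin 2) F) = 0 :=
      congrArg Subtype.val hab
    rw [h2, Matrix.zero_mulVec] at h1
    exact ⟨(congrFun h1 0).symm, (congrFun h1 1).symm⟩
  · have := hbne 1
    rw [pow_one] at this
    exact this
  · intro u
    refine hbij.1 ?_
    have h1 : ∀ u : V F, ((proj θ u : S) : Matrix (Fin 2) (Fin 2) F).mulVec e1 = planeCoord u :=
      fun u => hcomb _ _
    change ((proj θ (c u) : S) : Matrix (Fin 2) (Fin 2) F).mulVec e1 =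
      (B * ((proj θ u : S) : Matrix (Fin 2) (Fin 2) F)).mulVec e1
    rw [h1, (hB u).2, ← Matrix.mulVec_mulVec, h1]

end Model

/-! ### Semilinear maps and the involution s -/

section Semilinear

variable {F : Type*} [Field F]

theorem apply_inv_cancel {α : Type*} (g : Equiv.Perm α) (u : α) : g (g⁻¹ u) = u :=
  g.apply_symm_apply u

/-- `g` is semilinear with field automorphism `σ`. -/
def Semi (σ : RingAut F) (g : Equiv.Perm (V F)) : Prop :=
  (∀ u w, g (u + w) = g u + g w) ∧ ∀ (a : F) (u : V F), g (a • u) = σ a • g u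

theorem mem_GammaL_iff {g : Equiv.Perm (V F)} : g ∈ GammaL F ↔ ∃ σ, Semi σ g :=
  ⟨fun ⟨h, σ, hσ⟩ => ⟨σ, h, hσ⟩, fun ⟨σ, h, hσ⟩ => ⟨h, σ, hσ⟩⟩

theorem Semi.mem {σ : RingAut F} {g : Equiv.Perm (V F)} (h : Semi σ g) : g ∈ GammaL F :=
  mem_GammaL_iff.2 ⟨σ, h⟩

theorem Semi.one : Semi (1 : RingAut F) 1 := ⟨fun _ _ => rfl, fun _ _ => rfl⟩

theorem Semi.mul {σ τ : RingAut F} {f g : Equiv.Perm (V F)} (hf : Semi σ f) (hg : Semi τ g) :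
    Semi (σ * τ) (f * g) :=
  ⟨fun u w => by simp [Equiv.Perm.mul_apply, hf.1, hg.1],
    fun a u => by simp [Equiv.Perm.mul_apply, hf.2, hg.2]⟩

theorem Semi.inv {σ : RingAut F} {f : Equiv.Perm (V F)} (hf : Semi σ f) : Semi σ⁻¹ f⁻¹ := by
  refine ⟨fun u w => ?_, fun a u => ?_⟩
  · rw [Equiv.Perm.inv_eq_iff_eq, hf.1]
    simp
  · rw [Equiv.Perm.inv_eq_iff_eq, hf.2, ← RingAut.mul_apply]
    simp

theorem Semi.map_zero {σ : RingAut F} {f : Equiv.Perm (V F)} (hf : Semi σ f) : f 0 = 0 := by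
  have := hf.2 0 0
  simpa using this

theorem Semi.map_neg {σ : RingAut F} {f : Equiv.Perm (V F)} (hf : Semi σ f) (u : V F) :
    f (-u) = - f u := by
  have := hf.2 (-1) u
  simpa using this

theorem Semi.map_ne_zero {σ : RingAut F} {f : Equiv.Perm (V F)} (hf : Semi σ f) {u : V F}
    (hu : u ≠ 0) : f u ≠ 0 := by
  rw [← hf.map_zero]
  exact fun h => hu (f.injective h)

theorem v_ne_zero (i : Fin 3) : v F i ≠ 0 := by
  intro h
  have := congrFun h i
  simp [v] at this

theorem Semi.unique {σ τ : RingAut F} {f : Equiv.Perm (V F)} (hf : Semi σ f) (hg : Semi τ f) :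
    σ = τ := by
  ext a
  have h := (hf.2 a (v F 0)).symm.trans (hg.2 a (v F 0))
  exact smul_left_injective F (hf.map_ne_zero (v_ne_zero 0)) h

theorem vec_eq (u : V F) : u = u 0 • v F 0 + u 1 • v F 1 + u 2 • v F 2 := by
  ext i
  fin_cases i <;> simp [v]

theorem Semi.apply_eq {σ : RingAut F} {f : Equiv.Perm (V F)} (hf : Semi σ f) (u : V F) :
    f u = σ (u 0) • f (v F 0) + σ (u 1) • f (v F 1) + σ (u 2) • f (v F 2) := by
  conv_lhs => rw [vec_eq u]
  rw [hf.1, hf.1, hf.2, hf.2, hf.2]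

theorem mem_linearGroup_iff_semi {g : Equiv.Perm (V F)} : g ∈ linearGroup F ↔ Semi 1 g := by
  constructor
  · rintro ⟨f, rfl⟩
    exact ⟨fun u w => map_add f u w, fun a u => map_smul f a u⟩
  · intro h
    refine ⟨LinearEquiv.ofBijective
      ({ toFun := g, map_add' := h.1, map_smul' := h.2 } : V F →ₗ[F] V F) g.bijective, ?_⟩
    ext u : 1
    rfl

theorem Z_le_linearGroup : Z F ≤ linearGroup F := by
  intro g hg
  obtain ⟨a, -, h⟩ := mem_Z_iff.1 hg
  rw [mem_linearGroup_iff_semi]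
  exact ⟨fun u w => by simp [h], fun b u => by simp [h, smul_comm a b]⟩

theorem s_apply (u : V F) : s F u = ![u 1, u 0, -u 2] := rfl

theorem s_mul_s : s F * s F = 1 := by
  ext u i
  rw [Equiv.Perm.mul_apply, s_apply, s_apply]
  fin_cases i <;> simp

theorem s_inv : (s F)⁻¹ = s F := inv_eq_of_mul_eq_one_left s_mul_s

theorem hasDet_s : HasDet (s F) 1 := by
  refine ⟨!![0, 1, 0; 1, 0, 0; 0, 0, -1], by simp [Matrix.det_fin_three], fun u => ?_⟩
  ext i
  fin_cases i <;> simp [s_apply, Matrix.mulVec, dotProduct, Fin.sum_univ_three]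

theorem s_mem_SL : s F ∈ specialLinearGroup F := mem_specialLinearGroup_iff.2 hasDet_s

theorem s_mem_linearGroup : s F ∈ linearGroup F := mem_linearGroup_iff_hasDet.2 ⟨1, hasDet_s⟩

theorem semi_s : Semi 1 (s F) := mem_linearGroup_iff_semi.1 s_mem_linearGroup

theorem s_v0 : s F (v F 0) = v F 1 := by
  ext i; fin_cases i <;> simp [s_apply, v]

theorem s_v1 : s F (v F 1) = v F 0 := by
  ext i; fin_cases i <;> simp [s_apply, v]

theorem s_v2 : s F (v F 2) = - v F 2 := by
  ext i; fin_cases i <;> simp [s_apply, v]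

theorem s_conj_semi {σ : RingAut F} {g : Equiv.Perm (V F)} (h : Semi σ g) :
    Semi σ (s F * g * s F) := by
  simpa using (semi_s.mul h).mul semi_s

end Semilinear

/-! ### Maps that are semilinear over E on V/α₀, and the groups W and WZ -/

section Acts

variable {F E : Type w} [Field F] [Field E] [Algebra F E]

/-- `g` is semilinear and induces on `V / α₀ ≅ E` a semilinear map with automorphism `τ`. -/
def Acts (θ : E) (τ : RingAut E) (g : Equiv.Perm (V F)) : Prop :=
  g ∈ GammaL F ∧ ∃ a : E, a ≠ 0 ∧ ∀ u, proj θ (g u) = a * τ (proj θ u)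

/-- `g` is semilinear, preserves `⟨v₁, v₂⟩ ≅ E` and acts on it as `a τ`, and fixes `v₀`. -/
structure Frame (θ : E) (a : E) (τ : RingAut E) (σ : RingAut F) (g : Equiv.Perm (V F)) : Prop where
  semi : Semi σ g
  zero : ∀ u, g u 0 = σ (u 0)
  proj : ∀ u, proj θ (g u) = a * τ (proj θ u)

variable {θ : E}

theorem Acts.one : Acts θ 1 (1 : Equiv.Perm (V F)) :=
  ⟨(GammaL F).one_mem, 1, one_ne_zero, fun u => by simp⟩

theorem Acts.mul {σ τ : RingAut E} {f g : Equiv.Perm (V F)} (hf : Acts θ σ f) (hg : Acts θ τ g) :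
    Acts θ (σ * τ) (f * g) := by
  obtain ⟨hf, a, ha, hfa⟩ := hf
  obtain ⟨hg, b, hb, hgb⟩ := hg
  refine ⟨(GammaL F).mul_mem hf hg, a * σ b, mul_ne_zero ha (by simpa using hb), fun u => ?_⟩
  rw [Equiv.Perm.mul_apply, hfa, hgb, map_mul, RingAut.mul_apply, mul_assoc]

theorem Acts.inv {τ : RingAut E} {g : Equiv.Perm (V F)} (hg : Acts θ τ g) :
    Acts θ τ⁻¹ g⁻¹ := by
  obtain ⟨hg, a, ha, hga⟩ := hg
  refine ⟨(GammaL F).inv_mem hg, τ⁻¹ a⁻¹, by simpa using ha, fun u => ?_⟩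
  have := hga (g⁻¹ u)
  rw [apply_inv_cancel] at this
  rw [this, ← map_mul, inv_mul_cancel_left₀ ha, ← RingAut.mul_apply]
  simp

theorem Frame.acts {a : E} {τ : RingAut E} {σ : RingAut F} {g : Equiv.Perm (V F)}
    (h : Frame θ a τ σ g) (ha : a ≠ 0) : Acts θ τ g := ⟨h.semi.mem, a, ha, h.proj⟩

theorem Frame.one : Frame θ 1 1 1 (1 : Equiv.Perm (V F)) :=
  ⟨Semi.one, fun _ => rfl, fun _ => by simp⟩

theorem Frame.mul {a b : E} {τ τ' : RingAut E} {σ σ' : RingAut F} {f g : Equiv.Perm (V F)}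
    (hf : Frame θ a τ σ f) (hg : Frame θ b τ' σ' g) :
    Frame θ (a * τ b) (τ * τ') (σ * σ') (f * g) :=
  ⟨hf.semi.mul hg.semi, fun u => by rw [Equiv.Perm.mul_apply, hf.zero, hg.zero]; rfl,
    fun u => by rw [Equiv.Perm.mul_apply, hf.proj, hg.proj, map_mul, RingAut.mul_apply, mul_assoc]⟩

theorem Frame.inv {a : E} (ha : a ≠ 0) {τ : RingAut E} {σ : RingAut F} {g : Equiv.Perm (V F)}
    (hg : Frame θ a τ σ g) : Frame θ (τ⁻¹ a⁻¹) τ⁻¹ σ⁻¹ g⁻¹ := by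
  refine ⟨hg.semi.inv, fun u => ?_, fun u => ?_⟩
  · have := hg.zero (g⁻¹ u)
    rw [apply_inv_cancel] at this
    rw [this, ← RingAut.mul_apply]
    simp
  · have := hg.proj (g⁻¹ u)
    rw [apply_inv_cancel] at this
    rw [this, ← map_mul, inv_mul_cancel_left₀ ha, ← RingAut.mul_apply]
    simp

theorem Frame.pow_one {a : E} {g : Equiv.Perm (V F)} (hg : Frame θ a 1 1 g) (n : ℕ) :
    Frame θ (a ^ n) 1 1 (g ^ n) := by
  induction n with
  | zero => simpa using Frame.one
  | succ n ih => rw [pow_succ, pow_succ]; simpa using ih.mul hg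

theorem Frame.one_pow {τ : RingAut E} {σ : RingAut F} {g : Equiv.Perm (V F)}
    (hg : Frame θ 1 τ σ g) (n : ℕ) : Frame θ 1 (τ ^ n) (σ ^ n) (g ^ n) := by
  induction n with
  | zero => simpa using Frame.one
  | succ n ih => rw [pow_succ, pow_succ, pow_succ]; simpa using ih.mul hg

theorem Frame.v0 {a : E} {τ : RingAut E} {σ : RingAut F} {g : Equiv.Perm (V F)}
    (hθ : ∀ a b : F, algebraMap F E a + algebraMap F E b * θ = 0 → a = 0 ∧ b = 0)
    (h : Frame θ a τ σ g) : g (v F 0) = v F 0 := by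
  have h1 := h.zero (v F 0)
  have h2 := h.proj (v F 0)
  have : PlaneField.proj θ (v F 0) = 0 := by simp [PlaneField.proj, v]
  rw [this] at h2
  have h3 := hθ (g (v F 0) 1) (g (v F 0) 2) (by simpa [PlaneField.proj] using h2)
  ext i
  fin_cases i
  · simpa [v] using h1
  · simpa [v] using h3.1
  · simpa [v] using h3.2

theorem proj_v0 : proj θ (v F 0) = 0 := by simp [proj, v]
theorem proj_v1 : proj θ (v F 1) = 1 := by simp [proj, v]
theorem proj_v2 : proj θ (v F 2) = θ := by simp [proj, v]

theorem proj_neg (u : V F) : proj θ (-u) = - proj θ u := by simp [proj]; ring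

namespace SingerModel

variable {ζ : E} {c : Equiv.Perm (V F)} (hm : SingerModel θ ζ c)
include hm

theorem proj_eq_zero {u : V F} (h : PlaneField.proj θ u = 0) : u 1 = 0 ∧ u 2 = 0 :=
  hm.indep _ _ h

theorem ext {u w : V F} (h0 : u 0 = w 0) (h : PlaneField.proj θ u = PlaneField.proj θ w) :
    u = w := by
  have h1 := hm.indep (u 1 - w 1) (u 2 - w 2) (by
    rw [map_sub, map_sub, sub_mul]
    rw [PlaneField.proj, PlaneField.proj] at h
    linear_combination h)
  ext i
  fin_cases i
  · exact h0
  · exact sub_eq_zero.1 h1.1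
  · exact sub_eq_zero.1 h1.2

theorem exists_vec (a : F) (z : E) : ∃ u : V F, u 0 = a ∧ PlaneField.proj θ u = z := by
  obtain ⟨b, b', rfl⟩ := hm.span z
  exact ⟨![a, b, b'], by simp, by simp [PlaneField.proj]⟩

/-- The coordinates with respect to `V = α₀ ⊕ ⟨v₁, v₂⟩ ≅ F × E`. -/
noncomputable def coord : V F ≃ F × E :=
  Equiv.ofBijective (fun u => (u 0, PlaneField.proj θ u))
    ⟨fun u w h => hm.ext (congrArg Prod.fst h) (congrArg Prod.snd h), fun x => by
      obtain ⟨u, h0, h1⟩ := hm.exists_vec x.1 x.2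
      exact ⟨u, Prod.ext h0 h1⟩⟩

theorem frame_ext {a : E} {τ : RingAut E} {σ : RingAut F} {f g : Equiv.Perm (V F)}
    (hf : Frame θ a τ σ f) (hg : Frame θ a τ σ g) : f = g := by
  ext u : 1
  refine hm.ext ?_ ?_
  · rw [hf.zero, hg.zero]
  · rw [hf.proj, hg.proj]

theorem exists_frame {a : E} (ha : a ≠ 0) {τ : RingAut E} {σ : RingAut F}
    (h : ∀ k, τ (algebraMap F E k) = algebraMap F E (σ k)) : ∃ g, Frame (F := F) θ a τ σ g := by
  let g : Equiv.Perm (V F) := hm.coord.trans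
    ((Equiv.prodCongr σ.toEquiv (τ.toEquiv.trans (Equiv.mulLeft₀ a ha))).trans hm.coord.symm)
  have hg : ∀ u, hm.coord (g u) = (σ (u 0), a * τ (PlaneField.proj θ u)) := by
    intro u
    simp only [g, Equiv.trans_apply, Equiv.apply_symm_apply]
    rfl
  have h0 : ∀ u, g u 0 = σ (u 0) := fun u => congrArg Prod.fst (hg u)
  have h1 : ∀ u, PlaneField.proj θ (g u) = a * τ (PlaneField.proj θ u) :=
    fun u => congrArg Prod.snd (hg u)
  refine ⟨g, ⟨fun u w => hm.ext ?_ ?_, fun k u => hm.ext ?_ ?_⟩, h0, h1⟩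
  · simp [h0]
  · simp only [h1, proj_add, map_add, mul_add]
  · simp [h0]
  · simp only [h1, proj_smul, map_mul, h]
    ring

theorem frame_c : Frame θ ζ 1 1 c := by
  have hadd : ∀ u w, c (u + w) = c u + c w := by
    intro u w
    refine hm.ext ?_ ?_
    · simp [hm.zero_coord]
    · simp only [hm.proj, proj_add, mul_add]
  refine ⟨⟨hadd, fun k u => hm.ext ?_ ?_⟩, hm.zero_coord, hm.proj⟩
  · simp [hm.zero_coord]
  · simp only [hm.proj, proj_smul, RingAut.one_apply]
    ring

theorem acts_v0 {τ : RingAut E} {g : Equiv.Perm (V F)} (h : Acts θ τ g) :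
    ∃ μ : F, μ ≠ 0 ∧ g (v F 0) = μ • v F 0 := by
  obtain ⟨hg, a, ha, hga⟩ := h
  obtain ⟨σ, hσ⟩ := mem_GammaL_iff.1 hg
  have h1 := hga (v F 0)
  rw [proj_v0, map_zero, mul_zero] at h1
  obtain ⟨h2, h3⟩ := hm.proj_eq_zero h1
  have h4 : g (v F 0) = (g (v F 0) 0) • v F 0 := by
    ext i
    fin_cases i <;> simp [v] at h2 h3 ⊢ <;> assumption
  refine ⟨g (v F 0) 0, fun h0 => ?_, h4⟩
  rw [h0, zero_smul] at h4
  exact hσ.map_ne_zero (v_ne_zero 0) h4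

omit hm in
theorem acts_restrict {τ : RingAut E} {σ : RingAut F} {g : Equiv.Perm (V F)} (h : Acts θ τ g)
    (hσ : Semi σ g) (k : F) : τ (algebraMap F E k) = algebraMap F E (σ k) := by
  obtain ⟨-, a, ha, hga⟩ := h
  have h1 := hga (k • v F 1)
  rw [hσ.2, proj_smul, proj_smul, hga, proj_v1, map_one, mul_one, mul_one, mul_comm] at h1
  exact (mul_left_cancel₀ ha h1).symm

theorem acts_unique {τ τ' : RingAut E} {g : Equiv.Perm (V F)} (h : Acts θ τ g)
    (h' : Acts θ τ' g) : τ = τ' := by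
  obtain ⟨-, a, ha, hga⟩ := h
  obtain ⟨-, b, hb, hgb⟩ := h'
  have hab : a = b := by
    have h1 := hga (v F 1)
    rw [hgb, proj_v1] at h1
    simpa using h1.symm
  subst hab
  ext z
  obtain ⟨u, -, rfl⟩ := hm.exists_vec 0 z
  exact mul_left_cancel₀ ha ((hga u).symm.trans (hgb u))

omit hm in
theorem acts_one_semi {g : Equiv.Perm (V F)} (h : Acts θ 1 g) : Semi 1 g := by
  obtain ⟨σ, hσ⟩ := mem_GammaL_iff.1 h.1
  have : σ = 1 := by
    ext k
    exact ((algebraMap F E).injective (acts_restrict h hσ k)).symm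
  rwa [this] at hσ

/-- A map that is trivial on α₀ and on V/α₀ is linear of determinant one. It therefore lies in `G`
automatically, and W does not depend on `G`. -/
theorem mem_W_iff {G : Subgroup (Equiv.Perm (V F))} (hG : G ≤ GammaL F)
    (hSG : specialLinearGroup F ≤ G) {h : Equiv.Perm (V F)} :
    h ∈ W G ↔ Semi 1 h ∧ h (v F 0) = v F 0 ∧ ∀ u, PlaneField.proj θ (h u) = PlaneField.proj θ u := by
  constructor
  · rintro ⟨hhG, h0, h1⟩
    have hv : ∀ a : F, h (a • v F 0) = a • v F 0 := fun a =>
      h0 _ (Submodule.smul_mem _ _ (Submodule.mem_span_singleton_self _))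
    obtain ⟨σ, hσ⟩ := mem_GammaL_iff.1 (hG hhG)
    have hv0 : h (v F 0) = v F 0 := by simpa using hv 1
    have : σ = 1 := by
      ext a
      have h2 := hσ.2 a (v F 0)
      rw [hv, hv0] at h2
      exact (smul_left_injective F (v_ne_zero 0) h2).symm
    subst this
    refine ⟨hσ, hv0, fun u => ?_⟩
    have h2 := mem_line_zero.1 (h1 u)
    simp only [Pi.sub_apply, sub_eq_zero] at h2
    rw [PlaneField.proj, PlaneField.proj, h2.1, h2.2]
  · rintro ⟨hs, h0, h1⟩
    have h2 : ∀ u, h u 1 = u 1 ∧ h u 2 = u 2 := by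
      intro u
      have := hm.proj_eq_zero (u := h u + -u) (by rw [proj_add, proj_neg, h1]; ring)
      simpa [add_neg_eq_zero] using this
    refine ⟨hSG (mem_specialLinearGroup_iff.2 ?_), ?_, ?_⟩
    · obtain ⟨A, hA⟩ := mem_linearGroup_iff.1 (mem_linearGroup_iff_semi.2 hs)
      refine ⟨A, ?_, hA⟩
      have e0 := h0
      have e1 := h2 (v F 1)
      have e2 := h2 (v F 2)
      rw [hA] at e0 e1 e2
      have a0 := congrFun e0 0
      have a1 := congrFun e0 1
      have a2 := congrFun e0 2
      simp [v] at a0 a1 a2 e1 e2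
      simp [Matrix.det_fin_three, a0, a1, a2, e1, e2]
    · intro u hu
      obtain ⟨a, rfl⟩ := Submodule.mem_span_singleton.1 hu
      rw [hs.2, h0]
      rfl
    · intro u
      rw [mem_line_zero]
      simp [h2 u]

theorem mem_WZ_iff {G : Subgroup (Equiv.Perm (V F))} (hG : G ≤ GammaL F)
    (hSG : specialLinearGroup F ≤ G) {h : Equiv.Perm (V F)} :
    h ∈ W G ⊔ Z F ↔ ∃ μ : F, μ ≠ 0 ∧ Semi 1 h ∧ h (v F 0) = μ • v F 0 ∧
      ∀ u, PlaneField.proj θ (h u) = algebraMap F E μ * PlaneField.proj θ u := by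
  constructor
  · let K : Subgroup (Equiv.Perm (V F)) :=
      { carrier := {h | ∃ μ : F, μ ≠ 0 ∧ Semi 1 h ∧ h (v F 0) = μ • v F 0 ∧
          ∀ u, PlaneField.proj θ (h u) = algebraMap F E μ * PlaneField.proj θ u}
        one_mem' := ⟨1, one_ne_zero, Semi.one, by simp, fun u => by simp⟩
        mul_mem' := by
          rintro f g ⟨a, ha, hf, hf0, hf1⟩ ⟨b, hb, hg, hg0, hg1⟩
          refine ⟨a * b, mul_ne_zero ha hb, by simpa using hf.mul hg, ?_, fun u => ?_⟩
          · rw [Equiv.Perm.mul_apply, hg0, hf.2, hf0, RingAut.one_apply, smul_smul, mul_comm]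
          · rw [Equiv.Perm.mul_apply, hf1, hg1, map_mul, mul_assoc]
        inv_mem' := by
          rintro f ⟨a, ha, hf, hf0, hf1⟩
          have ha' : algebraMap F E a ≠ 0 := by simpa using ha
          refine ⟨a⁻¹, inv_ne_zero ha, by simpa using hf.inv, ?_, fun u => ?_⟩
          · rw [Equiv.Perm.inv_eq_iff_eq, hf.2, hf0, RingAut.one_apply, smul_smul,
              inv_mul_cancel₀ ha, one_smul]
          · have := hf1 (f⁻¹ u)
            rw [apply_inv_cancel] at this
            rw [this, map_inv₀, inv_mul_cancel_left₀ ha'] }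
    have hK : W G ⊔ Z F ≤ K := by
      refine sup_le (fun w hw => ?_) (fun z hz => ?_)
      · obtain ⟨h1, h2, h3⟩ := (hm.mem_W_iff hG hSG).1 hw
        exact ⟨1, one_ne_zero, h1, by rw [h2, one_smul], fun u => by rw [h3, map_one, one_mul]⟩
      · obtain ⟨a, ha, h⟩ := mem_Z_iff.1 hz
        exact ⟨a, ha, mem_linearGroup_iff_semi.1 (Z_le_linearGroup hz), h _,
          fun u => by rw [h, proj_smul]⟩
    exact fun hh => hK hh
  · rintro ⟨μ, hμ, hs, h0, h1⟩
    have : h = (h * (scalar μ hμ)⁻¹) * scalar μ hμ := by group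
    rw [this]
    refine Subgroup.mul_mem_sup ((hm.mem_W_iff hG hSG).2 ?_) (scalar_mem μ hμ)
    have hinv : ∀ u, (scalar μ hμ)⁻¹ u = μ⁻¹ • u := by
      intro u
      rw [Equiv.Perm.inv_eq_iff_eq, scalar_apply, smul_smul, mul_inv_cancel₀ hμ, one_smul]
    refine ⟨?_, ?_, fun u => ?_⟩
    · simpa using hs.mul (mem_linearGroup_iff_semi.1 (Z_le_linearGroup (scalar_mem μ hμ))).inv
    · rw [Equiv.Perm.mul_apply, hinv, hs.2, h0, RingAut.one_apply, smul_smul,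
        inv_mul_cancel₀ hμ, one_smul]
    · rw [Equiv.Perm.mul_apply, hinv, h1, proj_smul, ← mul_assoc, ← map_mul,
        mul_inv_cancel₀ hμ, map_one, one_mul]

end SingerModel
end Acts

/-! ### Maps compatible with the structure on V/α₀ and with its conjugate under s -/

section Pairs

variable {F E : Type w} [Field F] [Field E] [Algebra F E] {θ ζ : E} {c : Equiv.Perm (V F)}

/-- The transvection `u ↦ u + (k₁ u₁ + k₂ u₂) v₀`. -/
def transvec (k₁ k₂ : F) : Equiv.Perm (V F) where
  toFun u := ![u 0 + (k₁ * u 1 + k₂ * u 2), u 1, u 2]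
  invFun u := ![u 0 - (k₁ * u 1 + k₂ * u 2), u 1, u 2]
  left_inv u := by ext i; fin_cases i <;> simp
  right_inv u := by ext i; fin_cases i <;> simp

theorem transvec_apply (k₁ k₂ : F) (u : V F) :
    transvec k₁ k₂ u = ![u 0 + (k₁ * u 1 + k₂ * u 2), u 1, u 2] := rfl

theorem proj_transvec (k₁ k₂ : F) (u : V F) : proj θ (transvec k₁ k₂ u) = proj θ u := by
  simp [transvec_apply, proj]

theorem semi_transvec (k₁ k₂ : F) : Semi 1 (transvec k₁ k₂) := by
  refine ⟨fun u w => ?_, fun a u => ?_⟩ <;> ext i <;> fin_cases i <;>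
    simp [transvec_apply] <;> ring

theorem transvec_v0 (k₁ k₂ : F) : transvec k₁ k₂ (v F 0) = v F 0 := by
  ext i; fin_cases i <;> simp [transvec_apply, v]

namespace SingerModel
variable (hm : SingerModel θ ζ c)
include hm

theorem transvec_mem {G : Subgroup (Equiv.Perm (V F))} (hG : G ≤ GammaL F)
    (hSG : specialLinearGroup F ≤ G) (k₁ k₂ : F) : transvec k₁ k₂ ∈ W G :=
  (hm.mem_W_iff hG hSG).2 ⟨semi_transvec _ _, transvec_v0 _ _, proj_transvec _ _⟩

omit hm in
theorem acts_of_WZ {μ : F} (hμ : μ ≠ 0) {g : Equiv.Perm (V F)} (hs : Semi 1 g)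
    (h : ∀ u, PlaneField.proj θ (g u) = algebraMap F E μ * PlaneField.proj θ u) : Acts θ 1 g :=
  ⟨hs.mem, algebraMap F E μ, by simpa using hμ, h⟩

theorem exists_decomp {G : Subgroup (Equiv.Perm (V F))} (hG : G ≤ GammaL F)
    (hSG : specialLinearGroup F ≤ G) {g : Equiv.Perm (V F)} (hg : Acts θ 1 g) :
    ∃ n ∈ W G ⊔ Z F, ∃ i : ℕ, g = n * c ^ i := by
  obtain ⟨μ, hμ, hv⟩ := hm.acts_v0 hg
  have hs := acts_one_semi hg
  obtain ⟨-, a, ha, hga⟩ := hg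
  have hμ' : algebraMap F E μ ≠ 0 := by simpa using hμ
  -- Since `c` fixes v₀, the quotient g c^{-i} still acts on α₀ by μ; it lies in WZ once it acts by
  -- μ on V/α₀ as well, that is, once ζ^i = a/μ.
  obtain ⟨i, hi⟩ := hm.gen ((algebraMap F E μ)⁻¹ * a) (mul_ne_zero (inv_ne_zero hμ') ha)
  have hfr := (hm.frame_c.pow_one i).inv (pow_ne_zero i hm.ne_zero)
  refine ⟨g * (c ^ i)⁻¹, (hm.mem_WZ_iff hG hSG).2 ⟨μ, hμ, ?_, ?_, fun u => ?_⟩, i, by group⟩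
  · simpa using hs.mul hfr.semi
  · rw [Equiv.Perm.mul_apply, hfr.v0 hm.indep, hv]
  · rw [Equiv.Perm.mul_apply, hga, RingAut.one_apply, hfr.proj, ← hi]
    simp only [inv_one, RingAut.one_apply]
    rw [mul_inv, inv_inv]
    field_simp

theorem mem_R_iff {G : Subgroup (Equiv.Perm (V F))} (hG : G ≤ GammaL F)
    (hSG : specialLinearGroup F ≤ G) {g : Equiv.Perm (V F)} :
    g ∈ W G ⊔ Z F ⊔ Subgroup.zpowers c ↔ Acts θ 1 g := by
  constructor
  · let K : Subgroup (Equiv.Perm (V F)) :=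
      { carrier := {h | Acts θ 1 h}
        one_mem' := Acts.one
        mul_mem' := fun hf hg => by simpa using Acts.mul hf hg
        inv_mem' := fun hf => by simpa using Acts.inv hf }
    have hK : W G ⊔ Z F ⊔ Subgroup.zpowers c ≤ K := by
      refine sup_le (fun h hh => ?_) ?_
      · obtain ⟨μ, hμ, h1, -, h2⟩ := (hm.mem_WZ_iff hG hSG).1 hh
        exact acts_of_WZ hμ h1 h2
      · rw [Subgroup.zpowers_le]
        exact hm.frame_c.acts hm.ne_zero
    exact fun h => hK h
  · intro h
    obtain ⟨n, hn, i, rfl⟩ := hm.exists_decomp hG hSG h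
    exact Subgroup.mul_mem_sup hn (Subgroup.pow_mem _ (Subgroup.mem_zpowers c) i)

/-- An element that fixes both structures of a distant pair, without field automorphisms, is
scalar. -/
theorem mem_Z_of_acts_one {d : Equiv.Perm (V F)} (h : Acts θ 1 d)
    (h' : Acts θ 1 (s F * d * s F)) : d ∈ Z F := by
  have hs := acts_one_semi h
  obtain ⟨μ, hμ, hv0⟩ := hm.acts_v0 h
  obtain ⟨ν, hν, hv1⟩ := hm.acts_v0 h'
  obtain ⟨-, a, ha, hda⟩ := h
  obtain ⟨-, b, hb, hdb⟩ := h'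
  rw [Equiv.Perm.mul_apply, Equiv.Perm.mul_apply, s_v0] at hv1
  have hv1' : d (v F 1) = ν • v F 1 := by
    have := congrArg (s F) hv1
    rwa [← Equiv.Perm.mul_apply, s_mul_s, Equiv.Perm.one_apply, semi_s.2, s_v0] at this
  -- `d` preserves the line of v₁, whose image in E is F, so the multiplier on V/α₀ lies in F. The
  -- same holds for `b` by symmetry, and comparing the images of v₂ gives μ = ν.
  have haν : a = algebraMap F E ν := by
    have := hda (v F 1)
    rw [hv1', proj_smul, proj_v1] at this
    simpa using this.symm
  have hbμ : b = algebraMap F E μ := by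
    have := hdb (v F 1)
    rw [Equiv.Perm.mul_apply, Equiv.Perm.mul_apply, s_v1, hv0, semi_s.2, s_v0, proj_smul,
      proj_v1] at this
    simpa using this.symm
  have h2 := hda (v F 2)
  rw [proj_v2, haν] at h2
  have h3 := hm.proj_eq_zero (u := d (v F 2) + -(ν • v F 2)) (by
    rw [proj_add, proj_neg, h2, proj_smul, proj_v2]; simp)
  simp [v] at h3
  have h4 := hdb (v F 2)
  rw [Equiv.Perm.mul_apply, Equiv.Perm.mul_apply, s_v2, hs.map_neg, semi_s.map_neg, proj_neg,
    proj_v2, hbμ, s_apply] at h4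
  have h31 : d (v F 2) 1 = 0 := by simpa [v] using h3.1
  have h32 : d (v F 2) 2 = ν := by
    have := h3.2
    rw [add_neg_eq_zero] at this
    simpa [v] using this
  simp only [PlaneField.proj, Matrix.cons_val_one, Matrix.cons_val_zero, Matrix.cons_val_two,
    Matrix.tail_cons, Matrix.head_cons, RingAut.one_apply] at h4
  have h5 := hm.indep (-(d (v F 2) 0)) (ν - μ) (by
    have h4' : -(algebraMap F E (d (v F 2) 0) + algebraMap F E (-(d (v F 2) 2)) * θ) =
      algebraMap F E μ * θ := h4
    rw [h32] at h4'
    simp only [map_neg, map_sub] at h4' ⊢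
    linear_combination h4')
  have hνμ : ν = μ := sub_eq_zero.1 h5.2
  have hv2 : d (v F 2) = μ • v F 2 := by
    ext i
    fin_cases i
    · simpa [v] using h5.1
    · simpa [v] using h31
    · simpa [v, hνμ] using h32
  refine mem_Z_iff.2 ⟨μ, hμ, fun u => ?_⟩
  rw [hs.apply_eq, hv0, hv1', hv2, hνμ]
  conv_rhs => rw [vec_eq u]
  simp only [RingAut.one_apply, smul_add, smul_comm μ]

omit hm in
/-- The element of a two-point stabilizer that induces the field automorphism `ι` of the second
structure and the identity on the first one. -/
theorem exists_eps {ι : RingAut E} (hι : ∀ k, ι (algebraMap F E k) = algebraMap F E k) {A : F}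
    (hA : ι θ = algebraMap F E A - θ) :
    ∃ g : Equiv.Perm (V F), HasDet g 1 ∧ Acts θ 1 g ∧ Acts θ ι (s F * g * s F) := by
  -- This map is -1 on V/α₀. After conjugation by s the term with A sends the image θ of v₂ to A -
  -- θ, which is ι(θ).
  let g : Equiv.Perm (V F) := Function.Involutive.toPerm
    (fun u => ![u 0 - A * u 2, -u 1, -u 2]) (by
      intro u
      ext i
      fin_cases i <;> simp)
  have hg : ∀ u, g u = ![u 0 - A * u 2, -u 1, -u 2] := fun u => rfl
  have hd : HasDet g 1 := by
    refine ⟨!![1, 0, -A; 0, -1, 0; 0, 0, -1], by simp [Matrix.det_fin_three], fun u => ?_⟩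
    rw [hg]
    ext i
    fin_cases i <;> simp [Matrix.mulVec, dotProduct, Fin.sum_univ_three]
    ring
  have hs : Semi 1 g := mem_linearGroup_iff_semi.1 (mem_linearGroup_iff_hasDet.2 ⟨1, hd⟩)
  refine ⟨g, hd, ⟨hs.mem, -1, by simp, fun u => ?_⟩, ⟨(s_conj_semi hs).mem, 1, one_ne_zero,
    fun u => ?_⟩⟩
  · simp [hg, PlaneField.proj]
    ring
  · simp [hg, PlaneField.proj, s_apply, hι, hA]
    ring

/-- Let τ(θ) = a + bθ. Then `g` adds a σ(u₂) to coordinate 1; the transvection subtracts the same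
amount from coordinate 0. The product then commutes with s, so it induces τ on both structures. -/
theorem exists_transvec_pair {τ : RingAut E} {σ : RingAut F} {g : Equiv.Perm (V F)}
    (hg : Frame θ 1 τ σ g) {G : Subgroup (Equiv.Perm (V F))} (hG : G ≤ GammaL F)
    (hSG : specialLinearGroup F ≤ G) :
    ∃ n ∈ W G, Acts θ τ (n * g) ∧ Acts θ τ (s F * (n * g) * s F) := by
  obtain ⟨a, b, hab⟩ := hm.span (τ θ)
  have hτ : ∀ k, τ (algebraMap F E k) = algebraMap F E (σ k) :=
    acts_restrict (hg.acts one_ne_zero) hg.semi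
  have hb : b ≠ 0 := by
    rintro rfl
    have h1 : τ θ = τ (algebraMap F E (σ⁻¹ a)) := by
      rw [hτ, hab, ← RingAut.mul_apply]; simp
    have h2 := τ.injective h1
    have h3 := hm.indep (-(σ⁻¹ a)) 1 (by rw [h2]; simp)
    exact one_ne_zero h3.2
  have hcoord : ∀ u, g u = ![σ (u 0), σ (u 1) + a * σ (u 2), b * σ (u 2)] := by
    intro u
    refine hm.ext ?_ ?_
    · rw [hg.zero]; rfl
    · rw [hg.proj]
      simp [PlaneField.proj, hτ, hab]
      ring
  have hn : Semi σ (transvec 0 (-(a / b)) * g) := by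
    simpa using (semi_transvec 0 (-(a / b))).mul hg.semi
  refine ⟨transvec 0 (-(a / b)), hm.transvec_mem hG hSG _ _, ⟨hn.mem, 1, one_ne_zero, fun u => ?_⟩,
    ⟨(s_conj_semi hn).mem, 1, one_ne_zero, fun u => ?_⟩⟩
  · rw [Equiv.Perm.mul_apply, proj_transvec, hg.proj]
  · simp only [Equiv.Perm.mul_apply, s_apply, hcoord, transvec_apply]
    have hab' : a / b * (b * σ (u 2)) = a * σ (u 2) := by field_simp
    simp [PlaneField.proj, hτ, hab, hab']
    ring

end SingerModel
end Pairs

/-! ### Automorphisms of E and the norm to F -/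

section FiniteField

variable {F E : Type w} [Field F] [Field E] [Algebra F E] {θ ζ : E} {c : Equiv.Perm (V F)}

namespace SingerModel
variable (hm : SingerModel θ ζ c)
include hm

theorem card_ext : Nat.card E = Nat.card F ^ 2 := by
  rw [sq, ← Nat.card_prod]
  refine (Nat.card_congr (Equiv.ofBijective
    (fun x : F × F => algebraMap F E x.1 + algebraMap F E x.2 * θ) ⟨?_, ?_⟩)).symm
  · rintro ⟨a, b⟩ ⟨a', b'⟩ h
    have := hm.indep (a - a') (b - b') (by
      simp only at h
      rw [map_sub, map_sub]
      linear_combination h)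
    rw [sub_eq_zero, sub_eq_zero] at this
    rw [this.1, this.2]
  · intro z
    obtain ⟨a, b, h⟩ := hm.span z
    exact ⟨(a, b), h.symm⟩

theorem orderOf_zeta [Finite E] : orderOf ζ = Nat.card F ^ 2 - 1 := by
  have h1 : orderOf (Units.mk0 ζ hm.ne_zero) = Nat.card Eˣ := by
    refine orderOf_eq_card_of_forall_mem_zpowers fun x => ?_
    obtain ⟨i, hi⟩ := hm.gen x x.ne_zero
    exact ⟨i, by ext; simp [hi]⟩
  rw [← orderOf_units, Units.val_mk0] at h1
  rw [h1, Nat.card_units, hm.card_ext]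

/-- The automorphism of `E` of order two over `F`. -/
theorem exists_conj [Finite E] [Finite F] : ∃ ι : RingAut E, ι ≠ 1 ∧ (∀ z, ι z = z ^ Nat.card F) ∧
    (∀ k, ι (algebraMap F E k) = algebraMap F E k) ∧ (∃ A : F, ι θ = algebraMap F E A - θ) ∧
    ∀ τ : RingAut E, (∀ k, τ (algebraMap F E k) = algebraMap F E k) → τ = 1 ∨ τ = ι := by
  have hfin : Fintype F := Fintype.ofFinite F
  let f := FiniteField.frobeniusAlgEquivOfAlgebraic F E
  have hf : ∀ z, f z = z ^ Nat.card F := fun z => by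
    rw [Nat.card_eq_fintype_card]; rfl
  obtain ⟨b, a, hab⟩ := hm.span (θ ^ 2)
  have hdet : ∀ τ τ' : RingAut E, (∀ k, τ (algebraMap F E k) = algebraMap F E k) →
      (∀ k, τ' (algebraMap F E k) = algebraMap F E k) → τ θ = τ' θ → τ = τ' := by
    intro τ τ' h h' hθ
    ext z
    obtain ⟨x, y, rfl⟩ := hm.span z
    simp [h, h', hθ]
  have hroot : ∀ τ : RingAut E, (∀ k, τ (algebraMap F E k) = algebraMap F E k) →
      τ θ = θ ∨ τ θ = algebraMap F E a - θ := by
    intro τ h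
    have h1 : (τ θ) ^ 2 = algebraMap F E b + algebraMap F E a * τ θ := by
      rw [← map_pow, hab, map_add, map_mul, h, h]
    have h2 : (τ θ - θ) * (τ θ - (algebraMap F E a - θ)) = 0 := by
      linear_combination h1 - hab
    rcases mul_eq_zero.1 h2 with h3 | h3
    · exact Or.inl (sub_eq_zero.1 h3)
    · exact Or.inr (sub_eq_zero.1 h3)
  let ι : RingAut E := f.toRingEquiv
  have hι : ∀ k, ι (algebraMap F E k) = algebraMap F E k := fun k => f.commutes k
  have hne : ι ≠ 1 := by
    intro h
    have h1 : ζ ^ Nat.card F = ζ := by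
      rw [← hf]
      exact RingEquiv.congr_fun h ζ
    have hq : 1 < Nat.card F := Finite.one_lt_card
    have h2 : ζ ^ (Nat.card F - 1) = 1 := by
      have h3 : ζ ^ (Nat.card F - 1) * ζ = 1 * ζ := by
        rw [← pow_succ, one_mul, Nat.sub_add_cancel hq.le, h1]
      exact mul_right_cancel₀ hm.ne_zero h3
    have h3 := Nat.le_of_dvd (by omega) (orderOf_dvd_of_pow_eq_one h2)
    rw [hm.orderOf_zeta] at h3
    have : Nat.card F < Nat.card F ^ 2 := by nlinarith
    omega
  have hιθ : ι θ = algebraMap F E a - θ := by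
    refine (hroot ι hι).resolve_left fun h => hne ?_
    exact hdet ι 1 hι (fun k => rfl) h
  refine ⟨ι, hne, hf, hι, ⟨a, hιθ⟩, fun τ hτ => ?_⟩
  rcases hroot τ hτ with h | h
  · exact Or.inl (hdet τ 1 hτ (fun k => rfl) h)
  · exact Or.inr (hdet τ ι hτ hι (h.trans hιθ.symm))

/-- The norm of ζ is fixed by the Frobenius map z ↦ z^q, hence lies in F. If ζ^i lies in F, then q²
- 1 divides i(q - 1), so q + 1 divides i; thus the norm generates the multiplicative group of F. It
is the scalar by which x₀ acts on the plane. -/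
theorem exists_norm [Finite E] [Finite F] : ∃ l : F, algebraMap F E l = ζ ^ (Nat.card F + 1) ∧
    l ≠ 0 ∧ (∀ k : F, k ≠ 0 → ∃ i : ℕ, k = l ^ i) ∧ orderOf l = Nat.card F - 1 := by
  have hfin : Fintype F := Fintype.ofFinite F
  have hq : 1 < Nat.card F := Finite.one_lt_card
  have hsq : Nat.card F ^ 2 - 1 = (Nat.card F + 1) * (Nat.card F - 1) := by
    have := Nat.sq_sub_sq (Nat.card F) 1
    simpa using this
  obtain ⟨ι, -, hι, hιF, ⟨A, hA⟩, hιu⟩ := hm.exists_conj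
  have hfix : ∀ z : E, z ^ Nat.card F = z → ∃ k : F, algebraMap F E k = z := by
    intro z hz
    have : z ∈ (⊥ : IntermediateField F E) := by
      rw [IsGalois.mem_bot_iff_fixed]
      intro f
      rcases hιu f.toRingEquiv f.commutes with h | h
      · exact RingEquiv.congr_fun h z
      · exact (RingEquiv.congr_fun h z).trans ((hι z).trans hz)
    exact IntermediateField.mem_bot.1 this
  obtain ⟨l, hl⟩ := hfix (ζ ^ (Nat.card F + 1)) (by
    have h1 : ζ ^ (Nat.card F ^ 2 - 1) = 1 := by rw [← hm.orderOf_zeta, pow_orderOf_eq_one]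
    rw [hsq, pow_mul] at h1
    calc (ζ ^ (Nat.card F + 1)) ^ Nat.card F
        = (ζ ^ (Nat.card F + 1)) ^ (Nat.card F - 1) * ζ ^ (Nat.card F + 1) := by
          rw [← pow_succ, Nat.sub_add_cancel hq.le]
      _ = _ := by rw [h1, one_mul])
  have hl0 : l ≠ 0 := by
    rintro rfl
    rw [map_zero] at hl
    exact pow_ne_zero _ hm.ne_zero hl.symm
  have hgen : ∀ k : F, k ≠ 0 → ∃ i : ℕ, k = l ^ i := by
    intro k hk
    obtain ⟨i, hi⟩ := hm.gen (algebraMap F E k) (by simpa using hk)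
    have h1 : k ^ (Nat.card F - 1) = 1 := by
      rw [Nat.card_eq_fintype_card]
      exact FiniteField.pow_card_sub_one_eq_one k hk
    have h2 : ζ ^ (i * (Nat.card F - 1)) = 1 := by
      rw [pow_mul, ← hi, ← map_pow, h1, map_one]
    have h3 := orderOf_dvd_of_pow_eq_one h2
    rw [hm.orderOf_zeta, hsq] at h3
    obtain ⟨j, rfl⟩ := Nat.dvd_of_mul_dvd_mul_right (by omega) h3
    refine ⟨j, (algebraMap F E).injective ?_⟩
    rw [hi, pow_mul, ← hl, map_pow]
  refine ⟨l, hl, hl0, hgen, ?_⟩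
  have h1 : orderOf (Units.mk0 l hl0) = Nat.card Fˣ := by
    refine orderOf_eq_card_of_forall_mem_zpowers fun x => ?_
    obtain ⟨i, hi⟩ := hgen x x.ne_zero
    exact ⟨i, by ext; simp [hi]⟩
  rw [← orderOf_units, Units.val_mk0] at h1
  rw [h1, Nat.card_units]

end SingerModel

/-- Both fields are normal over the prime field, so restriction of automorphisms from E to F is
surjective. -/
theorem exists_extension [Finite E] (σ : RingAut F) :
    ∃ τ : RingAut E, ∀ k, τ (algebraMap F E k) = algebraMap F E (σ k) := by
  have hF : Finite F := Finite.of_injective _ (algebraMap F E).injective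
  obtain ⟨p, hp⟩ := CharP.exists F
  have : Fact p.Prime := ⟨CharP.char_is_prime F p⟩
  have : CharP E p := charP_of_injective_algebraMap (algebraMap F E).injective p
  let : Algebra (ZMod p) F := ZMod.algebra F p
  let : Algebra (ZMod p) E := ZMod.algebra E p
  have : IsScalarTower (ZMod p) F E := IsScalarTower.of_algebraMap_eq' (RingHom.ext_zmod _ _)
  let f : F ≃ₐ[ZMod p] F := AlgEquiv.ofRingEquiv (f := σ) (fun x => by
    have := RingHom.congr_fun (RingHom.ext_zmod ((σ : F →+* F).comp (algebraMap (ZMod p) F))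
      (algebraMap (ZMod p) F)) x
    exact this)
  obtain ⟨g, hg⟩ := AlgEquiv.restrictNormalHom_surjective (F := ZMod p) (K₁ := F) E f
  refine ⟨g.toRingEquiv, fun k => ?_⟩
  have := AlgEquiv.restrictNormal_commutes g F k
  change g (algebraMap F E k) = _
  rw [← this]
  congr 1
  exact AlgEquiv.congr_fun hg k

end FiniteField

/-! ### The group Ḡ and the configuration in adapted coordinates -/

theorem mem_sup_iff {F : Type*} [Field F] {G : Subgroup (Equiv.Perm (V F))} (hG : G ≤ GammaL F)
    {h : Equiv.Perm (V F)} : h ∈ linearGroup F ⊔ G ↔ ∃ σ, Semi σ h ∧ ∃ g ∈ G, Semi σ g := by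
  constructor
  · let K : Subgroup (Equiv.Perm (V F)) :=
      { carrier := {h | ∃ σ, Semi σ h ∧ ∃ g ∈ G, Semi σ g}
        one_mem' := ⟨1, Semi.one, 1, G.one_mem, Semi.one⟩
        mul_mem' := by
          rintro f f' ⟨σ, hf, g, hg, hσ⟩ ⟨σ', hf', g', hg', hσ'⟩
          exact ⟨σ * σ', hf.mul hf', g * g', G.mul_mem hg hg', hσ.mul hσ'⟩
        inv_mem' := by
          rintro f ⟨σ, hf, g, hg, hσ⟩
          exact ⟨σ⁻¹, hf.inv, g⁻¹, G.inv_mem hg, hσ.inv⟩ }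
    have hK : linearGroup F ⊔ G ≤ K := by
      refine sup_le (fun g hg => ?_) (fun g hg => ?_)
      · exact ⟨1, mem_linearGroup_iff_semi.1 hg, 1, G.one_mem, Semi.one⟩
      · obtain ⟨σ, hσ⟩ := mem_GammaL_iff.1 (hG hg)
        exact ⟨σ, hσ, g, hg, hσ⟩
    exact fun h => hK h
  · rintro ⟨σ, hh, g, hg, hσ⟩
    have : h = (h * g⁻¹) * g := by group
    rw [this]
    refine Subgroup.mul_mem_sup (mem_linearGroup_iff_semi.2 ?_) hg
    simpa using hh.mul hσ.inv

/-- The configuration of the theorem, in coordinates adapted to the Singer cycle. -/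
structure Configuration {F E : Type w} [Field F] [Field E] [Algebra F E]
    (G : Subgroup (Equiv.Perm (V F))) (θ ζ : E) (c x₀ y₀ x y : Equiv.Perm (V F))
    (τ₀ ι : RingAut E) (σ₀ : RingAut F) (l : F) (t r : ℕ) : Prop where
  le_GammaL : G ≤ GammaL F
  Z_le : Z F ≤ G
  SL_le : specialLinearGroup F ≤ G
  model : SingerModel θ ζ c
  frame_y₀ : Frame θ 1 τ₀ σ₀ y₀
  y₀_mem : y₀ ∈ linearGroup F ⊔ G
  decomp : ∀ g ∈ linearGroup F ⊔ G, ∀ τ, Acts θ τ g →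
    ∃ n ∈ W G ⊔ Z F, ∃ i j : ℕ, g = n * c ^ i * y₀ ^ j
  ι_ne : ι ≠ 1
  ι_fix : ∀ k, ι (algebraMap F E k) = algebraMap F E k
  ι_θ : ∃ A : F, ι θ = algebraMap F E A - θ
  ι_unique : ∀ τ : RingAut E, (∀ k, τ (algebraMap F E k) = algebraMap F E k) → τ = 1 ∨ τ = ι
  l_eq : algebraMap F E l = ζ ^ (Nat.card F + 1)
  l_ne : l ≠ 0
  l_gen : ∀ k : F, k ≠ 0 → ∃ i : ℕ, k = l ^ i
  l_order : orderOf l = Nat.card F - 1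
  least : IsLeast {k : ℕ | 0 < k ∧ x₀ ^ k ∈ G} t
  lt : r < t
  mem : x₀ ^ r * y₀ ∈ G
  x₀_eq : x₀ = c ^ (Nat.card F + 1)
  x_eq : x = c ^ t
  y_eq : y = x₀ ^ r * y₀

section
variable {F E : Type w} [Field F] [Field E] [Algebra F E] {θ ζ : E} {c : Equiv.Perm (V F)}

/-- As y₀ normalizes R, the conjugate of `c` by y₀ acts on V/α₀ as multiplication by some b. So the
additive map f that y₀ induces on E satisfies f(ζz) = b f(z) and f(1) = 1. Since ζ generates, f is
multiplicative, a field automorphism. -/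
theorem SingerModel.exists_frame_adapted [Finite E] (hm : SingerModel θ ζ c)
    {G : Subgroup (Equiv.Perm (V F))} (hG : G ≤ GammaL F) (hSG : specialLinearGroup F ≤ G)
    {y₀ : Equiv.Perm (V F)} (hy₀ : IsAdaptedFieldAut G c y₀) :
    ∃ τ₀ σ₀, Frame θ 1 τ₀ σ₀ y₀ := by
  obtain ⟨σ, hσ, -⟩ := (mem_sup_iff hG).1 hy₀.mem
  have hpl : ∀ u : V F, u 0 = 0 → y₀ u 0 = 0 := by
    intro u hu
    have h1 := hy₀.plane
    rw [MulAction.mem_stabilizer_iff] at h1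
    have h2 : y₀ u ∈ y₀ • (plane F : Set (V F)) := Set.smul_mem_smul_set (mem_plane.2 hu)
    rw [h1] at h2
    exact mem_plane.1 h2
  have hsplit : ∀ u u' : V F, u' 0 = 0 → PlaneField.proj θ u' = PlaneField.proj θ u →
      y₀ u = σ (u 0) • v F 0 + y₀ u' := by
    intro u u' h0 h1
    have : u = u 0 • v F 0 + u' := by
      refine hm.ext ?_ ?_
      · simp [v, h0]
      · rw [proj_add, proj_smul, proj_v0, h1]; simp
    conv_lhs => rw [this]
    rw [hσ.1, hσ.2, hy₀.fixes_zero]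
  have hzero : ∀ u, y₀ u 0 = σ (u 0) := by
    intro u
    obtain ⟨u', h0, h1⟩ := hm.exists_vec 0 (PlaneField.proj θ u)
    rw [hsplit u u' h0 h1]
    simp [v, hpl u' h0]
  let f : E → E := fun z => PlaneField.proj θ (y₀ (hm.coord.symm (0, z)))
  have hf : ∀ u, PlaneField.proj θ (y₀ u) = f (PlaneField.proj θ u) := by
    intro u
    have h1 := hm.coord.apply_symm_apply (0, PlaneField.proj θ u)
    have h0 : (hm.coord.symm (0, PlaneField.proj θ u)) 0 = 0 := congrArg Prod.fst h1
    have h2 : PlaneField.proj θ (hm.coord.symm (0, PlaneField.proj θ u)) = PlaneField.proj θ u :=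
      congrArg Prod.snd h1
    rw [hsplit u _ h0 h2, proj_add, proj_smul, proj_v0]
    simp [f]
  have hfadd : ∀ z z', f (z + z') = f z + f z' := by
    intro z z'
    obtain ⟨u, -, rfl⟩ := hm.exists_vec 0 z
    obtain ⟨u', -, rfl⟩ := hm.exists_vec 0 z'
    rw [← proj_add, ← hf, ← hf, ← hf, hσ.1, proj_add]
  have hf1 : f 1 = 1 := by
    have := hf (v F 1)
    rw [hy₀.fixes_one, proj_v1] at this
    exact this.symm
  have hf0 : f 0 = 0 := by
    have := hf 0
    rw [hσ.map_zero] at this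
    simpa [PlaneField.proj] using this.symm
  have hnorm : Acts θ 1 (y₀ * c * y₀⁻¹) := by
    have h1 : y₀ ∈ Subgroup.normalizer
          ((W G ⊔ Z F ⊔ Subgroup.zpowers c : Subgroup (Equiv.Perm (V F))) :
            Set (Equiv.Perm (V F))) := by
      have : y₀ ∈ W G ⊔ Z F ⊔ Subgroup.zpowers c ⊔ Subgroup.zpowers y₀ :=
        Subgroup.mem_sup_right (Subgroup.mem_zpowers y₀)
      rw [← hy₀.normalizer] at this
      exact this.2
    rw [← hm.mem_R_iff hG hSG]
    exact (Subgroup.mem_normalizer_iff.1 h1 c).1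
      (Subgroup.mem_sup_right (Subgroup.mem_zpowers c))
  obtain ⟨-, b, hb, hb'⟩ := hnorm
  have hfζ : ∀ z, f (ζ * z) = b * f z := by
    intro z
    obtain ⟨u, -, rfl⟩ := hm.exists_vec 0 z
    rw [← hm.proj, ← hf, ← hf]
    have := hb' (y₀ u)
    simpa using this
  have hfpow : ∀ (i : ℕ) z, f (ζ ^ i * z) = b ^ i * f z := by
    intro i
    induction i with
    | zero => simp
    | succ i ih =>
      intro z
      rw [pow_succ, mul_assoc, ih, hfζ, pow_succ, mul_assoc]
  have hfmul : ∀ z z', f (z * z') = f z * f z' := by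
    intro z z'
    by_cases hz : z = 0
    · rw [hz, zero_mul, hf0, zero_mul]
    · obtain ⟨i, rfl⟩ := hm.gen z hz
      have := hfpow i 1
      rw [mul_one, hf1, mul_one] at this
      rw [hfpow, this]
  let φ : E →+* E :=
    { toFun := f, map_one' := hf1, map_mul' := hfmul, map_zero' := hf0, map_add' := hfadd }
  have hφ : Function.Bijective φ := Finite.injective_iff_bijective.1 φ.injective
  exact ⟨RingEquiv.ofBijective φ hφ, σ, hσ, hzero, fun u => by rw [hf, one_mul]; rfl⟩

/-- The field `decomp` is where the normalizer condition on y₀ enters: R is the group of maps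
inducing the trivial automorphism of E, so every map that is semilinear over E normalizes it. -/
theorem exists_configuration {F : Type w} [Field F] [Finite F]
    {G : Subgroup (Equiv.Perm (V F))}
    (hG : G ≤ GammaL F) (hSG : Z F ⊔ specialLinearGroup F ≤ G)
    {c x₀ y₀ : Equiv.Perm (V F)}
    (hc : IsSingerCycle c) (hx₀ : x₀ = c ^ (Nat.card F + 1))
    (hy₀ : IsAdaptedFieldAut G c y₀)
    {t r : ℕ} (ht : IsLeast {k : ℕ | 0 < k ∧ x₀ ^ k ∈ G} t)
    (hrt : r < t) (hr : x₀ ^ r * y₀ ∈ G)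
    {x y : Equiv.Perm (V F)} (hx : x = c ^ t) (hy : y = x₀ ^ r * y₀) :
    ∃ (E : Type w) (_ : Field E) (_ : Algebra F E) (_ : Finite E) (θ ζ : E) (τ₀ ι : RingAut E)
      (σ₀ : RingAut F) (l : F), Configuration G θ ζ c x₀ y₀ x y τ₀ ι σ₀ l t r := by
  obtain ⟨E, _, _, _, θ, ζ, hm⟩ := hc.exists_model
  have hS : specialLinearGroup F ≤ G := le_sup_right.trans hSG
  obtain ⟨τ₀, σ₀, hfr⟩ := hm.exists_frame_adapted hG hS hy₀
  obtain ⟨ι, hι1, -, hι2, hι3, hι4⟩ := hm.exists_conj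
  obtain ⟨l, hl1, hl2, hl3, hl4⟩ := hm.exists_norm
  refine ⟨E, _, _, ‹_›, θ, ζ, τ₀, ι, σ₀, l, hG, le_sup_left.trans hSG, hS, hm, hfr, hy₀.mem, ?_,
    hι1, hι2, hι3, hι4, hl1, hl2, hl3, hl4, ht, hrt, hr, hx₀, hx, hy⟩
  intro g hg τ hgτ
  have hmem : g ∈ W G ⊔ Z F ⊔ Subgroup.zpowers c ⊔ Subgroup.zpowers y₀ := by
    rw [← hy₀.normalizer]
    refine Subgroup.mem_inf.2 ⟨Subgroup.mem_inf.2 ⟨hg, ?_⟩, ?_⟩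
    · rw [MulAction.mem_stabilizer_set]
      intro u
      obtain ⟨-, a, ha, hga⟩ := hgτ
      have h1 : ∀ u : V F, u ∈ (line F 0 : Set (V F)) ↔ PlaneField.proj θ u = 0 := by
        intro u
        rw [SetLike.mem_coe, mem_line_zero]
        exact ⟨fun h => by simp [PlaneField.proj, h], hm.proj_eq_zero⟩
      rw [h1, h1, Equiv.Perm.smul_def, hga]
      simp [ha]
    · rw [Subgroup.mem_normalizer_iff]
      intro h
      rw [hm.mem_R_iff hG hS, hm.mem_R_iff hG hS]
      constructor
      · intro hh
        simpa using (hgτ.mul hh).mul hgτ.inv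
      · intro hh
        have := (hgτ.inv.mul hh).mul hgτ
        have h2 : g⁻¹ * (g * h * g⁻¹) * g = h := by group
        simpa [h2] using this
  have hle : Subgroup.zpowers y₀ ≤ Subgroup.normalizer
          ((W G ⊔ Z F ⊔ Subgroup.zpowers c : Subgroup (Equiv.Perm (V F))) :
            Set (Equiv.Perm (V F))) := by
    have : Subgroup.zpowers y₀ ≤ W G ⊔ Z F ⊔ Subgroup.zpowers c ⊔ Subgroup.zpowers y₀ :=
      le_sup_right
    rw [← hy₀.normalizer] at this
    exact this.trans inf_le_right
  rw [← SetLike.mem_coe, Subgroup.coe_mul_of_right_le_normalizer_left _ _ hle] at hmem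
  obtain ⟨ρ, hρ, k, hk, rfl⟩ := hmem
  obtain ⟨n, hn, i, rfl⟩ := hm.exists_decomp hG hS ((hm.mem_R_iff hG hS).1 hρ)
  obtain ⟨j, rfl⟩ := (mem_powers_iff_mem_zpowers.2 hk : k ∈ Submonoid.powers y₀)
  exact ⟨n, hn, i, j, rfl⟩

end

/-! ### Factorization through s in Ḡ -/

/-- The elements of `⟨GL₃(q), G⟩` that act semilinearly on `V / α₀ ≅ E`. -/
def extSemilinear {F E : Type w} [Field F] [Field E] [Algebra F E] (θ : E)
    (G : Subgroup (Equiv.Perm (V F))) : Subgroup (Equiv.Perm (V F)) where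
  carrier := {g | g ∈ linearGroup F ⊔ G ∧ ∃ τ, Acts θ τ g}
  one_mem' := ⟨Subgroup.one_mem _, 1, Acts.one⟩
  mul_mem' := fun ⟨h1, _, h2⟩ ⟨h3, _, h4⟩ => ⟨Subgroup.mul_mem _ h1 h3, _, h2.mul h4⟩
  inv_mem' := fun ⟨h1, _, h2⟩ => ⟨Subgroup.inv_mem _ h1, _, h2.inv⟩

section
variable {F E : Type w} [Field F] [Field E] [Algebra F E] {θ ζ : E} {c : Equiv.Perm (V F)}
  {G : Subgroup (Equiv.Perm (V F))}

theorem extSemilinear_of_acts_one {g : Equiv.Perm (V F)} (h : Acts θ 1 g) :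
    g ∈ extSemilinear θ G :=
  ⟨Subgroup.mem_sup_left (mem_linearGroup_iff_semi.2 (SingerModel.acts_one_semi h)), 1, h⟩

/-- The linear map that fixes `v₁` modulo `α₀` and sends `v₂` to `b v₁ + d v₂`. -/
def shear (b d : F) (hd : d ≠ 0) : Equiv.Perm (V F) where
  toFun u := ![d * u 0, u 1 + b * u 2, d * u 2]
  invFun u := ![d⁻¹ * u 0, u 1 - b * (d⁻¹ * u 2), d⁻¹ * u 2]
  left_inv u := by ext i; fin_cases i <;> simp [hd]
  right_inv u := by ext i; fin_cases i <;> simp [hd]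

theorem acts_shear (b d : F) (hd : d ≠ 0) :
    Acts θ 1 (s F * shear b d hd * s F) := by
  have h : ∀ u, (s F * shear b d hd * s F) u = ![u 0 - b * u 2, d * u 1, d * u 2] := by
    intro u
    simp only [Equiv.Perm.mul_apply, s_apply, shear, Equiv.coe_fn_mk]
    ext i; fin_cases i <;> simp
    ring
  refine ⟨Semi.mem (σ := 1) ⟨fun u w => ?_, fun a u => ?_⟩, algebraMap F E d, by simpa using hd,
    fun u => ?_⟩
  · rw [h, h, h]
    ext i; fin_cases i <;> simp <;> ring
  · rw [h, h]
    ext i; fin_cases i <;> simp <;> ring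
  · rw [h]
    simp [proj]
    ring

/-- An element of `⟨GL₃(q), G⟩` that moves `α₀` factors through `s`. -/
theorem SingerModel.exists_factor [Finite E] (hm : SingerModel θ ζ c) (hG : G ≤ GammaL F)
    {g : Equiv.Perm (V F)} (hg : g ∈ linearGroup F ⊔ G) (hg0 : PlaneField.proj θ (g (v F 0)) ≠ 0) :
    ∃ a ∈ extSemilinear θ G, ∃ b ∈ extSemilinear θ G, g = a * s F * b := by
  obtain ⟨σ, hσ, g', hg', hσ'⟩ := (mem_sup_iff hG).1 hg
  obtain ⟨i, hi⟩ := hm.gen _ hg0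
  have hci := hm.frame_c.pow_one i
  have hci' := hci.inv (pow_ne_zero i hm.ne_zero)
  have hca : ∀ i : ℕ, Acts θ 1 (c ^ i) := fun i =>
    (hm.frame_c.pow_one i).acts (pow_ne_zero i hm.ne_zero)
  -- The power of `c` brings the image of v₀ in E to 1, and the transvection then removes its
  -- v₀-coordinate. So n₁ g maps v₀ to v₁, and s n₁ g fixes v₀.
  let n₁ := transvec (-(g (v F 0) 0)) 0 * (c ^ i)⁻¹
  have hn₁ : Acts θ 1 n₁ := by
    have h1 : Acts θ 1 (transvec (-(g (v F 0) 0)) 0) :=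
      ⟨(semi_transvec _ _).mem, 1, one_ne_zero, fun u => by simp [proj_transvec]⟩
    simpa using h1.mul (hca i).inv
  have hn₁v : n₁ (g (v F 0)) = v F 1 := by
    have e1 : PlaneField.proj θ ((c ^ i)⁻¹ (g (v F 0))) = PlaneField.proj θ (v F 1) := by
      rw [hci'.proj, hi, proj_v1]
      simp [hm.ne_zero]
    have e0 : (c ^ i)⁻¹ (g (v F 0)) 0 = g (v F 0) 0 := by rw [hci'.zero]; simp
    have e2 : (c ^ i)⁻¹ (g (v F 0)) = g (v F 0) 0 • v F 0 + v F 1 := by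
      refine hm.ext ?_ ?_
      · rw [e0]; simp [v]
      · rw [e1, proj_add, proj_smul, proj_v0]; simp
    rw [show n₁ (g (v F 0)) = transvec (-(g (v F 0) 0)) 0 ((c ^ i)⁻¹ (g (v F 0))) from rfl, e2,
      transvec_apply]
    ext i
    fin_cases i <;> simp [v]
  let h := s F * (n₁ * g)
  have hh : Semi σ h := by
    simpa using semi_s.mul ((acts_one_semi hn₁).mul hσ)
  have hh0 : h (v F 0) = v F 0 := by
    change s F (n₁ (g (v F 0))) = _
    rw [hn₁v, s_v1]
  have hne : PlaneField.proj θ (h⁻¹ (v F 1)) ≠ 0 := by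
    intro h0
    have h1 : h⁻¹ (v F 1) = (h⁻¹ (v F 1) 0) • v F 0 := by
      refine hm.ext ?_ ?_
      · simp [v]
      · rw [h0, proj_smul, proj_v0, mul_zero]
    have h2 := congrArg h h1
    rw [apply_inv_cancel, hh.2, hh0] at h2
    have := congrFun h2 1
    simp [v] at this
  obtain ⟨j, hj⟩ := hm.gen _ hne
  -- Right multiplication by c^j f makes h linear, since f carries σ⁻¹, and makes it fix v₁ modulo
  -- α₀.
  obtain ⟨τ, hτ⟩ := exists_extension (E := E) σ⁻¹
  obtain ⟨f, hf⟩ := hm.exists_frame one_ne_zero hτ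
  have hfmem : f ∈ extSemilinear θ G :=
    ⟨(mem_sup_iff hG).2 ⟨_, hf.semi, g'⁻¹, G.inv_mem hg', hσ'.inv⟩, τ, hf.acts one_ne_zero⟩
  have hfv1 : f (v F 1) = v F 1 := by
    refine hm.ext ?_ ?_
    · rw [hf.zero]; simp [v]
    · rw [hf.proj, proj_v1]; simp
  have hcj := hm.frame_c.pow_one j
  let h₂ := h * (c ^ j * f)
  have hh₂ : Semi 1 h₂ := by
    have := hh.mul (hcj.semi.mul hf.semi)
    simpa using this
  have hh₂0 : h₂ (v F 0) = v F 0 := by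
    change h ((c ^ j) (f (v F 0))) = _
    rw [hf.v0 hm.indep, hcj.v0 hm.indep, hh0]
  have hh₂1 : ∃ φ : F, h₂ (v F 1) = φ • v F 0 + v F 1 := by
    have h1 : (c ^ j) (v F 1) = (-(h⁻¹ (v F 1) 0)) • v F 0 + h⁻¹ (v F 1) := by
      refine hm.ext ?_ ?_
      · rw [hcj.zero]; simp [v]
      · rw [hcj.proj, proj_add, proj_smul, proj_v0, proj_v1, hj]; simp
    refine ⟨σ (-(h⁻¹ (v F 1) 0)), ?_⟩
    change h ((c ^ j) (f (v F 1))) = _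
    rw [hfv1, h1, hh.1, hh.2, hh0, apply_inv_cancel]
  obtain ⟨φ, hφ⟩ := hh₂1
  have hd : h₂ (v F 2) 2 ≠ 0 := by
    intro h0
    have h1 : h₂ ((-(h₂ (v F 2) 0 - h₂ (v F 2) 1 * φ)) • v F 0 + (-(h₂ (v F 2) 1)) • v F 1 +
        v F 2) = 0 := by
      rw [hh₂.1, hh₂.1, hh₂.2, hh₂.2, hh₂0, hφ]
      ext i
      fin_cases i <;> simp [v] at h0 ⊢
      · ring
      · exact h0
    rw [← hh₂.map_zero] at h1
    have := congrFun (h₂.injective h1) 2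
    simp [v] at this
  -- ν agrees with h₂ modulo α₀, so ν⁻¹h₂ is trivial on V/α₀, while sνs is a scalar on V/α₀. Thus sν
  -- = (sνs)s lets ν be absorbed into the left factor.
  let ν := shear (h₂ (v F 2) 1) (h₂ (v F 2) 2) hd
  have hν : Acts θ 1 (s F * ν * s F) := acts_shear _ _ hd
  let n₂ := ν⁻¹ * h₂
  have hn₂ : Acts θ 1 n₂ := by
    refine ⟨?_, 1, one_ne_zero, fun u => ?_⟩
    · refine (GammaL F).mul_mem ((GammaL F).inv_mem ?_) hh₂.mem
      have h1 := s_conj_semi (acts_one_semi hν)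
      have : s F * (s F * ν * s F) * s F = ν := by
        have e := s_mul_s (F := F)
        calc s F * (s F * ν * s F) * s F = (s F * s F) * ν * (s F * s F) := by group
          _ = ν := by rw [e]; group
      rw [this] at h1
      exact h1.mem
    · have h1 : h₂ u = u 0 • v F 0 + u 1 • (φ • v F 0 + v F 1) + u 2 • h₂ (v F 2) := by
        rw [hh₂.apply_eq, hh₂0, hφ]; rfl
      have h2 : ∀ u, ν⁻¹ u = ![(h₂ (v F 2) 2)⁻¹ * u 0,
        u 1 - h₂ (v F 2) 1 * ((h₂ (v F 2) 2)⁻¹ * u 2), (h₂ (v F 2) 2)⁻¹ * u 2] := fun u => rfl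
      change PlaneField.proj θ (ν⁻¹ (h₂ u)) = _
      rw [h2, PlaneField.proj]
      have e1 : h₂ u 1 = u 1 + u 2 * h₂ (v F 2) 1 := by rw [h1]; simp [v]
      have e2 : h₂ u 2 = u 2 * h₂ (v F 2) 2 := by rw [h1]; simp [v]
      have e3 : (h₂ (v F 2) 2)⁻¹ * h₂ u 2 = u 2 := by rw [e2]; field_simp
      simp only [Matrix.cons_val_one, Matrix.cons_val_zero, Matrix.cons_val_two,
        Matrix.tail_cons, Matrix.head_cons, e3, e1]
      simp [PlaneField.proj, mul_comm]
  refine ⟨n₁⁻¹ * (s F * ν * s F), Subgroup.mul_mem _ (Subgroup.inv_mem _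
    (extSemilinear_of_acts_one hn₁)) (extSemilinear_of_acts_one hν),
    n₂ * (c ^ j * f)⁻¹, Subgroup.mul_mem _ (extSemilinear_of_acts_one hn₂) (Subgroup.inv_mem _
    (Subgroup.mul_mem _ (extSemilinear_of_acts_one (hca j)) hfmem)), ?_⟩
  have e := s_mul_s (F := F)
  have : n₁⁻¹ * (s F * ν * s F) * s F * (n₂ * (c ^ j * f)⁻¹) =
      n₁⁻¹ * (s F * ν * (s F * s F)) * (n₂ * (c ^ j * f)⁻¹) := by group
  rw [this, e]
  simp only [n₂, h₂, h]
  have : n₁⁻¹ * (s F * ν * 1) * (ν⁻¹ * (s F * (n₁ * g) * (c ^ j * f)) * (c ^ j * f)⁻¹) =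
    n₁⁻¹ * (s F * s F) * n₁ * g := by group
  rw [this, e]
  group

end

/-! ### Powers of x₀ and y₀, normal forms in G, orders of the field automorphisms -/

section
variable {F : Type w} [Field F]

/-- The field automorphism of a semilinear map, as a homomorphism on a group of semilinear maps. -/
theorem exists_fieldHom {G : Subgroup (Equiv.Perm (V F))} (hG : G ≤ GammaL F) :
    ∃ φ : G →* RingAut F, ∀ g : G, Semi (φ g) (g : Equiv.Perm (V F)) := by
  have h : ∀ g : G, ∃ σ, Semi σ (g : Equiv.Perm (V F)) := fun g => mem_GammaL_iff.1 (hG g.2)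
  choose φ hφ using h
  exact ⟨MonoidHom.mk' φ fun a b => (hφ (a * b)).unique ((hφ a).mul (hφ b)), hφ⟩

theorem W_le (G : Subgroup (Equiv.Perm (V F))) : W G ≤ G := fun _ h => h.1

theorem Acts.linear {E : Type w} [Field E] [Algebra F E] {θ : E} {g : Equiv.Perm (V F)}
    (h : Acts θ 1 g) : g ∈ linearGroup F :=
  mem_linearGroup_iff_semi.2 (SingerModel.acts_one_semi h)

instance finite_ringAut [Finite F] : Finite (RingAut F) :=
  Finite.of_injective (fun σ : RingAut F => (σ : F → F)) DFunLike.coe_injective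

end

namespace Configuration

variable {F E : Type w} [Field F] [Field E] [Algebra F E]
  {G : Subgroup (Equiv.Perm (V F))} {θ ζ : E} {c x₀ y₀ x y : Equiv.Perm (V F)}
  {τ₀ ι : RingAut E} {σ₀ : RingAut F} {l : F} {t r : ℕ}
  (K : Configuration G θ ζ c x₀ y₀ x y τ₀ ι σ₀ l t r)
include K

theorem frame_c_pow (k : ℕ) : Frame θ (ζ ^ k) 1 1 (c ^ k) := K.model.frame_c.pow_one k

theorem acts_c_pow (k : ℕ) : Acts θ 1 (c ^ k) :=
  (K.frame_c_pow k).acts (pow_ne_zero k K.model.ne_zero)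

theorem frame_x₀_pow (k : ℕ) : Frame θ (algebraMap F E (l ^ k)) 1 1 (x₀ ^ k) := by
  have := K.frame_c_pow ((Nat.card F + 1) * k)
  rw [pow_mul, pow_mul, ← K.l_eq, ← map_pow, ← K.x₀_eq] at this
  exact this

theorem acts_x₀_pow (k : ℕ) : Acts θ 1 (x₀ ^ k) :=
  (K.frame_x₀_pow k).acts (by simpa using fun h => absurd h K.l_ne)

theorem frame_y₀_pow (j : ℕ) : Frame θ 1 (τ₀ ^ j) (σ₀ ^ j) (y₀ ^ j) := K.frame_y₀.one_pow j

theorem acts_y₀_pow (j : ℕ) : Acts θ (τ₀ ^ j) (y₀ ^ j) := (K.frame_y₀_pow j).acts one_ne_zero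

theorem hasDet_x₀_pow (k : ℕ) : HasDet (x₀ ^ k) ((l ^ k) ^ 2) := by
  refine ⟨!![1, 0, 0; 0, l ^ k, 0; 0, 0, l ^ k], by simp [Matrix.det_fin_three, sq], fun u => ?_⟩
  have h := K.frame_x₀_pow k
  refine K.model.ext ?_ ?_
  · rw [h.zero]
    simp [Matrix.mulVec, dotProduct, Fin.sum_univ_three]
  · rw [h.proj]
    simp [PlaneField.proj, Matrix.mulVec, dotProduct, Fin.sum_univ_three]
    ring

theorem mem_of_cube {g : Equiv.Perm (V F)} {a : F} (h : HasDet g (a ^ 3)) : g ∈ G :=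
  (sup_le K.Z_le K.SL_le) h.mem_of_cube

theorem cube_mem {g : Equiv.Perm (V F)} (h : g ∈ linearGroup F) : g ^ 3 ∈ G := by
  obtain ⟨d, hd⟩ := mem_linearGroup_iff_hasDet.1 h
  exact K.mem_of_cube (hd.pow 3)

theorem s_mem : s F ∈ G := K.SL_le s_mem_SL

theorem t_pos : 0 < t := K.least.1.1

theorem x₀_pow_mem_iff (k : ℕ) : x₀ ^ k ∈ G ↔ t ∣ k := by
  constructor
  · intro hk
    rw [Nat.dvd_iff_mod_eq_zero]
    by_contra hne
    have hlt := Nat.mod_lt k K.t_pos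
    have hmem : x₀ ^ (k % t) ∈ G := by
      have h1 : x₀ ^ k = (x₀ ^ t) ^ (k / t) * x₀ ^ (k % t) := by
        rw [← pow_mul, ← pow_add, Nat.div_add_mod]
      rw [h1] at hk
      exact (Subgroup.mul_mem_cancel_left G (G.pow_mem K.least.1.2 _)).1 hk
    have := K.least.2 ⟨Nat.pos_of_ne_zero hne, hmem⟩
    omega
  · rintro ⟨j, rfl⟩
    rw [pow_mul]
    exact G.pow_mem K.least.1.2 _

theorem t_dvd_three : t ∣ 3 :=
  (K.x₀_pow_mem_iff 3).1 (K.cube_mem (by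
    simpa using (K.acts_x₀_pow 1).linear))

theorem t_eq : t = 1 ∨ t = 3 := (Nat.dvd_prime Nat.prime_three).1 K.t_dvd_three

theorem exists_mul_x₀_pow {h : Equiv.Perm (V F)} (hh : h ∈ linearGroup F) :
    ∃ g ∈ G, ∃ i : ℕ, h = g * x₀ ^ i := by
  obtain ⟨d, hd⟩ := mem_linearGroup_iff_hasDet.1 hh
  obtain ⟨k, rfl⟩ := K.l_gen d hd.ne_zero
  -- x₀ has determinant l². Dividing the determinant l^k by l^{4k} leaves the cube l^{-3k}.
  refine ⟨h * (x₀ ^ (2 * k))⁻¹, K.mem_of_cube (a := (l ^ k)⁻¹) ?_, 2 * k, by group⟩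
  have h1 := hd.mul (K.hasDet_x₀_pow (2 * k)).inv
  have h2 : l ^ k * ((l ^ (2 * k)) ^ 2)⁻¹ = (l ^ k)⁻¹ ^ 3 := by
    have := K.l_ne
    field_simp
    ring
  rwa [h2] at h1

theorem t_dvd_of_c_pow_mem {i : ℕ} (h : c ^ i ∈ G) : t ∣ i := by
  rw [← K.x₀_pow_mem_iff, K.x₀_eq, ← pow_mul, mul_comm, pow_mul]
  exact G.pow_mem h _

theorem linearGroup_le_of_t_eq_one (ht : t = 1) : linearGroup F ≤ G := by
  intro h hh
  obtain ⟨g, hg, i, rfl⟩ := K.exists_mul_x₀_pow hh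
  exact G.mul_mem hg ((K.x₀_pow_mem_iff i).2 (by simp [ht]))

theorem x_mem : x ∈ G := by
  have hc : c ∈ linearGroup F := by simpa using (K.acts_c_pow 1).linear
  rw [K.x_eq]
  rcases K.t_eq with h | h
  · exact G.pow_mem (K.linearGroup_le_of_t_eq_one h hc) _
  · rw [h]
    exact K.cube_mem hc

theorem y_mem : y ∈ G := by rw [K.y_eq]; exact K.mem

theorem t_dvd_card_sub_one : t ∣ Nat.card F - 1 := by
  rw [← K.x₀_pow_mem_iff]
  have : x₀ ^ (Nat.card F - 1) = 1 := by
    have h := K.frame_x₀_pow (Nat.card F - 1)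
    rw [← K.l_order, pow_orderOf_eq_one, map_one, K.l_order] at h
    exact K.model.frame_ext h Frame.one
  rw [this]
  exact G.one_mem

/-- Conjugation by y₀ raises x₀ to this power m; only m modulo 3 matters later. -/
theorem exists_exponent : ∃ m : ℕ, σ₀ l = l ^ m := K.l_gen _ (by simpa using K.l_ne)

theorem restrict (j : ℕ) (k : F) :
    (τ₀ ^ j) (algebraMap F E k) = algebraMap F E ((σ₀ ^ j) k) :=
  SingerModel.acts_restrict (K.acts_y₀_pow j) (K.frame_y₀_pow j).semi k

omit K [Field E] [Algebra F E] in
theorem pow_exponent {m : ℕ} (hm : σ₀ l = l ^ m) (j : ℕ) : (σ₀ ^ j) l = l ^ m ^ j := by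
  induction j with
  | zero => simp
  | succ j ih => rw [pow_succ', RingAut.mul_apply, ih, map_pow, hm, ← pow_mul, pow_succ']

theorem y₀_pow_mul_x₀_pow {m : ℕ} (hm : σ₀ l = l ^ m) (j k : ℕ) :
    y₀ ^ j * x₀ ^ k = x₀ ^ (m ^ j * k) * y₀ ^ j := by
  have h1 := (K.frame_y₀_pow j).mul (K.frame_x₀_pow k)
  have h2 := (K.frame_x₀_pow (m ^ j * k)).mul (K.frame_y₀_pow j)
  refine K.model.frame_ext h1 ?_
  have : (1 : E) * (τ₀ ^ j) (algebraMap F E (l ^ k)) =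
      algebraMap F E (l ^ (m ^ j * k)) * (1 : RingAut E) 1 := by
    rw [K.restrict, map_pow (σ₀ ^ j), pow_exponent hm, ← pow_mul]
    simp
  rw [this]
  simpa using h2

theorem y_pow (j : ℕ) : ∃ k, y ^ j = x₀ ^ k * y₀ ^ j := by
  obtain ⟨m, hm⟩ := K.exists_exponent
  induction j with
  | zero => exact ⟨0, by simp⟩
  | succ j ih =>
    obtain ⟨k, hk⟩ := ih
    refine ⟨k + m ^ j * r, ?_⟩
    rw [pow_succ, hk, K.y_eq, mul_assoc, ← mul_assoc (y₀ ^ j), K.y₀_pow_mul_x₀_pow hm, pow_add,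
      pow_succ]
    group

theorem acts_y_pow (j : ℕ) : Acts θ (τ₀ ^ j) (y ^ j) := by
  obtain ⟨k, hk⟩ := K.y_pow j
  rw [hk]
  simpa using (K.acts_x₀_pow k).mul (K.acts_y₀_pow j)

theorem x₀_pow_mem (j : ℕ) : x₀ ^ j ∈ extSemilinear θ G := extSemilinear_of_acts_one (K.acts_x₀_pow j)

theorem mem_WZ_iff {h : Equiv.Perm (V F)} :
    h ∈ W G ⊔ Z F ↔ ∃ μ : F, μ ≠ 0 ∧ Semi 1 h ∧ h (v F 0) = μ • v F 0 ∧
      ∀ u, PlaneField.proj θ (h u) = algebraMap F E μ * PlaneField.proj θ u :=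
  K.model.mem_WZ_iff K.le_GammaL K.SL_le

theorem acts_of_mem_WZ {h : Equiv.Perm (V F)} (hh : h ∈ W G ⊔ Z F) : Acts θ 1 h := by
  obtain ⟨μ, hμ, h1, -, h2⟩ := K.mem_WZ_iff.1 hh
  exact SingerModel.acts_of_WZ hμ h1 h2

theorem WZ_le : W G ⊔ Z F ≤ G := sup_le (W_le G) K.Z_le

/-- The normal form of the elements of `L^{ΓL₁}`. -/
theorem normal_form {g : Equiv.Perm (V F)} (hg : g ∈ G) {τ : RingAut E} (h : Acts θ τ g) :
    ∃ n ∈ W G ⊔ Z F, ∃ i j : ℕ, g = n * x ^ i * y ^ j ∧ τ = τ₀ ^ j := by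
  obtain ⟨n, hn, i, j, hnij⟩ := K.decomp g (Subgroup.mem_sup_right hg) τ h
  have hτ : τ = τ₀ ^ j := by
    refine K.model.acts_unique h ?_
    rw [hnij]
    simpa using ((K.acts_of_mem_WZ hn).mul (K.acts_c_pow i)).mul (K.acts_y₀_pow j)
  obtain ⟨k, hk⟩ := K.y_pow j
  have hne : algebraMap F E (l ^ k) ≠ 0 := by simpa using fun h => absurd h K.l_ne
  -- Replacing y₀^j by y^j costs a power of x₀, which is itself a power of `c`. The remaining c^a
  -- lies in G, hence t divides a.
  obtain ⟨a, ha⟩ := K.model.gen (ζ ^ i * (algebraMap F E (l ^ k))⁻¹)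
    (mul_ne_zero (pow_ne_zero _ K.model.ne_zero) (inv_ne_zero hne))
  have hca : c ^ i * (x₀ ^ k)⁻¹ = c ^ a := by
    refine K.model.frame_ext ?_ (K.frame_c_pow a)
    rw [← ha]
    simpa using (K.frame_c_pow i).mul ((K.frame_x₀_pow k).inv hne)
  have hg' : g = n * c ^ a * y ^ j := by
    rw [hnij, ← hca, hk]; group
  have hmem : c ^ a ∈ G := by
    have : c ^ a = n⁻¹ * g * (y ^ j)⁻¹ := by rw [hg']; group
    rw [this]
    exact G.mul_mem (G.mul_mem (G.inv_mem (K.WZ_le hn)) hg) (G.inv_mem (G.pow_mem K.y_mem j))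
  obtain ⟨b, rfl⟩ := K.t_dvd_of_c_pow_mem hmem
  exact ⟨n, hn, b, j, by rw [hg', K.x_eq, pow_mul], hτ⟩

/-- The intrinsic description of L^{ΓL₁}: membership is tested by the action on V/α₀, without its
generators. -/
theorem mem_LGammaL_iff {g : Equiv.Perm (V F)} :
    g ∈ LGammaL G x y ↔ g ∈ G ∧ g ∈ extSemilinear θ G := by
  constructor
  · have : LGammaL G x y ≤ G ⊓ extSemilinear θ G := by
      refine sup_le (fun n hn => ⟨K.WZ_le hn, extSemilinear_of_acts_one (K.acts_of_mem_WZ hn)⟩) ?_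
      rw [Subgroup.closure_le]
      rintro g (rfl | rfl)
      · refine ⟨K.x_mem, ?_⟩
        rw [K.x_eq]
        exact extSemilinear_of_acts_one (K.acts_c_pow t)
      · exact ⟨K.y_mem, Subgroup.mem_sup_right K.y_mem, _, by simpa using K.acts_y_pow 1⟩
    exact fun h => this h
  · rintro ⟨hg, -, τ, h⟩
    obtain ⟨n, hn, i, j, rfl, -⟩ := K.normal_form hg h
    have hx : x ∈ LGammaL G x y := Subgroup.mem_sup_right (Subgroup.subset_closure (by simp))
    have hy : y ∈ LGammaL G x y := Subgroup.mem_sup_right (Subgroup.subset_closure (by simp))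
    exact Subgroup.mul_mem _ (Subgroup.mul_mem _ (Subgroup.mem_sup_left hn)
      (Subgroup.pow_mem _ hx i)) (Subgroup.pow_mem _ hy j)

theorem tau_eq_pow {g : Equiv.Perm (V F)} {τ : RingAut E} (hg : g ∈ linearGroup F ⊔ G)
    (h : Acts θ τ g) : ∃ j : ℕ, τ = τ₀ ^ j := by
  obtain ⟨n, hn, i, j, hnij⟩ := K.decomp g hg τ h
  refine ⟨j, K.model.acts_unique h ?_⟩
  rw [hnij]
  simpa using ((K.acts_of_mem_WZ hn).mul (K.acts_c_pow i)).mul (K.acts_y₀_pow j)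

/-- An automorphism of E whose restriction to F occurs in `G` is induced by a map in Ḡ that fixes v₀
and preserves the plane, and `decomp` applies to that map. -/
theorem tau_eq_pow_of_restrict {τ : RingAut E} {σ : RingAut F}
    (h : ∀ k, τ (algebraMap F E k) = algebraMap F E (σ k)) {g : Equiv.Perm (V F)} (hg : g ∈ G)
    (hσ : Semi σ g) : ∃ j : ℕ, τ = τ₀ ^ j := by
  obtain ⟨f, hf⟩ := K.model.exists_frame one_ne_zero h
  exact K.tau_eq_pow ((mem_sup_iff K.le_GammaL).2 ⟨σ, hf.semi, g, hg, hσ⟩) (hf.acts one_ne_zero)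

theorem sigma_eq_pow {τ : RingAut E} {σ : RingAut F}
    (h : ∀ k, τ (algebraMap F E k) = algebraMap F E (σ k)) {j : ℕ} (hj : τ = τ₀ ^ j) :
    σ = σ₀ ^ j := by
  ext k
  apply (algebraMap F E).injective
  rw [← h, hj, K.restrict]

theorem range_fieldHom [Finite E] {φ : G →* RingAut F}
    (hφ : ∀ g : G, Semi (φ g) (g : Equiv.Perm (V F))) : φ.range = Subgroup.zpowers σ₀ := by
  refine le_antisymm ?_ ?_
  · rintro _ ⟨g, rfl⟩
    obtain ⟨τ, hτ⟩ := exists_extension (E := E) (φ g)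
    obtain ⟨j, hj⟩ := K.tau_eq_pow_of_restrict hτ g.2 (hφ g)
    rw [K.sigma_eq_pow hτ hj]
    exact Subgroup.pow_mem _ (Subgroup.mem_zpowers σ₀) j
  · rw [Subgroup.zpowers_le]
    obtain ⟨σ, hσ, g, hg, hσ'⟩ := (mem_sup_iff K.le_GammaL).1 K.y₀_mem
    refine ⟨⟨g, hg⟩, ?_⟩
    rw [(hφ ⟨g, hg⟩).unique hσ', hσ.unique K.frame_y₀.semi]

theorem fieldIndex_eq [Finite E] : fieldIndex G = orderOf σ₀ := by
  obtain ⟨φ, hφ⟩ := exists_fieldHom K.le_GammaL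
  have hker : (linearGroup F).subgroupOf G = φ.ker := by
    ext g
    rw [Subgroup.mem_subgroupOf, mem_linearGroup_iff_semi, MonoidHom.mem_ker]
    exact ⟨fun h => (hφ g).unique h, fun h => h ▸ hφ g⟩
  rw [fieldIndex, Subgroup.relIndex, hker, Subgroup.index_ker, K.range_fieldHom hφ,
    Nat.card_zpowers]

theorem fix_iff (j : ℕ) : (∀ k, (τ₀ ^ j) (algebraMap F E k) = algebraMap F E k) ↔ σ₀ ^ j = 1 := by
  constructor
  · intro h
    ext k
    apply (algebraMap F E).injective
    rw [← K.restrict, h, RingAut.one_apply]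
  · intro h k
    rw [K.restrict, h, RingAut.one_apply]

theorem ι_mul_ι : ι * ι = 1 := by
  refine (K.ι_unique (ι * ι) fun k => ?_).resolve_right fun h => K.ι_ne ?_
  · rw [RingAut.mul_apply, K.ι_fix, K.ι_fix]
  · simpa using h

theorem orderOf_ι : orderOf ι = 2 := orderOf_eq_prime (by rw [sq, K.ι_mul_ι]) K.ι_ne

/-- ι is a power of τ₀ that is trivial on F, so it is a power of τ₀^{e_G}. The latter is 1 or ι, and
it cannot be 1. -/
theorem τ₀_pow_e : τ₀ ^ orderOf σ₀ = ι := by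
  obtain ⟨j, hj⟩ := K.tau_eq_pow_of_restrict (τ := ι) (σ := 1) (fun k => K.ι_fix k) G.one_mem Semi.one
  have h1 : σ₀ ^ j = 1 := by
    rw [← K.fix_iff, ← hj]
    exact K.ι_fix
  obtain ⟨i, rfl⟩ := orderOf_dvd_of_pow_eq_one h1
  refine (K.ι_unique _ ((K.fix_iff _).2 (pow_orderOf_eq_one σ₀))).resolve_left fun h => K.ι_ne ?_
  rw [hj, pow_mul, h, one_pow]

theorem orderOf_τ₀ [Finite E] : orderOf τ₀ = 2 * orderOf σ₀ := by
  have h1 : orderOf σ₀ ∣ orderOf τ₀ := by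
    apply orderOf_dvd_of_pow_eq_one
    rw [← K.fix_iff, pow_orderOf_eq_one]
    exact fun k => rfl
  have h2 := K.orderOf_ι
  have hfin : Finite F := Finite.of_injective _ (algebraMap F E).injective
  have h3 : 0 < orderOf σ₀ := orderOf_pos _
  rw [← K.τ₀_pow_e, orderOf_pow_of_dvd h3.ne' h1] at h2
  rw [← h2, Nat.div_mul_cancel h1]

end Configuration

/-! ### Transitivity of L^{ΓL₁} and maximality of the line stabilizer -/

section
variable {F : Type w} [Field F]

theorem s_conj_mul (a b : Equiv.Perm (V F)) :
    s F * (a * b) * s F = (s F * a * s F) * (s F * b * s F) := by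
  have : (s F * a * s F) * (s F * b * s F) = s F * a * (s F * s F) * b * s F := by group
  rw [this, s_mul_s]
  group

theorem s_conj_inv (a : Equiv.Perm (V F)) : s F * a⁻¹ * s F = (s F * a * s F)⁻¹ := by
  rw [mul_inv_rev, mul_inv_rev, s_inv]
  group

theorem s_conj_conj (a : Equiv.Perm (V F)) : s F * (s F * a * s F) * s F = a := by
  have : s F * (s F * a * s F) * s F = (s F * s F) * a * (s F * s F) := by group
  rw [this, s_mul_s]
  group

theorem exists_pow_eq_inv {Q : Type*} [Group Q] [Finite Q] (g : Q) (j : ℕ) :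
    ∃ k : ℕ, g ^ k = (g ^ j)⁻¹ := by
  have h : (g ^ j)⁻¹ ∈ Subgroup.zpowers g :=
    Subgroup.inv_mem _ (Subgroup.pow_mem _ (Subgroup.mem_zpowers g) j)
  exact mem_powers_iff_mem_zpowers.2 h

theorem s_conj_mem_sup {G : Subgroup (Equiv.Perm (V F))} {d : Equiv.Perm (V F)} (h : d ∈ linearGroup F ⊔ G) :
    s F * d * s F ∈ linearGroup F ⊔ G := by
  have hs : s F ∈ linearGroup F ⊔ G := Subgroup.mem_sup_left s_mem_linearGroup
  exact Subgroup.mul_mem _ (Subgroup.mul_mem _ hs h) hs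

/-- Every element of `G` that moves `α₀` lies in the double coset `L s L`. -/
def IsTransitiveOn (G L : Subgroup (Equiv.Perm (V F))) : Prop :=
  ∀ g ∈ G, g (v F 0) ∉ line F 0 → ∃ a ∈ L, ∃ b ∈ L, g = a * s F * b

/-- The stabilizer of `α₀` in `G`. -/
def lineStabilizer (G : Subgroup (Equiv.Perm (V F))) : Subgroup G :=
  (MulAction.stabilizer (Equiv.Perm (V F)) (line F 0 : Set (V F))).subgroupOf G

theorem mem_lineStabilizer {G : Subgroup (Equiv.Perm (V F))} (hG : G ≤ GammaL F) {g : G} :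
    g ∈ lineStabilizer G ↔ (g : Equiv.Perm (V F)) (v F 0) ∈ line F 0 := by
  rw [lineStabilizer, Subgroup.mem_subgroupOf]
  obtain ⟨σ, hσ⟩ := mem_GammaL_iff.1 (hG g.2)
  have hv : v F 0 ∈ line F 0 := Submodule.mem_span_singleton_self _
  constructor
  · intro h
    rw [MulAction.mem_stabilizer_iff] at h
    have h2 := Set.smul_mem_smul_set (a := (g : Equiv.Perm (V F)))
      (show v F 0 ∈ (line F 0 : Set (V F)) from hv)
    rw [h] at h2
    exact h2
  · intro h
    obtain ⟨μ, hμ⟩ := Submodule.mem_span_singleton.1 h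
    have hμ0 : μ ≠ 0 := by
      rintro rfl
      rw [zero_smul] at hμ
      exact hσ.map_ne_zero (v_ne_zero 0) hμ.symm
    rw [MulAction.mem_stabilizer_set]
    intro u
    rw [Equiv.Perm.smul_def, SetLike.mem_coe, SetLike.mem_coe]
    constructor
    · intro hu
      obtain ⟨κ, hκ⟩ := Submodule.mem_span_singleton.1 hu
      refine Submodule.mem_span_singleton.2 ⟨σ⁻¹ (κ * μ⁻¹), (g : Equiv.Perm (V F)).injective ?_⟩
      rw [hσ.2, ← RingAut.mul_apply, mul_inv_cancel, RingAut.one_apply, ← hμ, smul_smul, ← hκ,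
        mul_assoc, inv_mul_cancel₀ hμ0, mul_one]
    · intro hu
      obtain ⟨κ, rfl⟩ := Submodule.mem_span_singleton.1 hu
      rw [hσ.2]
      exact Submodule.smul_mem _ _ h

end

namespace Configuration

variable {F E : Type w} [Field F] [Field E] [Algebra F E]
  {G : Subgroup (Equiv.Perm (V F))} {θ ζ : E} {c x₀ y₀ x y : Equiv.Perm (V F)}
  {τ₀ ι : RingAut E} {σ₀ : RingAut F} {l : F} {t r : ℕ}
  (K : Configuration G θ ζ c x₀ y₀ x y τ₀ ι σ₀ l t r)
include K

theorem mem_line_iff {u : V F} : u ∈ line F 0 ↔ PlaneField.proj θ u = 0 := by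
  rw [mem_line_zero]
  exact ⟨fun h => by simp [PlaneField.proj, h], K.model.proj_eq_zero⟩

theorem exists_pair (j : ℕ) : ∃ n ∈ W G, Acts θ (τ₀ ^ j) (n * y₀ ^ j) ∧
    Acts θ (τ₀ ^ j) (s F * (n * y₀ ^ j) * s F) :=
  K.model.exists_transvec_pair (K.frame_y₀_pow j) K.le_GammaL K.SL_le

/-- The two-point stabilizers without field automorphisms on the first structure. -/
theorem mem_of_acts_one {d : Equiv.Perm (V F)} {τ : RingAut E} (h : Acts θ 1 d)
    (h' : Acts θ τ (s F * d * s F)) : d ∈ G := by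
  have hfix : ∀ k, τ (algebraMap F E k) = algebraMap F E k :=
    SingerModel.acts_restrict h' (s_conj_semi (SingerModel.acts_one_semi h))
  obtain ⟨A, hA⟩ := K.ι_θ
  rcases K.ι_unique τ hfix with rfl | rfl
  · exact K.Z_le (K.model.mem_Z_of_acts_one h h')
  · obtain ⟨ε, hε, h1, h2⟩ := SingerModel.exists_eps K.ι_fix hA
    have h3 : d * ε⁻¹ ∈ Z F := by
      refine K.model.mem_Z_of_acts_one (by simpa using h.mul h1.inv) ?_
      rw [s_conj_mul, s_conj_inv]
      simpa using h'.mul h2.inv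
    exact (Subgroup.mul_mem_cancel_right G (G.inv_mem (K.SL_le
      (mem_specialLinearGroup_iff.2 hε)))).1 (K.Z_le h3)

/-- Modulo `G`, the maps compatible with both structures are just the powers of y₀: the corrected
y₀^j has the same automorphism on the first structure, and the quotient lies in `G` by
`mem_of_acts_one`. -/
theorem pair_eq {d : Equiv.Perm (V F)} {j : ℕ} {τ : RingAut E} (h : Acts θ (τ₀ ^ j) d)
    (h' : Acts θ τ (s F * d * s F)) : ∃ g ∈ G, d = g * y₀ ^ j := by
  obtain ⟨n, hn, h1, h2⟩ := K.exists_pair j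
  have h3 : d * (n * y₀ ^ j)⁻¹ ∈ G := by
    refine K.mem_of_acts_one (τ := τ * (τ₀ ^ j)⁻¹) (by simpa using h.mul h1.inv) ?_
    rw [s_conj_mul, s_conj_inv]
    exact h'.mul h2.inv
  exact ⟨d * (n * y₀ ^ j)⁻¹ * n, G.mul_mem h3 hn.1, by group⟩

/-- Write g = n₁ s n₂ in Ḡ. A map δ compatible with both structures gives g = (n₁δ⁻¹) s (sδs n₂),
again with factors semilinear over E. The hypothesis allows a δ with n₁δ⁻¹ in `G`; the other factor
is then in `G` because g and s are. -/
theorem isTransitiveOn_of_forall [Finite E] [Finite F]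
    (h : ∀ i, ∃ j : ℕ, x₀ ^ i * y₀ ^ j ∈ G) : IsTransitiveOn G (LGammaL G x y) := by
  intro g hg hgv
  rw [K.mem_line_iff] at hgv
  obtain ⟨n₁, hn₁, n₂, hn₂, hgn⟩ := K.model.exists_factor K.le_GammaL
    (Subgroup.mem_sup_right hg) hgv
  obtain ⟨hn₁', τ, hτ⟩ := hn₁
  obtain ⟨n, hn, i, j, hnij⟩ := K.decomp n₁ hn₁' τ hτ
  obtain ⟨g₁, hg₁, a, ha⟩ := K.exists_mul_x₀_pow (h := n * c ^ i)
    ((linearGroup F).mul_mem (K.acts_of_mem_WZ hn).linear (K.acts_c_pow i).linear)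
  obtain ⟨b, hb⟩ := h a
  obtain ⟨b', hb'⟩ := exists_pow_eq_inv y₀ b
  -- As y₀^{b'} = y₀^{-b}, dividing n₁ = g₁ x₀^a y₀^j by w y₀^{b'+j} leaves g₁ (x₀^a y₀^b) w⁻¹, a
  -- product of elements of G.
  obtain ⟨w, hw, hp₁, hp₂⟩ := K.exists_pair (b' + j)
  have hδ : w * y₀ ^ (b' + j) ∈ linearGroup F ⊔ G :=
    Subgroup.mul_mem _ (Subgroup.mem_sup_right hw.1) (Subgroup.pow_mem _ K.y₀_mem _)
  have hA : n₁ * (w * y₀ ^ (b' + j))⁻¹ ∈ G := by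
    have : n₁ * (w * y₀ ^ (b' + j))⁻¹ = g₁ * (x₀ ^ a * y₀ ^ b) * w⁻¹ := by
      rw [hnij, ha, pow_add, hb']
      group
    rw [this]
    exact G.mul_mem (G.mul_mem hg₁ hb) (G.inv_mem hw.1)
  refine ⟨n₁ * (w * y₀ ^ (b' + j))⁻¹, K.mem_LGammaL_iff.2 ⟨hA, Subgroup.mul_mem _ ⟨hn₁', τ, hτ⟩
    (Subgroup.inv_mem _ ⟨hδ, _, hp₁⟩)⟩, s F * (w * y₀ ^ (b' + j)) * s F * n₂,
    K.mem_LGammaL_iff.2 ⟨?_, Subgroup.mul_mem _ ⟨s_conj_mem_sup hδ, _, hp₂⟩ hn₂⟩, ?_⟩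
  · have : s F * (w * y₀ ^ (b' + j)) * s F * n₂ =
        s F * (n₁ * (w * y₀ ^ (b' + j))⁻¹)⁻¹ * g := by
      rw [hgn]; group
    rw [this]
    exact G.mul_mem (G.mul_mem K.s_mem (G.inv_mem hA)) hg
  · have : n₁ * (w * y₀ ^ (b' + j))⁻¹ * s F * (s F * (w * y₀ ^ (b' + j)) * s F * n₂) =
        n₁ * (w * y₀ ^ (b' + j))⁻¹ * (s F * s F) * (w * y₀ ^ (b' + j)) * s F * n₂ := by group
    rw [this, s_mul_s, hgn]
    group

/-- The test element is the conjugate of s by x₀^i, which has determinant one. If it equals a s b,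
then a⁻¹x₀^i is compatible with both structures, so x₀^i lies in G y₀^j for some j. -/
theorem forall_of_isTransitiveOn [Finite F] (h : IsTransitiveOn G (LGammaL G x y)) (i : ℕ) :
    ∃ j : ℕ, x₀ ^ i * y₀ ^ j ∈ G := by
  have hf := K.frame_x₀_pow i
  have hne : algebraMap F E (l ^ i) ≠ 0 := by simpa using fun h => absurd h K.l_ne
  have hmem : x₀ ^ i * s F * (x₀ ^ i)⁻¹ ∈ G := by
    refine K.SL_le (mem_specialLinearGroup_iff.2 ?_)
    have h1 := ((K.hasDet_x₀_pow i).mul hasDet_s).mul (K.hasDet_x₀_pow i).inv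
    have h2 : (l ^ i) ^ 2 * 1 * ((l ^ i) ^ 2)⁻¹ = 1 := by
      have := K.l_ne
      field_simp
    rwa [h2] at h1
  obtain ⟨a, ha, b, hb, hab⟩ := h _ hmem (by
    rw [K.mem_line_iff, Equiv.Perm.mul_apply, Equiv.Perm.mul_apply,
      (hf.inv hne).v0 K.model.indep, s_v0, hf.proj, proj_v1]
    simpa using fun h => absurd h K.l_ne)
  obtain ⟨ha, ha', τ, hτ⟩ := K.mem_LGammaL_iff.1 ha
  obtain ⟨hb, hb', τ', hτ'⟩ := K.mem_LGammaL_iff.1 hb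
  have hd := hτ.inv.mul (K.acts_x₀_pow i)
  obtain ⟨j, hj⟩ := K.tau_eq_pow (Subgroup.mul_mem _ (Subgroup.inv_mem _ ha')
    (K.x₀_pow_mem i).1) hd
  rw [hj] at hd
  obtain ⟨g, hg, hgj⟩ := K.pair_eq (τ := τ') hd (by
    have e : s F * (a⁻¹ * x₀ ^ i) * s F = b * x₀ ^ i := by
      have : a⁻¹ * x₀ ^ i * s F = s F * b * x₀ ^ i := by
        have : a⁻¹ * x₀ ^ i * s F = a⁻¹ * (x₀ ^ i * s F * (x₀ ^ i)⁻¹) * x₀ ^ i := by group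
        rw [this, hab]; group
      rw [mul_assoc, this, ← mul_assoc, ← mul_assoc, s_mul_s, one_mul]
    rw [e]
    simpa using hτ'.mul (K.acts_x₀_pow i))
  obtain ⟨j', hj'⟩ := exists_pow_eq_inv y₀ j
  refine ⟨j', ?_⟩
  have : x₀ ^ i * y₀ ^ j' = a * g := by
    rw [hj', show x₀ ^ i = a * (a⁻¹ * x₀ ^ i) by group, hgj]
    group
  rw [this]
  exact G.mul_mem ha hg

theorem s_notMem : (⟨s F, K.s_mem⟩ : G) ∉ lineStabilizer G := by
  rw [mem_lineStabilizer K.le_GammaL, K.mem_line_iff]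
  simp [s_v0, proj_v1]

/-- The factors in Ḡ are moved into `G` by a matrix diag(1, 1, k), which fixes v₀ and commutes with
s; k corrects the determinant. They need not stay semilinear over E, but they still fix α₀. -/
theorem exists_factor_mem [Finite E] {g : G} (hg : g ∉ lineStabilizer G) :
    ∃ a ∈ lineStabilizer G, ∃ b ∈ lineStabilizer G, g = a * ⟨s F, K.s_mem⟩ * b := by
  rw [mem_lineStabilizer K.le_GammaL, K.mem_line_iff] at hg
  obtain ⟨a, ⟨ha, τ, hτ⟩, b, ⟨-, τ', hτ'⟩, hab⟩ := K.model.exists_factor K.le_GammaL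
    (Subgroup.mem_sup_right g.2) hg
  obtain ⟨σ, hσ, g', hg', hσ'⟩ := (mem_sup_iff K.le_GammaL).1 ha
  obtain ⟨k, hk⟩ := mem_linearGroup_iff_hasDet.1
    (show g'⁻¹ * a ∈ linearGroup F from
      mem_linearGroup_iff_semi.2 (by simpa using hσ'.inv.mul hσ))
  have hk0 := hk.ne_zero
  let d : Equiv.Perm (V F) :=
    { toFun := fun u => ![u 0, u 1, k * u 2]
      invFun := fun u => ![u 0, u 1, k⁻¹ * u 2]
      left_inv := fun u => by ext i; fin_cases i <;> simp [hk0]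
      right_inv := fun u => by ext i; fin_cases i <;> simp [hk0] }
  have hd : ∀ u, d u = ![u 0, u 1, k * u 2] := fun u => rfl
  have hdet : HasDet d k := by
    refine ⟨!![1, 0, 0; 0, 1, 0; 0, 0, k], by simp [Matrix.det_fin_three], fun u => ?_⟩
    rw [hd]
    ext i
    fin_cases i <;> simp [Matrix.mulVec, dotProduct, Fin.sum_univ_three]
  have hds : d⁻¹ * s F * d = s F := by
    rw [mul_assoc, inv_mul_eq_iff_eq_mul]
    ext u i
    simp only [Equiv.Perm.mul_apply, hd, s_apply]
    fin_cases i <;> simp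
  have hd0 : d (v F 0) = v F 0 := by
    rw [hd]; ext i; fin_cases i <;> simp [v]
  have hd0' : d⁻¹ (v F 0) = v F 0 := by rw [Equiv.Perm.inv_eq_iff_eq, hd0]
  have hsemi : Semi 1 d := mem_linearGroup_iff_semi.1 (mem_linearGroup_iff_hasDet.2 ⟨_, hdet⟩)
  have hA : a * d⁻¹ ∈ G := by
    have h1 := hk.mul hdet.inv
    rw [mul_inv_cancel₀ hk0] at h1
    have : a * d⁻¹ = g' * (g'⁻¹ * a * d⁻¹) := by group
    rw [this]
    exact G.mul_mem hg' (K.SL_le (mem_specialLinearGroup_iff.2 h1))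
  have hgab : (g : Equiv.Perm (V F)) = (a * d⁻¹) * s F * (d * b) := by
    rw [hab]
    conv_lhs => rw [← hds]
    group
  have hB : d * b ∈ G := by
    have : d * b = (s F)⁻¹ * (a * d⁻¹)⁻¹ * g := by rw [hgab]; group
    rw [this]
    exact G.mul_mem (G.mul_mem (G.inv_mem K.s_mem) (G.inv_mem hA)) g.2
  obtain ⟨μ, -, hμ⟩ := K.model.acts_v0 hτ
  obtain ⟨ν, -, hν⟩ := K.model.acts_v0 hτ'
  have hv : ∀ μ : F, μ • v F 0 ∈ line F 0 := fun μ =>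
    Submodule.smul_mem _ _ (Submodule.mem_span_singleton_self _)
  refine ⟨⟨a * d⁻¹, hA⟩, ?_, ⟨d * b, hB⟩, ?_, Subtype.ext hgab⟩
  · rw [mem_lineStabilizer K.le_GammaL]
    change a (d⁻¹ (v F 0)) ∈ _
    rw [hd0', hμ]
    exact hv μ
  · rw [mem_lineStabilizer K.le_GammaL]
    change d (b (v F 0)) ∈ _
    rw [hν, hsemi.2, hd0]
    exact hv _

theorem lineStabilizer_ne_top : lineStabilizer G ≠ ⊤ := fun h => K.s_notMem (h ▸ trivial)

/-- With P the stabilizer of α₀, G = P ∪ PsP, so a larger subgroup contains s. -/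
theorem lineStabilizer_maximal [Finite E] (M : Subgroup G) (hM : lineStabilizer G ≤ M) :
    M = lineStabilizer G ∨ M = ⊤ := by
  by_cases h : M ≤ lineStabilizer G
  · exact Or.inl (le_antisymm h hM)
  · right
    obtain ⟨g, hgM, hg⟩ := SetLike.not_le_iff_exists.1 h
    obtain ⟨a, ha, b, hb, rfl⟩ := K.exists_factor_mem hg
    have hs := (Subgroup.mul_mem_cancel_left M (hM ha)).1
      ((Subgroup.mul_mem_cancel_right M (hM hb)).1 hgM)
    rw [Subgroup.eq_top_iff']
    intro k
    by_cases hk : k ∈ lineStabilizer G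
    · exact hM hk
    · obtain ⟨a, ha, b, hb, rfl⟩ := K.exists_factor_mem hk
      exact M.mul_mem (M.mul_mem (hM ha) hs) (hM hb)

theorem le_lineStabilizer {L : Subgroup (Equiv.Perm (V F))} (hL : L ≤ LGammaL G x y) :
    L.subgroupOf G ≤ lineStabilizer G := by
  intro g hg
  obtain ⟨-, -, τ, hτ⟩ := K.mem_LGammaL_iff.1 (hL hg)
  obtain ⟨μ, -, hμ⟩ := K.model.acts_v0 hτ
  rw [mem_lineStabilizer K.le_GammaL]
  exact hμ ▸ Submodule.smul_mem _ _ (Submodule.mem_span_singleton_self _)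

theorem eq_lineStabilizer [Finite E] {L : Subgroup (Equiv.Perm (V F))} (hL : L ≤ LGammaL G x y)
    {M : Subgroup G} (hM : IsBlockSubgroup (L.subgroupOf G) M) : M = lineStabilizer G :=
  hM.eq_of_maximal (K.le_lineStabilizer hL) K.lineStabilizer_ne_top K.lineStabilizer_maximal

theorem isBlockSubgroup_iff {L : Subgroup (Equiv.Perm (V F))} (hL : L ≤ LGammaL G x y) :
    IsBlockSubgroup (L.subgroupOf G) (lineStabilizer G) ↔ IsTransitiveOn G L := by
  constructor
  · intro h g hg hgv
    have hg' : (⟨g, hg⟩ : G) ∉ lineStabilizer G := by rwa [mem_lineStabilizer K.le_GammaL]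
    obtain ⟨a, ha, b, hb, hab⟩ := h.double _ _ K.s_notMem hg'
    exact ⟨a, ha, b, hb, congrArg Subtype.val hab⟩
  · intro h
    refine ⟨K.le_lineStabilizer hL, K.lineStabilizer_ne_top, fun g k hg hk => ?_⟩
    rw [mem_lineStabilizer K.le_GammaL] at hg hk
    obtain ⟨a, ha, b, hb, hab⟩ := h g g.2 hg
    obtain ⟨a', ha', b', hb', hab'⟩ := h k k.2 hk
    have hLG : L ≤ G := fun l hl => (K.mem_LGammaL_iff.1 (hL hl)).1
    refine ⟨⟨a' * a⁻¹, G.mul_mem (hLG ha') (G.inv_mem (hLG ha))⟩, L.mul_mem ha' (L.inv_mem ha),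
      ⟨b⁻¹ * b', G.mul_mem (G.inv_mem (hLG hb)) (hLG hb')⟩, L.mul_mem (L.inv_mem hb) hb',
      Subtype.ext ?_⟩
    change (k : Equiv.Perm (V F)) = a' * a⁻¹ * g * (b⁻¹ * b')
    rw [hab', hab]
    group

/-- The maximality of the stabilizer of α₀ leaves a single candidate for the block system, so the
existential over equivalence relations becomes a double coset condition. -/
theorem mem_pointStabilizers_iff [Finite E] {L : Subgroup (Equiv.Perm (V F))} :
    L ∈ pointStabilizers G x y ↔ L ≤ LGammaL G x y ∧ Z F ≤ L ∧ IsTransitiveOn G L := by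
  refine and_congr_right fun hL => and_congr_right fun _ => ?_
  rw [← K.isBlockSubgroup_iff hL]
  constructor
  · rintro ⟨ρ, hρ⟩
    obtain ⟨M, hM, -⟩ := hρ.exists_block
    rwa [K.eq_lineStabilizer hL hM] at hM
  · exact fun h => h.exists_setoid

end Configuration

/-! ### The numerical criterion for transitivity when t = 3 -/

/-- The automorphisms of a finite field are the powers of the Frobenius automorphism. -/
theorem exists_frobenius_pow {F : Type*} [Field F] [Finite F] {p e : ℕ} (hp : p.Prime)
    (hF : Nat.card F = p ^ e) : ∃ φ : RingAut F, (∀ (k : ℕ) (a : F), (φ ^ k) a = a ^ p ^ k) ∧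
      ∀ σ : RingAut F, ∃ n : ℕ, σ = φ ^ n := by
  have : Fintype F := Fintype.ofFinite F
  have : Fact p.Prime := ⟨hp⟩
  have : CharP F p := charP_of_card_eq_prime_pow (p := p) (f := e) (by
    rw [← hF, Nat.card_eq_fintype_card])
  let : Algebra (ZMod p) F := ZMod.algebra F p
  let f := FiniteField.frobeniusAlgEquivOfAlgebraic (ZMod p) F
  let φ : RingAut F := f.toRingEquiv
  have hφ1 : ∀ a : F, φ a = a ^ p := fun a => by
    change a ^ Fintype.card (ZMod p) = _
    rw [ZMod.card]
  have hφ : ∀ (k : ℕ) (a : F), (φ ^ k) a = a ^ p ^ k := by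
    intro k
    induction k with
    | zero => simp
    | succ k ih =>
      intro a
      rw [pow_succ', RingAut.mul_apply, ih, hφ1, ← pow_mul, pow_succ]
  refine ⟨φ, hφ, fun σ => ?_⟩
  let g : F ≃ₐ[ZMod p] F := AlgEquiv.ofRingEquiv (f := σ) (fun x =>
    RingHom.congr_fun (RingHom.ext_zmod ((σ : F →+* F).comp (algebraMap (ZMod p) F))
      (algebraMap (ZMod p) F)) x)
  obtain ⟨n, hn⟩ := (FiniteField.bijective_frobeniusAlgEquivOfAlgebraic_pow (ZMod p) F).2 g
  refine ⟨n, ?_⟩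
  ext a
  have hpow : ∀ (k : ℕ) (a : F), (f ^ k) a = a ^ p ^ k := by
    intro k
    induction k with
    | zero => simp
    | succ k ih =>
      intro a
      rw [pow_succ', AlgEquiv.mul_apply, ih, show f (a ^ p ^ k) = (a ^ p ^ k) ^ p from hφ1 _,
        ← pow_mul, pow_succ]
  rw [hφ, ← hpow]
  exact (AlgEquiv.congr_fun hn a).symm

/-- Let `3` divide `p ^ e - 1`. An automorphism `x ↦ x ^ (p ^ n)` of the field of order `p ^ e`
that has order `k` fixes the cube roots of unity if and only if `p ^ (e / k) ≡ 1` modulo `3`. -/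
theorem exponent_modEq_iff {F : Type*} [Field F] [Finite F] {p e : ℕ} (hp : p.Prime)
    (hF : Nat.card F = p ^ e) {l : F} (hl : orderOf l = Nat.card F - 1)
    (h3 : 3 ∣ Nat.card F - 1) {σ : RingAut F} {m : ℕ} (hm : σ l = l ^ m) :
    m ≡ 1 [MOD 3] ↔ p ^ (e / orderOf σ) ≡ 1 [MOD 3] := by
  obtain ⟨φ, hφ, hgen⟩ := exists_frobenius_pow hp hF
  obtain ⟨n, rfl⟩ := hgen σ
  have hcard : 1 < Nat.card F := Finite.one_lt_card
  have he : 0 < e := Nat.pos_of_ne_zero (by rintro rfl; rw [hF] at hcard; simp at hcard)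
  have hord : orderOf φ = e := by
    rw [orderOf_eq_iff he]
    refine ⟨?_, fun k hk hk0 h => ?_⟩
    · ext a
      rw [hφ, ← hF, RingAut.one_apply]
      have : Fintype F := Fintype.ofFinite F
      rw [Nat.card_eq_fintype_card, FiniteField.pow_card]
    · have h1 : l ^ p ^ k = l ^ 1 := by rw [← hφ, h, pow_one, RingAut.one_apply]
      have hl0 : l ≠ 0 := by
        rintro rfl
        rw [orderOf_zero] at hl
        omega
      have h2 : 1 ≡ p ^ k [MOD Nat.card F - 1] := by
        rw [← hl]
        have h3 : orderOf (Units.mk0 l hl0) = orderOf l := by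
          rw [← orderOf_units, Units.val_mk0]
        rw [← h3, ← pow_eq_pow_iff_modEq]
        ext
        simpa using h1.symm
      have h4 := (Nat.modEq_iff_dvd' (Nat.one_le_pow _ _ hp.pos)).1 h2
      have h5 : p ^ k < p ^ e := Nat.pow_lt_pow_right hp.one_lt hk
      have h6 : 1 < p ^ k := Nat.one_lt_pow hk0.ne' hp.one_lt
      have := Nat.le_of_dvd (by omega) h4
      omega
  have hmn : m ≡ p ^ n [MOD 3] := by
    have hl0 : l ≠ 0 := by
      rintro rfl
      rw [orderOf_zero] at hl
      omega
    have h2 : m ≡ p ^ n [MOD Nat.card F - 1] := by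
      rw [← hl]
      have h3 : orderOf (Units.mk0 l hl0) = orderOf l := by
        rw [← orderOf_units, Units.val_mk0]
      rw [← h3, ← pow_eq_pow_iff_modEq]
      ext
      simpa [hφ] using hm.symm
    exact h2.of_dvd h3
  -- The condition thus concerns p^{gcd(e, n)}. Since p^e ≡ 1 modulo 3 already, it is equivalent to
  -- p^n ≡ 1.
  have hquot : e / orderOf (φ ^ n) = e.gcd n := by
    rw [orderOf_pow, hord]
    exact Nat.div_div_self (Nat.gcd_dvd_left _ _) he.ne'
  have hone : ∀ k, p ^ k ≡ 1 [MOD 3] ↔ orderOf (p : ZMod 3) ∣ k := by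
    intro k
    rw [orderOf_dvd_iff_pow_eq_one, ← Nat.cast_pow, ← ZMod.natCast_eq_natCast_iff]
    simp
  have hpe : p ^ e ≡ 1 [MOD 3] := by
    rw [← hF]
    exact ((Nat.modEq_iff_dvd' (by omega)).2 h3).symm
  rw [hquot, hone, Nat.dvd_gcd_iff, ← hone, ← hone]
  exact ⟨fun h => ⟨hpe, hmn.symm.trans h⟩, fun h => hmn.trans h.2⟩

namespace Configuration

variable {F E : Type w} [Field F] [Field E] [Algebra F E]
  {G : Subgroup (Equiv.Perm (V F))} {θ ζ : E} {c x₀ y₀ x y : Equiv.Perm (V F)}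
  {τ₀ ι : RingAut E} {σ₀ : RingAut F} {l : F} {t r : ℕ}
  (K : Configuration G θ ζ c x₀ y₀ x y τ₀ ι σ₀ l t r)
include K

theorem mul_mem_of_modEq {a b : ℕ} {z : Equiv.Perm (V F)} (h : a ≡ b [MOD t])
    (ha : x₀ ^ a * z ∈ G) : x₀ ^ b * z ∈ G := by
  rcases le_total a b with hab | hab
  · obtain ⟨j, hj⟩ := (Nat.modEq_iff_dvd' hab).1 h
    have hmem := (K.x₀_pow_mem_iff (b - a)).2 ⟨j, hj⟩
    have : x₀ ^ b * z = x₀ ^ (b - a) * (x₀ ^ a * z) := by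
      rw [← mul_assoc, ← pow_add, Nat.sub_add_cancel hab]
    rw [this]
    exact G.mul_mem hmem ha
  · obtain ⟨j, hj⟩ := (Nat.modEq_iff_dvd' hab).1 h.symm
    have hmem := (K.x₀_pow_mem_iff (a - b)).2 ⟨j, hj⟩
    have : x₀ ^ a * z = x₀ ^ (a - b) * (x₀ ^ b * z) := by
      rw [← mul_assoc, ← pow_add, Nat.sub_add_cancel hab]
    rw [this] at ha
    exact (Subgroup.mul_mem_cancel_left G hmem).1 ha

theorem x₀_pow_mul_y₀_pow_mem {m : ℕ} (hm : σ₀ l = l ^ m) (hmt : m ≡ 1 [MOD t]) (k : ℕ) :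
    x₀ ^ (r * k) * y₀ ^ k ∈ G := by
  induction k with
  | zero => simp
  | succ k ih =>
    have h1 : x₀ ^ (r * k + m ^ k * r) * y₀ ^ (k + 1) ∈ G := by
      have : x₀ ^ (r * k + m ^ k * r) * y₀ ^ (k + 1) = x₀ ^ (r * k) * y₀ ^ k * (x₀ ^ r * y₀) := by
        rw [pow_add, pow_succ, mul_assoc, ← mul_assoc (x₀ ^ (m ^ k * r)),
          ← K.y₀_pow_mul_x₀_pow hm]
        group
      rw [this]
      exact G.mul_mem ih K.mem
    refine K.mul_mem_of_modEq ?_ h1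
    have h2 : m ^ k ≡ 1 [MOD t] := by simpa using hmt.pow k
    calc r * k + m ^ k * r ≡ r * k + 1 * r [MOD t] := (h2.mul_right r).add_left _
      _ = r * (k + 1) := by ring

/-- This power is linear with square 1, so it equals its own cube, and cubes of linear maps lie in
G. -/
theorem y₀_pow_e_mem : y₀ ^ orderOf σ₀ ∈ G := by
  have h1 : y₀ ^ (2 * orderOf σ₀) = 1 := by
    have h := K.frame_y₀_pow (2 * orderOf σ₀)
    rw [mul_comm, pow_mul, pow_mul, K.τ₀_pow_e, pow_orderOf_eq_one, one_pow, sq, K.ι_mul_ι] at h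
    rw [mul_comm]
    exact K.model.frame_ext h Frame.one
  have h2 : y₀ ^ orderOf σ₀ ∈ linearGroup F := by
    have h := (K.frame_y₀_pow (orderOf σ₀)).semi
    rw [pow_orderOf_eq_one] at h
    exact mem_linearGroup_iff_semi.2 h
  have h3 : y₀ ^ orderOf σ₀ = (y₀ ^ orderOf σ₀) ^ 3 := by
    rw [← pow_mul, show orderOf σ₀ * 3 = orderOf σ₀ + 2 * orderOf σ₀ by ring, pow_add, h1, mul_one]
  rw [h3]
  exact K.cube_mem h2

/-- Here 3 divides q - 1, and a field automorphism cannot send a primitive cube root of unity to 1.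
-/
theorem not_three_dvd_exponent [Finite F] (ht : t = 3) {m : ℕ} (hm : σ₀ l = l ^ m) : ¬ 3 ∣ m := by
  rintro ⟨k, rfl⟩
  obtain ⟨a, ha⟩ := K.t_dvd_card_sub_one
  have hq : 1 < Nat.card F := Finite.one_lt_card
  have h1 : σ₀ (l ^ a) = 1 := by
    rw [map_pow, hm, ← pow_mul, show 3 * k * a = (t * a) * k by rw [ht]; ring, ← ha, ← K.l_order,
      pow_mul, pow_orderOf_eq_one, one_pow]
  have h2 : l ^ a = 1 := σ₀.injective (h1.trans (map_one σ₀).symm)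
  have h3 := Nat.le_of_dvd (Nat.pos_of_ne_zero (by rintro rfl; omega))
    (orderOf_dvd_of_pow_eq_one h2)
  rw [K.l_order, ha, ht] at h3
  have : a ≠ 0 := by rintro rfl; omega
  omega

/-- For t = 3 the powers of y₀ must reach all three cosets of ⟨x₀⟩ modulo ⟨x₀³⟩. If r = 0, they stay
in G. If m ≡ 2, they reach at most two cosets. If m ≡ 1, then x₀^{rk} y₀^k ∈ G for all k, and k =
e_G forces 3 ∣ e_G. -/
theorem forall_iff [Finite F] {m : ℕ} (hm : σ₀ l = l ^ m) :
    (∀ i, ∃ j : ℕ, x₀ ^ i * y₀ ^ j ∈ G) ↔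
      (t = 3 → r ≠ 0 ∧ 3 ∣ orderOf σ₀ ∧ m ≡ 1 [MOD 3]) := by
  constructor
  · intro h ht
    subst ht
    have hr0 : r ≠ 0 := by
      rintro rfl
      have hy : y₀ ∈ G := by simpa using K.mem
      obtain ⟨j, hj⟩ := h 1
      have := (K.x₀_pow_mem_iff 1).1 ((Subgroup.mul_mem_cancel_right G (G.pow_mem hy j)).1 hj)
      omega
    have hr3 : ¬ 3 ∣ r := fun hd => hr0 (Nat.eq_zero_of_dvd_of_lt hd K.lt)
    have hm1 : m ≡ 1 [MOD 3] := by
      by_contra hne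
      have hm2 : m ≡ 2 [MOD 3] := by
        have := K.not_three_dvd_exponent rfl hm
        unfold Nat.ModEq at hne ⊢
        omega
      -- y² = x₀^{r + mr} y₀², and r + mr ≡ 3r ≡ 0 modulo 3.
      have hy2 : y₀ ^ 2 ∈ G := by
        have h1 : x₀ ^ (r + m ^ 1 * r) * y₀ ^ 2 ∈ G := by
          have : x₀ ^ (r + m ^ 1 * r) * y₀ ^ 2 = (x₀ ^ r * y₀) * (x₀ ^ r * y₀) := by
            have := K.y₀_pow_mul_x₀_pow hm 1 r
            rw [pow_one] at this
            rw [pow_add, mul_assoc, sq, ← mul_assoc (x₀ ^ (m ^ 1 * r)), ← this]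
            group
          rw [this]
          exact G.mul_mem K.mem K.mem
        have h2 : r + m ^ 1 * r ≡ 0 [MOD 3] := by
          have : r + m ^ 1 * r ≡ r + 2 * r [MOD 3] := by
            rw [pow_one]
            exact (hm2.mul_right r).add_left _
          refine this.trans ((Nat.modEq_zero_iff_dvd).2 ⟨r, by ring⟩)
        simpa using K.mul_mem_of_modEq h2 h1
      -- Even powers of y₀ reach only the class 0 and odd ones only the class r, so the class 2r is
      -- missed.
      obtain ⟨j, hj⟩ := h (2 * r)
      rcases Nat.even_or_odd' j with ⟨a, rfl | rfl⟩
      · rw [pow_mul y₀] at hj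
        have h1 := (K.x₀_pow_mem_iff _).1
          ((Subgroup.mul_mem_cancel_right G (G.pow_mem hy2 a)).1 hj)
        omega
      · rw [pow_succ', pow_mul y₀, ← mul_assoc] at hj
        have h1 := (Subgroup.mul_mem_cancel_right G (G.pow_mem hy2 a)).1 hj
        rw [two_mul, pow_add, mul_assoc] at h1
        exact hr3 ((K.x₀_pow_mem_iff _).1 ((Subgroup.mul_mem_cancel_right G K.mem).1 h1))
    refine ⟨hr0, ?_, hm1⟩
    have h1 := K.x₀_pow_mul_y₀_pow_mem hm hm1 (orderOf σ₀)
    have h2 := (K.x₀_pow_mem_iff _).1 ((Subgroup.mul_mem_cancel_right G K.y₀_pow_e_mem).1 h1)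
    exact ((Nat.Prime.dvd_mul Nat.prime_three).1 h2).resolve_left hr3
  · intro h i
    rcases K.t_eq with rfl | rfl
    · exact ⟨0, by simpa using (K.x₀_pow_mem_iff i).2 (one_dvd i)⟩
    · obtain ⟨hr0, -, hm1⟩ := h rfl
      -- Modulo 3 the nonzero r is its own inverse, so r · (ri) ≡ i.
      refine ⟨r * i, K.mul_mem_of_modEq ?_ (K.x₀_pow_mul_y₀_pow_mem hm hm1 (r * i))⟩
      have hr := K.lt
      have h1 : r * r ≡ 1 [MOD 3] := by
        interval_cases r
        · exact absurd rfl hr0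
        · rfl
        · rfl
      calc r * (r * i) = r * r * i := by ring
        _ ≡ 1 * i [MOD 3] := h1.mul_right i
        _ = i := one_mul i

theorem isTransitiveOn_iff [Finite E] [Finite F] {p e : ℕ} (hp : p.Prime)
    (hF : Nat.card F = p ^ e) :
    IsTransitiveOn G (LGammaL G x y) ↔ (t = 3 → r ≠ 0 ∧ 3 ∣ fieldIndex G ∧
      p ^ (e / fieldIndex G) ≡ 1 [MOD 3]) := by
  obtain ⟨m, hm⟩ := K.exists_exponent
  have h1 : IsTransitiveOn G (LGammaL G x y) ↔ ∀ i, ∃ j : ℕ, x₀ ^ i * y₀ ^ j ∈ G :=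
    ⟨fun h i => K.forall_of_isTransitiveOn h i, fun h => K.isTransitiveOn_of_forall h⟩
  rw [h1, K.forall_iff hm, K.fieldIndex_eq]
  refine forall_congr' fun ht => and_congr_right fun _ => and_congr_right fun _ => ?_
  exact exponent_modEq_iff hp hF K.l_order (ht ▸ K.t_dvd_card_sub_one) hm

end Configuration

/-! ### Transitive subgroups of L^{ΓL₁} -/

section
variable {F : Type w} [Field F]

theorem mem_map_conj_s {L : Subgroup (Equiv.Perm (V F))} {k : Equiv.Perm (V F)} :
    k ∈ L.map (MulAut.conj (s F)).toMonoidHom ↔ s F * k * s F ∈ L := by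
  constructor
  · rintro ⟨a, ha, rfl⟩
    have : s F * (MulAut.conj (s F)).toMonoidHom a * s F = a := by
      change s F * (s F * a * (s F)⁻¹) * s F = a
      rw [s_inv, s_conj_conj]
    rwa [this]
  · intro h
    refine ⟨_, h, ?_⟩
    change s F * (s F * k * s F) * (s F)⁻¹ = k
    rw [s_inv, s_conj_conj]

theorem map_conj_s_map (L : Subgroup (Equiv.Perm (V F))) :
    (L.map (MulAut.conj (s F)).toMonoidHom).map (MulAut.conj (s F)).toMonoidHom = L := by
  ext k
  rw [mem_map_conj_s, mem_map_conj_s, s_conj_conj]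

end

section
variable {F : Type w} [Field F] {G : Subgroup (Equiv.Perm (V F))} {x y : Equiv.Perm (V F)}

theorem x_mem_LGammaL : x ∈ LGammaL G x y :=
  Subgroup.mem_sup_right (Subgroup.subset_closure (by simp))

theorem y_mem_LGammaL : y ∈ LGammaL G x y :=
  Subgroup.mem_sup_right (Subgroup.subset_closure (by simp))

theorem WZ_le_LGammaL : W G ⊔ Z F ≤ LGammaL G x y := le_sup_left

end

theorem mul_mem_iff_of_relIndex_two {Q : Type*} [Group Q] {L M : Subgroup Q}
    (h : L.relIndex M = 2) {a b : Q} (ha : a ∈ M) (hb : b ∈ M) :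
    a * b ∈ L ↔ (a ∈ L ↔ b ∈ L) :=
  Subgroup.mul_mem_iff_of_index_two (H := L.subgroupOf M) h (a := ⟨a, ha⟩) (b := ⟨b, hb⟩)

theorem sq_mem_of_relIndex_two {Q : Type*} [Group Q] {L M : Subgroup Q}
    (h : L.relIndex M = 2) {a : Q} (ha : a ∈ M) : a ^ 2 ∈ L := by
  rw [sq, mul_mem_iff_of_relIndex_two h ha ha]

theorem pow_mem_iff_of_relIndex_two {Q : Type*} [Group Q] {L M : Subgroup Q}
    (h : L.relIndex M = 2) {a : Q} (ha : a ∈ M) (k : ℕ) : a ^ k ∈ L ↔ a ∈ L ∨ Even k := by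
  rcases Nat.even_or_odd' k with ⟨i, rfl | rfl⟩
  · simp [pow_mul, L.pow_mem (sq_mem_of_relIndex_two h ha) i]
  · rw [pow_succ, pow_mul, Subgroup.mul_mem_cancel_left _
      (L.pow_mem (sq_mem_of_relIndex_two h ha) i)]
    simp

namespace Configuration

variable {F E : Type w} [Field F] [Field E] [Algebra F E]
  {G : Subgroup (Equiv.Perm (V F))} {θ ζ : E} {c x₀ y₀ x y : Equiv.Perm (V F)}
  {τ₀ ι : RingAut E} {σ₀ : RingAut F} {l : F} {t r : ℕ}
  (K : Configuration G θ ζ c x₀ y₀ x y τ₀ ι σ₀ l t r)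
include K

theorem exists_acts {g : Equiv.Perm (V F)} (h : g ∈ LGammaL G x y) : ∃ τ, Acts θ τ g :=
  (K.mem_LGammaL_iff.1 h).2.2

theorem mem_LGammaL {g : Equiv.Perm (V F)} (h : g ∈ G) {τ : RingAut E} (hτ : Acts θ τ g) :
    g ∈ LGammaL G x y := K.mem_LGammaL_iff.2 ⟨h, Subgroup.mem_sup_right h, τ, hτ⟩

theorem s_conj_mem {g : Equiv.Perm (V F)} (h : g ∈ G) : s F * g * s F ∈ G :=
  G.mul_mem (G.mul_mem K.s_mem h) K.s_mem

/-- Writing s m⁻¹ as a s b and inverting gives m = b⁻¹·(s a⁻¹ s). So transitivity of L yields M ⊆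
L·sLs, a condition inside M = L^{ΓL₁}. -/
theorem exists_mul_of_isTransitiveOn {L : Subgroup (Equiv.Perm (V F))} (hL : IsTransitiveOn G L)
    {m : Equiv.Perm (V F)} (hm : m ∈ LGammaL G x y) :
    ∃ a ∈ L, ∃ b ∈ L, m = a * (s F * b * s F) := by
  have hm' := Subgroup.inv_mem _ hm
  obtain ⟨τ, hτ⟩ := K.exists_acts hm'
  obtain ⟨μ, hμ0, hμ⟩ := K.model.acts_v0 hτ
  obtain ⟨a, ha, b, hb, hab⟩ := hL (s F * m⁻¹)
    (G.mul_mem K.s_mem (K.mem_LGammaL_iff.1 hm').1) (by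
      rw [K.mem_line_iff, Equiv.Perm.mul_apply, hμ, semi_s.2, s_v0, proj_smul, proj_v1]
      simpa using hμ0)
  refine ⟨b⁻¹, L.inv_mem hb, a⁻¹, L.inv_mem ha, ?_⟩
  have h1 : m⁻¹ = s F * (a * s F * b) := by rw [← hab, ← mul_assoc, s_mul_s, one_mul]
  have h2 : m = (s F * (a * s F * b))⁻¹ := by rw [← h1, inv_inv]
  rw [h2]
  simp only [mul_inv_rev, s_inv]
  group

omit K in
-- Conversely M ⊆ L·sLs gives MsM ⊆ LsL: in a s b the sLs-part of a passes across s to join b, and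
-- the sLs-part of the resulting right factor passes back.
theorem isTransitiveOn_of_mul {L M : Subgroup (Equiv.Perm (V F))} (hLM : L ≤ M)
    (hM : IsTransitiveOn G M) (h : ∀ m ∈ M, ∃ a ∈ L, ∃ b ∈ L, m = a * (s F * b * s F)) :
    IsTransitiveOn G L := by
  intro g hg hgv
  obtain ⟨a, ha, b, hb, hab⟩ := hM g hg hgv
  obtain ⟨l, hl, k, hk, hlk⟩ := h a ha
  obtain ⟨l', hl', k', hk', hlk'⟩ := h (k * b)⁻¹ (M.inv_mem (M.mul_mem (hLM hk) hb))
  refine ⟨l * k'⁻¹, L.mul_mem hl (L.inv_mem hk'), l'⁻¹, L.inv_mem hl', ?_⟩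
  have h1 : k * b = (l' * (s F * k' * s F))⁻¹ := by rw [← hlk', inv_inv]
  have h2 : (l' * (s F * k' * s F))⁻¹ = s F * k'⁻¹ * s F * l'⁻¹ := by
    simp only [mul_inv_rev, s_inv]
    group
  calc g = l * s F * k * (s F * s F) * b := by rw [hab, hlk]; group
    _ = l * s F * (k * b) := by rw [s_mul_s]; group
    _ = l * (s F * s F) * k'⁻¹ * s F * l'⁻¹ := by rw [h1, h2]; group
    _ = l * k'⁻¹ * s F * l'⁻¹ := by rw [s_mul_s]; group

theorem x_mem_zpowers_sq [Finite E] [Finite F] (h : Even (Nat.card F)) : x ∈ Subgroup.zpowers (x ^ 2) := by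
  have h1 : c ^ (Nat.card F ^ 2 - 1) = 1 := by
    have h := K.frame_c_pow (Nat.card F ^ 2 - 1)
    rw [← K.model.orderOf_zeta, pow_orderOf_eq_one, K.model.orderOf_zeta] at h
    exact K.model.frame_ext h Frame.one
  have hq : 1 ≤ Nat.card F ^ 2 := Nat.one_le_pow _ _ Nat.card_pos
  have h2 : x ^ (Nat.card F ^ 2) = x := by
    have : Nat.card F ^ 2 = 1 + (Nat.card F ^ 2 - 1) := by omega
    rw [this, pow_add, K.x_eq, ← pow_mul c t (Nat.card F ^ 2 - 1), mul_comm t, pow_mul, h1]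
    simp
  obtain ⟨a, ha⟩ := h
  have h3 : x = (x ^ 2) ^ (a * Nat.card F) := by
    rw [← pow_mul, show 2 * (a * Nat.card F) = Nat.card F ^ 2 by rw [sq]; nth_rw 2 [ha]; ring, h2]
  rw [h3]
  have : (x ^ 2) ^ (a * Nat.card F) ∈ Subgroup.zpowers (x ^ 2) :=
    Subgroup.pow_mem _ (Subgroup.mem_zpowers _) _
  rwa [← h3] at this ⊢

/-- x₀^{tj} = x^{(q+1)j}. For odd q the exponent is even; for even q the order of x is odd, so x is
itself a power of x². Powers of x₀ in G thus lie in every subgroup of index two in L^{ΓL₁}. -/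
theorem x₀_pow_mem_zpowers_sq [Finite E] [Finite F] {k : ℕ} (h : x₀ ^ k ∈ G) :
    x₀ ^ k ∈ Subgroup.zpowers (x ^ 2) := by
  obtain ⟨j, rfl⟩ := (K.x₀_pow_mem_iff k).1 h
  have h1 : x₀ ^ (t * j) = x ^ ((Nat.card F + 1) * j) := by
    rw [K.x₀_eq, K.x_eq, ← pow_mul, ← pow_mul]
    congr 1
    ring
  rw [h1]
  rcases Nat.even_or_odd (Nat.card F) with hq | hq
  · exact Subgroup.pow_mem _ (K.x_mem_zpowers_sq hq) _
  · obtain ⟨a, ha⟩ := hq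
    rw [show (Nat.card F + 1) * j = 2 * ((a + 1) * j) by rw [ha]; ring, pow_mul]
    exact Subgroup.pow_mem _ (Subgroup.mem_zpowers _) _

/-- The element of the two-point stabilizer that induces the automorphism of order two on both
structures. -/
theorem exists_eta [Finite E] [Finite F] : ∃ η ∈ LGammaL G x y, Acts θ ι η ∧
    Acts θ ι (s F * η * s F) ∧
    ∃ n ∈ W G ⊔ Z F, ∃ a ∈ Subgroup.zpowers (x ^ 2), η = n * a * y ^ orderOf σ₀ := by
  obtain ⟨n, hn, h1, h2⟩ := K.exists_pair (orderOf σ₀)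
  rw [K.τ₀_pow_e] at h1 h2
  obtain ⟨k, hk⟩ := K.y_pow (orderOf σ₀)
  have hmem : n * y₀ ^ orderOf σ₀ ∈ G := G.mul_mem hn.1 K.y₀_pow_e_mem
  refine ⟨_, K.mem_LGammaL hmem h1, h1, h2, n, Subgroup.mem_sup_left hn, (x₀ ^ k)⁻¹,
    Subgroup.inv_mem _ (K.x₀_pow_mem_zpowers_sq ?_), by rw [hk]; group⟩
  have : x₀ ^ k = y ^ orderOf σ₀ * (y₀ ^ orderOf σ₀)⁻¹ := by rw [hk]; group
  rw [this]
  exact G.mul_mem (G.pow_mem K.y_mem _) (G.inv_mem K.y₀_pow_e_mem)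

/-- `d` and sds induce the same automorphism of F, so u = d⁻¹·sds induces 1 or ι on V/α₀. As sus =
u⁻¹ and ι² = 1, it induces the same on the second structure, which determines it modulo Z. -/
theorem inv_mul_s_conj {d η : Equiv.Perm (V F)} (hη : Acts θ ι η)
    (hη' : Acts θ ι (s F * η * s F)) {τ τ' : RingAut E} (h : Acts θ τ d)
    (h' : Acts θ τ' (s F * d * s F)) :
    d⁻¹ * (s F * d * s F) ∈ Z F ∨ d⁻¹ * (s F * d * s F) * η⁻¹ ∈ Z F := by
  obtain ⟨σ, hσ⟩ := mem_GammaL_iff.1 h.1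
  have h1 := SingerModel.acts_restrict h hσ
  have h2 := SingerModel.acts_restrict h' (s_conj_semi hσ)
  have hu := h.inv.mul h'
  have hu' := h'.inv.mul h
  have e : s F * (d⁻¹ * (s F * d * s F)) * s F = (s F * d * s F)⁻¹ * d := by
    rw [s_conj_mul, s_conj_inv, s_conj_conj]
  have hι : ι⁻¹ = ι := inv_eq_of_mul_eq_one_left K.ι_mul_ι
  have hinv : τ'⁻¹ * τ = (τ⁻¹ * τ')⁻¹ := by group
  rcases K.ι_unique (τ⁻¹ * τ') (fun k => by
    rw [RingAut.mul_apply, h2, ← h1, ← RingAut.mul_apply, inv_mul_cancel, RingAut.one_apply])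
    with h3 | h3
  · left
    rw [h3] at hu
    rw [hinv, h3, inv_one] at hu'
    exact K.model.mem_Z_of_acts_one hu (by rwa [e])
  · right
    rw [h3] at hu
    rw [hinv, h3, hι] at hu'
    refine K.model.mem_Z_of_acts_one ?_ ?_
    · have := hu.mul hη.inv
      rwa [mul_inv_cancel] at this
    · rw [s_conj_mul, s_conj_inv, e]
      have := hu'.mul hη'.inv
      rwa [mul_inv_cancel] at this

/-- In m = a·sbs with a, b in L, the factor sbs equals b·(b⁻¹sbs), which lies in LZ ∪ LZη. Hence L
has index at most two. -/
theorem mem_or_mul_inv_mem {L : Subgroup (Equiv.Perm (V F))} (hLM : L ≤ LGammaL G x y)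
    (hZ : Z F ≤ L) (hL : IsTransitiveOn G L) {η : Equiv.Perm (V F)} (hη : Acts θ ι η)
    (hη' : Acts θ ι (s F * η * s F)) {m : Equiv.Perm (V F)} (hm : m ∈ LGammaL G x y) :
    m ∈ L ∨ m * η⁻¹ ∈ L := by
  obtain ⟨a, ha, b, hb, rfl⟩ := K.exists_mul_of_isTransitiveOn hL hm
  have hb' : s F * b * s F ∈ LGammaL G x y :=
    (Subgroup.mul_mem_cancel_left _ (hLM ha)).1 hm
  obtain ⟨τ, hτ⟩ := K.exists_acts (hLM hb)
  obtain ⟨τ', hτ'⟩ := K.exists_acts hb'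
  refine (K.inv_mul_s_conj hη hη' hτ hτ').imp (fun h => ?_) fun h => ?_
  · have : a * (s F * b * s F) = a * b * (b⁻¹ * (s F * b * s F)) := by group
    rw [this]
    exact L.mul_mem (L.mul_mem ha hb) (hZ h)
  · have : a * (s F * b * s F) * η⁻¹ = a * b * (b⁻¹ * (s F * b * s F) * η⁻¹) := by group
    rw [this]
    exact L.mul_mem (L.mul_mem ha hb) (hZ h)

theorem zeta_pow_t_ne [Finite E] [Finite F] : ζ ^ t ≠ 1 := by
  intro h
  have hq : 1 < Nat.card F := Finite.one_lt_card
  have h1 := Nat.le_of_dvd K.t_pos (orderOf_dvd_of_pow_eq_one h)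
  have h2 := Nat.le_of_dvd (by omega) K.t_dvd_card_sub_one
  rw [K.model.orderOf_zeta] at h1
  have : Nat.card F < Nat.card F ^ 2 := by nlinarith
  omega

/-- `W` consists of commutators with `x`. -/
theorem exists_commutator [Finite E] [Finite F] {n : Equiv.Perm (V F)} (hn : n ∈ W G) :
    ∃ m ∈ W G, n = m * x * m⁻¹ * x⁻¹ := by
  have hx := K.frame_c_pow t
  rw [← K.x_eq] at hx
  have hxi := hx.inv (pow_ne_zero t K.model.ne_zero)
  have hmem := fun {h : Equiv.Perm (V F)} => K.model.mem_W_iff (h := h) K.le_GammaL K.SL_le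
  let f : W G → W G := fun m => ⟨m * x * (m : Equiv.Perm (V F))⁻¹ * x⁻¹, by
    have h1 : x * (m : Equiv.Perm (V F))⁻¹ * x⁻¹ ∈ W G := by
      obtain ⟨h1, h2, h3⟩ := hmem.1 ((W G).inv_mem m.2)
      refine hmem.2 ⟨by simpa using (hx.semi.mul h1).mul hxi.semi, ?_, fun u => ?_⟩
      · rw [Equiv.Perm.mul_apply, Equiv.Perm.mul_apply, hxi.v0 K.model.indep, h2,
          hx.v0 K.model.indep]
      · rw [Equiv.Perm.mul_apply, Equiv.Perm.mul_apply, hx.proj, h3, hxi.proj]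
        simp [K.model.ne_zero]
    have := (W G).mul_mem m.2 h1
    rwa [← mul_assoc, ← mul_assoc] at this⟩
  -- Equal commutators give an element d of W that commutes with x. As x acts on V/α₀ by ζ^t ≠ 1,
  -- such a d is trivial; finiteness of W then gives surjectivity.
  have hinj : Function.Injective f := by
    intro a b hab
    have h1 : (a : Equiv.Perm (V F)) * x * (a : Equiv.Perm (V F))⁻¹ * x⁻¹ =
      b * x * (b : Equiv.Perm (V F))⁻¹ * x⁻¹ := congrArg Subtype.val hab
    have h2 := mul_right_cancel h1
    set d : Equiv.Perm (V F) := (b : Equiv.Perm (V F))⁻¹ * a with hd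
    have hdx : d * x = x * d := by
      have : d * x = (b : Equiv.Perm (V F))⁻¹ * (a * x * (a : Equiv.Perm (V F))⁻¹) * a := by
        rw [hd]; group
      rw [this, h2, hd]
      group
    obtain ⟨h3, h4, h5⟩ := hmem.1 ((W G).mul_mem ((W G).inv_mem b.2) a.2)
    rw [← hd] at h3 h4 h5
    have hd1 : d = 1 := by
      ext u : 1
      have hne : ζ ^ t - 1 ≠ 0 := sub_ne_zero.2 K.zeta_pow_t_ne
      obtain ⟨u', -, hu'⟩ := K.model.exists_vec 0 ((ζ ^ t - 1)⁻¹ * PlaneField.proj θ u)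
      have hline : ∀ w, ∃ k : F, d w = w + k • v F 0 := by
        intro w
        refine ⟨d w 0 - w 0, K.model.ext ?_ ?_⟩
        · simp [v]
        · rw [h5, proj_add, proj_smul, proj_v0]; simp
      obtain ⟨k, hk⟩ := hline u'
      have hdxu : d (x u') = x u' + k • v F 0 := by
        rw [← Equiv.Perm.mul_apply, hdx, Equiv.Perm.mul_apply, hk, hx.semi.1, hx.semi.2,
          hx.v0 K.model.indep, RingAut.one_apply]
      -- ζ^t - 1 is invertible, so x - 1 is onto V/α₀. The commuting `d` shifts u' and xu' by the
      -- same multiple of v₀, and the shifts cancel.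
      have hu : ∃ b : F, u = x u' + -u' + b • v F 0 := by
        refine ⟨u 0 - (x u' + -u') 0, K.model.ext ?_ ?_⟩
        · simp [v]
        · rw [proj_add, proj_add, proj_neg, proj_smul, proj_v0, hx.proj, RingAut.one_apply, hu']
          field_simp
          ring
      obtain ⟨b, hb⟩ := hu
      rw [Equiv.Perm.one_apply]
      conv_lhs => rw [hb]
      rw [h3.1, h3.1, h3.2, h3.map_neg, hdxu, hk, h4, RingAut.one_apply]
      conv_rhs => rw [hb]
      abel
    rw [hd, inv_mul_eq_one] at hd1
    exact Subtype.ext hd1.symm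
  obtain ⟨m, hm⟩ := Finite.surjective_of_injective hinj ⟨n, hn⟩
  exact ⟨m, m.2, (congrArg Subtype.val hm).symm⟩

theorem WZ_le_of_relIndex_two [Finite E] [Finite F] {L : Subgroup (Equiv.Perm (V F))} (hZ : Z F ≤ L)
    (h : L.relIndex (LGammaL G x y) = 2) : W G ⊔ Z F ≤ L := by
  refine sup_le (fun n hn => ?_) hZ
  obtain ⟨m, hm, rfl⟩ := K.exists_commutator hn
  have hm' : m ∈ LGammaL G x y := WZ_le_LGammaL (Subgroup.mem_sup_left hm)
  have hx := x_mem_LGammaL (G := G) (x := x) (y := y)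
  have e : m * x * m⁻¹ * x⁻¹ = (m * x) * (x * m)⁻¹ := by group
  rw [e, mul_mem_iff_of_relIndex_two h (Subgroup.mul_mem _ hm' hx)
    (Subgroup.inv_mem _ (Subgroup.mul_mem _ hx hm')), Subgroup.inv_mem_iff,
    mul_mem_iff_of_relIndex_two h hm' hx, mul_mem_iff_of_relIndex_two h hx hm']
  exact Iff.comm

/-- A subgroup of index two containing Z contains WZ and x², and modulo these η is y^{e_G}. -/
theorem eta_mem_iff [Finite E] [Finite F] {L : Subgroup (Equiv.Perm (V F))} (hZ : Z F ≤ L)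
    (h : L.relIndex (LGammaL G x y) = 2) {η n a : Equiv.Perm (V F)} (hn : n ∈ W G ⊔ Z F)
    (ha : a ∈ Subgroup.zpowers (x ^ 2)) (hη : η = n * a * y ^ orderOf σ₀) :
    η ∈ L ↔ y ∈ L ∨ Even (orderOf σ₀) := by
  have ha' : a ∈ L := by
    have : Subgroup.zpowers (x ^ 2) ≤ L := by
      rw [Subgroup.zpowers_le]
      exact sq_mem_of_relIndex_two h x_mem_LGammaL
    exact this ha
  rw [hη, Subgroup.mul_mem_cancel_left _ (L.mul_mem (K.WZ_le_of_relIndex_two hZ h hn) ha'),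
    pow_mem_iff_of_relIndex_two h y_mem_LGammaL]

/-- With M = L^{ΓL₁} one has M = L ∪ Lη for transitive L, so L = M or η ∉ L with index two.
Conversely, if the index is two and η ∉ L, then L is not invariant under s, and M ⊆ L·sLs follows.
-/
theorem isTransitiveOn_iff_of_le [Finite E] [Finite F] {L : Subgroup (Equiv.Perm (V F))}
    (hLM : L ≤ LGammaL G x y) (hZ : Z F ≤ L) :
    IsTransitiveOn G L ↔ IsTransitiveOn G (LGammaL G x y) ∧ (L = LGammaL G x y ∨
      (L.relIndex (LGammaL G x y) = 2 ∧ y ∉ L ∧ ¬ Even (orderOf σ₀))) := by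
  obtain ⟨η, hηM, hη, hη', n, hn, a, ha, hηeq⟩ := K.exists_eta
  constructor
  · intro hL
    refine ⟨fun g hg hgv => ?_, ?_⟩
    · obtain ⟨a, ha, b, hb, hab⟩ := hL g hg hgv
      exact ⟨a, hLM ha, b, hLM hb, hab⟩
    · by_cases hηL : η ∈ L
      · left
        refine le_antisymm hLM fun m hm => ?_
        rcases K.mem_or_mul_inv_mem hLM hZ hL hη hη' hm with h | h
        · exact h
        · exact (Subgroup.mul_mem_cancel_right L (L.inv_mem hηL)).1 h
      · right
        have hind : L.relIndex (LGammaL G x y) = 2 := by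
          rw [Subgroup.relIndex_eq_two_iff]
          refine ⟨η⁻¹, Subgroup.inv_mem _ hηM, fun m hm => ?_⟩
          rcases K.mem_or_mul_inv_mem hLM hZ hL hη hη' hm with h | h
          · exact Or.inr ⟨h, fun h' => hηL (L.inv_mem_iff.1
              ((Subgroup.mul_mem_cancel_left L h).1 h'))⟩
          · exact Or.inl ⟨h, fun h' => hηL (L.inv_mem_iff.1
              ((Subgroup.mul_mem_cancel_left L h').1 h))⟩
        rw [K.eta_mem_iff hZ hind hn ha hηeq, not_or] at hηL
        exact ⟨hind, hηL⟩
  · rintro ⟨hM, rfl | ⟨hind, hy, he⟩⟩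
    · exact hM
    · refine isTransitiveOn_of_mul hLM hM fun m hm => ?_
      have hηL : η ∉ L := by
        rw [K.eta_mem_iff hZ hind hn ha hηeq, not_or]
        exact ⟨hy, he⟩
      obtain ⟨A, hA⟩ := K.ι_θ
      obtain ⟨ε, hε, h1, h2⟩ := SingerModel.exists_eps K.ι_fix hA
      have hεG : ε ∈ G := K.SL_le (mem_specialLinearGroup_iff.2 hε)
      have hε1 := K.mem_LGammaL hεG h1
      have hε2 := K.mem_LGammaL (K.s_conj_mem hεG) h2
      -- ε·sεs and η both induce ι on each structure, so they agree modulo Z. Since η ∉ L, exactly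
      -- one of ε and sεs lies in L.
      have hprod : ε * (s F * ε * s F) * η⁻¹ ∈ Z F := by
        refine K.model.mem_Z_of_acts_one (by simpa using (h1.mul h2).mul hη.inv) ?_
        rw [s_conj_mul, s_conj_mul, s_conj_conj, s_conj_inv]
        simpa using (h2.mul h1).mul hη'.inv
      have hnot : ¬ (ε ∈ L ↔ s F * ε * s F ∈ L) := by
        rw [← mul_mem_iff_of_relIndex_two hind hε1 hε2]
        intro h
        exact hηL (L.inv_mem_iff.1 ((Subgroup.mul_mem_cancel_left L h).1 (hZ hprod)))
      obtain ⟨b, hb, hb', hbM⟩ : ∃ b ∈ L, s F * b * s F ∉ L ∧ s F * b * s F ∈ LGammaL G x y := by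
        by_cases h : ε ∈ L
        · exact ⟨ε, h, fun h' => hnot ⟨fun _ => h', fun _ => h⟩, hε2⟩
        · refine ⟨s F * ε * s F, ?_, ?_, ?_⟩
          · by_contra h'
            exact hnot ⟨fun h'' => absurd h'' h, fun h'' => absurd h'' h'⟩
          · rwa [s_conj_conj]
          · rwa [s_conj_conj]
      by_cases hmL : m ∈ L
      · refine ⟨m, hmL, 1, L.one_mem, ?_⟩
        rw [mul_one, s_mul_s, mul_one]
      · refine ⟨m * (s F * b * s F)⁻¹, ?_, b, hb, by group⟩
        rw [mul_mem_iff_of_relIndex_two hind hm (Subgroup.inv_mem _ hbM), Subgroup.inv_mem_iff]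
        exact ⟨fun h => absurd h hmL, fun h => absurd h hb'⟩

end Configuration

theorem s_conj_of_mem_Z {F : Type*} [Field F] {z : Equiv.Perm (V F)} (hz : z ∈ Z F) :
    s F * z * s F = z := by
  obtain ⟨a, -, ha⟩ := mem_Z_iff.1 hz
  ext u : 1
  rw [Equiv.Perm.mul_apply, Equiv.Perm.mul_apply, ha, semi_s.2, ← Equiv.Perm.mul_apply,
    s_mul_s, ha]
  rfl

namespace Configuration

variable {F E : Type w} [Field F] [Field E] [Algebra F E]
  {G : Subgroup (Equiv.Perm (V F))} {θ ζ : E} {c x₀ y₀ x y : Equiv.Perm (V F)}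
  {τ₀ ι : RingAut E} {σ₀ : RingAut F} {l : F} {t r : ℕ}
  (K : Configuration G θ ζ c x₀ y₀ x y τ₀ ι σ₀ l t r)
include K

/-! ### The order of the two-point stabilizers -/

/-- Transitivity gives x₀^{rj} y₀^j ∈ G and r prime to t, so y₀^j ∈ G means t ∣ rj, that is, t ∣ j.
-/
theorem y₀_pow_mem_iff [Finite F] (h : IsTransitiveOn G (LGammaL G x y)) (j : ℕ) :
    y₀ ^ j ∈ G ↔ t ∣ j := by
  obtain ⟨m, hm⟩ := K.exists_exponent
  have h1 := (K.forall_iff hm).1 (K.forall_of_isTransitiveOn h)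
  have hmt : m ≡ 1 [MOD t] := by
    rcases K.t_eq with ht | ht
    · rw [ht]; exact Nat.modEq_one
    · rw [ht]; exact (h1 ht).2.2
  have h2 := K.x₀_pow_mul_y₀_pow_mem hm hmt j
  have hcop : t.Coprime r := by
    rcases K.t_eq with ht | ht
    · rw [ht]; exact Nat.coprime_one_left r
    · have hr0 := (h1 ht).1
      have hlt := K.lt
      rw [ht] at hlt ⊢
      rw [Nat.Prime.coprime_iff_not_dvd Nat.prime_three]
      intro hd
      exact hr0 (Nat.eq_zero_of_dvd_of_lt hd hlt)
  rw [← hcop.dvd_mul_left, ← K.x₀_pow_mem_iff]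
  constructor
  · intro h
    exact (Subgroup.mul_mem_cancel_right G h).1 h2
  · intro h
    exact (Subgroup.mul_mem_cancel_left G h).1 h2

theorem t_dvd_e [Finite F] (h : IsTransitiveOn G (LGammaL G x y)) : t ∣ orderOf σ₀ :=
  (K.y₀_pow_mem_iff h _).1 K.y₀_pow_e_mem

/-- Sending d to its automorphism on V/α₀ has image ⟨τ₀^t⟩, of order 2e_G/t, since y₀^j ∈ G only for
t ∣ j. The kernel is Z⟨ε⟩, in which Z has index two. -/
theorem relIndex_Z_pair [Finite E] [Finite F] (h : IsTransitiveOn G (LGammaL G x y)) :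
    (Z F).relIndex (LGammaL G x y ⊓ (LGammaL G x y).map (MulAut.conj (s F)).toMonoidHom) * t =
      4 * orderOf σ₀ := by
  set D := LGammaL G x y ⊓ (LGammaL G x y).map (MulAut.conj (s F)).toMonoidHom with hD
  have hmem : ∀ {d}, d ∈ D ↔ d ∈ LGammaL G x y ∧ s F * d * s F ∈ LGammaL G x y := by
    intro d
    rw [hD, Subgroup.mem_inf, mem_map_conj_s]
  have hex : ∀ d : D, ∃ τ, Acts θ τ (d : Equiv.Perm (V F)) := fun d =>
    K.exists_acts (hmem.1 d.2).1
  choose f hf using hex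
  let ψ : D →* RingAut E :=
    MonoidHom.mk' f fun a b => K.model.acts_unique (hf (a * b)) ((hf a).mul (hf b))
  have hψ : ∀ d : D, Acts θ (ψ d) (d : Equiv.Perm (V F)) := hf
  have hrange : ψ.range = Subgroup.zpowers (τ₀ ^ t) := by
    refine le_antisymm ?_ ?_
    · rintro _ ⟨d, rfl⟩
      obtain ⟨hd, hd'⟩ := hmem.1 d.2
      obtain ⟨j, hj⟩ := K.tau_eq_pow (Subgroup.mem_sup_right (K.mem_LGammaL_iff.1 hd).1) (hψ d)
      obtain ⟨τ', hτ'⟩ := K.exists_acts hd'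
      have h1 := hψ d
      rw [hj] at h1 ⊢
      obtain ⟨g, hg, hgd⟩ := K.pair_eq h1 hτ'
      have h2 : y₀ ^ j ∈ G := by
        have h3 := (K.mem_LGammaL_iff.1 hd).1
        rw [hgd] at h3
        exact (Subgroup.mul_mem_cancel_left G hg).1 h3
      obtain ⟨i, rfl⟩ := (K.y₀_pow_mem_iff h j).1 h2
      rw [pow_mul]
      exact Subgroup.pow_mem _ (Subgroup.mem_zpowers _) i
    · rw [Subgroup.zpowers_le]
      obtain ⟨n, hn, h1, h2⟩ := K.exists_pair t
      have hG : n * y₀ ^ t ∈ G := G.mul_mem hn.1 ((K.y₀_pow_mem_iff h t).2 dvd_rfl)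
      refine ⟨⟨n * y₀ ^ t, hmem.2 ⟨K.mem_LGammaL hG h1, K.mem_LGammaL (K.s_conj_mem hG) h2⟩⟩, ?_⟩
      exact K.model.acts_unique (hψ _) h1
  let D₁ : Subgroup (Equiv.Perm (V F)) := ψ.ker.map D.subtype
  have hD₁ : ∀ {d}, d ∈ D₁ ↔ d ∈ D ∧ Acts θ 1 d := by
    intro d
    constructor
    · rintro ⟨d, hd, rfl⟩
      have h1 := hψ d
      rw [MonoidHom.mem_ker.1 hd] at h1
      exact ⟨d.2, h1⟩
    · rintro ⟨hd, h1⟩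
      exact ⟨⟨d, hd⟩, K.model.acts_unique (hψ ⟨d, hd⟩) h1, rfl⟩
  have hD₁D : D₁ ≤ D := fun d hd => (hD₁.1 hd).1
  have hind : D₁.relIndex D = 2 * orderOf σ₀ / t := by
    have h1 : D₁.subgroupOf D = ψ.ker := by
      ext d
      rw [Subgroup.mem_subgroupOf]
      exact ⟨fun ⟨d', hd', h⟩ => by rwa [← Subtype.ext h], fun hd => ⟨d, hd, rfl⟩⟩
    rw [Subgroup.relIndex, h1, Subgroup.index_ker, hrange, Nat.card_zpowers,
      orderOf_pow_of_dvd K.t_pos.ne', K.orderOf_τ₀]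
    rw [K.orderOf_τ₀]
    exact (K.t_dvd_e h).mul_left 2
  have hZD : Z F ≤ D₁ := by
    intro z hz
    have h1 := K.acts_of_mem_WZ (Subgroup.mem_sup_right hz)
    refine hD₁.2 ⟨hmem.2 ?_, h1⟩
    rw [s_conj_of_mem_Z hz]
    exact ⟨K.mem_LGammaL (K.Z_le hz) h1, K.mem_LGammaL (K.Z_le hz) h1⟩
  have htwo : (Z F).relIndex D₁ = 2 := by
    rw [Subgroup.relIndex_eq_two_iff]
    obtain ⟨A, hA⟩ := K.ι_θ
    obtain ⟨ε, hε, h1, h2⟩ := SingerModel.exists_eps K.ι_fix hA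
    have hεG : ε ∈ G := K.SL_le (mem_specialLinearGroup_iff.2 hε)
    have hεZ : ε ∉ Z F := by
      intro hz
      rw [s_conj_of_mem_Z hz] at h2
      exact K.ι_ne (K.model.acts_unique h2 (K.acts_of_mem_WZ (Subgroup.mem_sup_right hz)))
    refine ⟨ε, hD₁.2 ⟨hmem.2 ⟨K.mem_LGammaL hεG h1, K.mem_LGammaL (K.s_conj_mem hεG) h2⟩, h1⟩,
      fun b hb => ?_⟩
    obtain ⟨hbD, hb1⟩ := hD₁.1 hb
    obtain ⟨τ', hτ'⟩ := K.exists_acts (hmem.1 hbD).2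
    rcases K.ι_unique τ' (SingerModel.acts_restrict hτ'
      (s_conj_semi (SingerModel.acts_one_semi hb1))) with rfl | rfl
    · have hbZ := K.model.mem_Z_of_acts_one hb1 hτ'
      exact Or.inr ⟨hbZ, fun h' => hεZ ((Subgroup.mul_mem_cancel_left _ hbZ).1 h')⟩
    · have hbε : b * ε ∈ Z F := by
        refine K.model.mem_Z_of_acts_one (by simpa using hb1.mul h1) ?_
        rw [s_conj_mul, ← K.ι_mul_ι]
        exact hτ'.mul h2
      exact Or.inl ⟨hbε, fun h' => hεZ ((Subgroup.mul_mem_cancel_left _ h').1 hbε)⟩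
  rw [← Subgroup.relIndex_mul_relIndex _ _ _ hZD hD₁D, htwo, hind, mul_assoc,
    Nat.div_mul_cancel ((K.t_dvd_e h).mul_left 2)]
  ring

/-- Put M = L^{ΓL₁}, D = M ∩ sMs and B = M ∩ sLs. From M = LB both |B : L ∩ B| and |D : L ∩ D| equal
|M : L|. Conjugation by s carries L ∩ D to B, so |D : B| = |M : L| too, and L ∩ B = L ∩ sLs. -/
theorem relIndex_pair {L : Subgroup (Equiv.Perm (V F))} (hLM : L ≤ LGammaL G x y)
    (hL : IsTransitiveOn G L) :
    (L ⊓ L.map (MulAut.conj (s F)).toMonoidHom).relIndex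
      (LGammaL G x y ⊓ (LGammaL G x y).map (MulAut.conj (s F)).toMonoidHom) =
      L.relIndex (LGammaL G x y) ^ 2 := by
  set M := LGammaL G x y
  set D := M ⊓ M.map (MulAut.conj (s F)).toMonoidHom
  let B := M ⊓ L.map (MulAut.conj (s F)).toMonoidHom
  have hinj : Function.Injective (MulAut.conj (s F)).toMonoidHom := (MulAut.conj (s F)).injective
  have hmul : ∀ m ∈ M, ∃ a ∈ L, ∃ b ∈ B, m = a * b := by
    intro m hm
    obtain ⟨a, ha, b, hb, hab⟩ := K.exists_mul_of_isTransitiveOn hL hm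
    refine ⟨a, ha, _, ⟨?_, mem_map_conj_s.2 (by rwa [s_conj_conj])⟩, hab⟩
    rw [hab] at hm
    exact (Subgroup.mul_mem_cancel_left _ (hLM ha)).1 hm
  have hBD : B ≤ D := inf_le_inf_left _ (Subgroup.map_mono hLM)
  have h1 : L.relIndex B = L.relIndex M := relIndex_eq_of_mul inf_le_left hmul
  have h2 : L.relIndex D = L.relIndex M := by
    refine relIndex_eq_of_mul inf_le_left fun m hm => ?_
    obtain ⟨a, ha, b, hb, hab⟩ := hmul m hm
    exact ⟨a, ha, b, hBD hb, hab⟩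
  have h3 : B.relIndex D = L.relIndex D := by
    have hBmap : B = (L ⊓ D).map (MulAut.conj (s F)).toMonoidHom := by
      rw [Subgroup.map_inf _ _ _ hinj, Subgroup.map_inf _ _ _ hinj, map_conj_s_map]
      apply le_antisymm
      · exact le_inf inf_le_right (le_inf (inf_le_right.trans (Subgroup.map_mono hLM)) inf_le_left)
      · exact le_inf (inf_le_right.trans inf_le_right) inf_le_left
    have hDmap : D = D.map (MulAut.conj (s F)).toMonoidHom := by
      rw [Subgroup.map_inf _ _ _ hinj, map_conj_s_map, inf_comm]
    have h5 := Subgroup.relIndex_map_map_of_injective (L ⊓ D) D hinj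
    rwa [← hBmap, ← hDmap, Subgroup.inf_relIndex_right] at h5
  have h4 : L ⊓ L.map (MulAut.conj (s F)).toMonoidHom = L ⊓ B := by
    rw [← inf_assoc, inf_eq_left.2 hLM]
  rw [h4, ← Subgroup.relIndex_mul_relIndex _ _ _ inf_le_right hBD, Subgroup.inf_relIndex_right,
    h1, h3, h2, sq]

theorem relIndex_Z_mul [Finite E] [Finite F] {L : Subgroup (Equiv.Perm (V F))}
    (hLM : L ≤ LGammaL G x y) (hZ : Z F ≤ L) (hL : IsTransitiveOn G L) :
    (Z F).relIndex (L ⊓ L.map (MulAut.conj (s F)).toMonoidHom) *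
      (L.relIndex (LGammaL G x y) ^ 2 * t) = 4 * fieldIndex G := by
  have hM := ((K.isTransitiveOn_iff_of_le hLM hZ).1 hL).1
  have hZs : Z F ≤ L ⊓ L.map (MulAut.conj (s F)).toMonoidHom := by
    refine le_inf hZ fun z hz => ?_
    rw [mem_map_conj_s, s_conj_of_mem_Z hz]
    exact hZ hz
  rw [K.fieldIndex_eq, ← K.relIndex_Z_pair hM, ← K.relIndex_pair hLM hL, ← mul_assoc,
    Subgroup.relIndex_mul_relIndex _ _ _ hZs (inf_le_inf hLM (Subgroup.map_mono hLM))]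

/-! ### The form of the point stabilizers -/

/-- The group ⟨x, y⟩ consists of maps that fix v₀ and preserve the plane, with an explicit action on
it. Such a map in WZ has scalar 1 on α₀, hence on V/α₀, and is the identity. -/
theorem isInternalSemidirect :
    IsInternalSemidirect (W G ⊔ Z F) (Subgroup.closure {x, y}) (LGammaL G x y) := by
  have hx := K.frame_c_pow t
  rw [← K.x_eq] at hx
  have hy : ∃ a, Frame θ a τ₀ σ₀ y := by
    rw [K.y_eq]
    have := (K.frame_x₀_pow r).mul K.frame_y₀
    exact ⟨_, by simpa using this⟩
  let S : Subgroup (Equiv.Perm (V F)) :=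
    { carrier := {g | ∃ a τ σ, a ≠ 0 ∧ Frame (F := F) (E := E) θ a τ σ g}
      one_mem' := ⟨1, 1, 1, one_ne_zero, Frame.one⟩
      mul_mem' := by
        rintro f g ⟨a, τ, σ, ha, hf⟩ ⟨b, τ', σ', hb, hg⟩
        exact ⟨_, _, _, mul_ne_zero ha (by simpa using hb), hf.mul hg⟩
      inv_mem' := by
        rintro f ⟨a, τ, σ, ha, hf⟩
        exact ⟨_, _, _, by simpa using ha, hf.inv ha⟩ }
  have hS : Subgroup.closure {x, y} ≤ S := by
    rw [Subgroup.closure_le]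
    rintro g (rfl | rfl)
    · exact ⟨_, _, _, pow_ne_zero t K.model.ne_zero, hx⟩
    · obtain ⟨a, ha⟩ := hy
      refine ⟨a, _, _, ?_, ha⟩
      rintro rfl
      have h1 := ha.proj (v F 1)
      rw [zero_mul] at h1
      have h2 : g (v F 1) = g (v F 1) 0 • v F 0 := by
        refine K.model.ext (by simp [v]) ?_
        rw [h1, proj_smul, proj_v0, mul_zero]
      have h3 : g (v F 1) 0 = 0 := by rw [ha.zero]; simp [v]
      rw [h3, zero_smul] at h2
      exact ha.semi.map_ne_zero (v_ne_zero 1) h2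
  refine ⟨rfl, fun g hg => ?_, ?_⟩
  · have hconj : ∀ g ∈ S, ∀ h ∈ W G ⊔ Z F, g * h * g⁻¹ ∈ W G ⊔ Z F := by
      rintro g ⟨a, τ, σ, ha, hf⟩ h hh
      obtain ⟨μ, hμ, h1, h2, h3⟩ := K.mem_WZ_iff.1 hh
      refine K.mem_WZ_iff.2 ⟨σ μ, by simpa using hμ, ?_, ?_, fun u => ?_⟩
      · simpa using (hf.semi.mul h1).mul hf.semi.inv
      · rw [Equiv.Perm.mul_apply, Equiv.Perm.mul_apply, (hf.inv ha).v0 K.model.indep, h2,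
          hf.semi.2, hf.v0 K.model.indep]
      · rw [Equiv.Perm.mul_apply, Equiv.Perm.mul_apply, hf.proj, h3, map_mul,
          SingerModel.acts_restrict (hf.acts ha) hf.semi, (hf.inv ha).proj]
        simp only [map_mul, ← RingAut.mul_apply, mul_inv_cancel, RingAut.one_apply]
        field_simp
    rw [Subgroup.mem_normalizer_iff]
    intro h
    refine ⟨hconj g (hS hg) h, fun hh => ?_⟩
    have := hconj g⁻¹ (S.inv_mem (hS hg)) _ hh
    simpa [mul_assoc] using this
  · rw [Subgroup.disjoint_def]
    intro h hh hc
    obtain ⟨μ, hμ, h1, h2, h3⟩ := K.mem_WZ_iff.1 hh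
    obtain ⟨a, τ, σ, ha, hf⟩ := hS hc
    have h4 := hf.v0 K.model.indep
    have hμ1 : μ = 1 := by
      have := congrFun (h2.symm.trans h4) 0
      simpa [v] using this
    have hσ := hf.semi.unique h1
    ext u : 1
    refine K.model.ext ?_ ?_
    · rw [hf.zero, hσ]; rfl
    · rw [h3, hμ1, map_one, one_mul]; rfl

theorem hasForm_of_sup_eq {L : Subgroup (Equiv.Perm (V F))} {dx dy : ℕ}
    (hdx : dx = 1 ∨ dx = 2) (hdy : dy = 1 ∨ dy = 2)
    (hL : W G ⊔ Z F ⊔ Subgroup.closure {x ^ dx, x ^ (dx - 1) * y ^ dy} = L)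
    (hind : dx * dy = L.relIndex (LGammaL G x y)) (hle : dx * dy ≤ 2) :
    HasForm G x y L dx dy := by
  have h := K.isInternalSemidirect
  have hcl : Subgroup.closure {x ^ dx, x ^ (dx - 1) * y ^ dy} ≤ Subgroup.closure {x, y} := by
    have hx : x ∈ Subgroup.closure {x, y} := Subgroup.subset_closure (by simp)
    have hy : y ∈ Subgroup.closure {x, y} := Subgroup.subset_closure (by simp)
    rw [Subgroup.closure_le]
    rintro g (rfl | rfl)
    · exact Subgroup.pow_mem _ hx _
    · exact Subgroup.mul_mem _ (Subgroup.pow_mem _ hx _) (Subgroup.pow_mem _ hy _)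
  exact ⟨hdx, hdy, ⟨hL, hcl.trans h.normalizes, h.disjoint.mono_right hcl⟩, hind, hle⟩

theorem exists_normal_form {g : Equiv.Perm (V F)} (h : g ∈ LGammaL G x y) :
    ∃ n ∈ W G ⊔ Z F, ∃ i j : ℕ, g = n * (x ^ i * y ^ j) := by
  obtain ⟨hg, -, τ, hτ⟩ := K.mem_LGammaL_iff.1 h
  obtain ⟨n, hn, i, j, hgn, -⟩ := K.normal_form hg hτ
  exact ⟨n, hn, i, j, by rw [hgn, mul_assoc]⟩

theorem y_pow_mul_x (j : ℕ) : ∃ k : ℕ, x * y ^ j = y ^ j * x ^ k := by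
  have hx := K.frame_c_pow t
  obtain ⟨k₀, hk₀⟩ := K.y_pow j
  have hy := (K.frame_x₀_pow k₀).mul (K.frame_y₀_pow j)
  rw [← hk₀] at hy
  have hne : algebraMap F E (l ^ k₀) * (1 : RingAut E) 1 ≠ 0 := by
    simpa using fun h => absurd h K.l_ne
  have h1 := ((hy.inv hne).mul hx).mul hy
  rw [← K.x_eq] at h1
  have h2 : Acts θ 1 ((y ^ j)⁻¹ * x * y ^ j) := by
    have e : (y ^ j)⁻¹ * x * y ^ j = ((y ^ j)⁻¹ * x) * y ^ j := rfl
    simpa using h1.acts (by simpa [K.model.ne_zero] using fun h => absurd h K.l_ne)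
  have h3 : ∃ a, a ≠ 0 ∧ Frame θ a 1 1 ((y ^ j)⁻¹ * x * y ^ j) := by
    refine ⟨_, ?_, by simpa using h1⟩
    simpa [K.model.ne_zero] using fun h => absurd h K.l_ne
  obtain ⟨a, ha, h4⟩ := h3
  obtain ⟨i, rfl⟩ := K.model.gen a ha
  have h5 : (y ^ j)⁻¹ * x * y ^ j = c ^ i := K.model.frame_ext h4 (K.frame_c_pow i)
  have h6 : c ^ i ∈ G := by
    rw [← h5]
    exact G.mul_mem (G.mul_mem (G.inv_mem (G.pow_mem K.y_mem j)) K.x_mem) (G.pow_mem K.y_mem j)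
  obtain ⟨k, rfl⟩ := K.t_dvd_of_c_pow_mem h6
  refine ⟨k, ?_⟩
  rw [K.x_eq, ← pow_mul, ← h5, ← K.x_eq]
  group

/-- L contains WZ, x² and y² but not y. Modulo WZ, if x ∈ L it is ⟨x, y²⟩; otherwise xy ∈ L and it
is ⟨x², xy⟩. The latter cannot occur for even q, where x is a power of x². -/
theorem exists_hasForm [Finite E] [Finite F] {L : Subgroup (Equiv.Perm (V F))}
    (hLM : L ≤ LGammaL G x y) (hZ : Z F ≤ L) (hind : L.relIndex (LGammaL G x y) = 2)
    (hy : y ∉ L) : ∃ dx dy : ℕ, HasForm G x y L dx dy ∧ (Even (Nat.card F) → dx = 1) := by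
  have hWZ := K.WZ_le_of_relIndex_two hZ hind
  have hxM := x_mem_LGammaL (G := G) (x := x) (y := y)
  have hyM := y_mem_LGammaL (G := G) (x := x) (y := y)
  have hxsq := sq_mem_of_relIndex_two hind hxM
  have hysq := sq_mem_of_relIndex_two hind hyM
  by_cases hx : x ∈ L
  · refine ⟨1, 2, K.hasForm_of_sup_eq (Or.inl rfl) (Or.inr rfl) ?_ (by rw [hind]) le_rfl,
      fun _ => rfl⟩
    simp only [pow_one, Nat.sub_self, pow_zero, one_mul]
    apply le_antisymm
    · refine sup_le hWZ ((Subgroup.closure_le _).2 ?_)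
      rintro g (rfl | rfl)
      · exact hx
      · exact hysq
    · intro g hg
      obtain ⟨n, hn, i, j, rfl⟩ := K.exists_normal_form (hLM hg)
      have h1 : y ^ j ∈ L := (Subgroup.mul_mem_cancel_left L (L.pow_mem hx i)).1
        ((Subgroup.mul_mem_cancel_left L (hWZ hn)).1 hg)
      obtain ⟨a, rfl⟩ := even_iff_two_dvd.1
        (((pow_mem_iff_of_relIndex_two hind hyM j).1 h1).resolve_left hy)
      rw [pow_mul]
      exact Subgroup.mul_mem_sup hn (Subgroup.mul_mem _
        (Subgroup.pow_mem _ (Subgroup.subset_closure (by simp)) i)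
        (Subgroup.pow_mem _ (Subgroup.subset_closure (by simp)) a))
  · have hxy : x * y ∈ L := by
      rw [mul_mem_iff_of_relIndex_two hind hxM hyM]
      exact ⟨fun h => absurd h hx, fun h => absurd h hy⟩
    refine ⟨2, 1, K.hasForm_of_sup_eq (Or.inr rfl) (Or.inl rfl) ?_ (by rw [hind]) le_rfl,
      fun hq => absurd ?_ hx⟩
    swap
    · have : Subgroup.zpowers (x ^ 2) ≤ L := by
        rw [Subgroup.zpowers_le]
        exact hxsq
      exact this (K.x_mem_zpowers_sq hq)
    simp only [pow_one, Nat.add_one_sub_one]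
    apply le_antisymm
    · refine sup_le hWZ ((Subgroup.closure_le _).2 ?_)
      rintro g (rfl | rfl)
      · exact hxsq
      · exact hxy
    · set C : Subgroup (Equiv.Perm (V F)) := Subgroup.closure {x ^ 2, x * y} with hC
      have hx2C : x ^ 2 ∈ C := Subgroup.subset_closure (by simp)
      have hxyC : x * y ∈ C := Subgroup.subset_closure (by simp)
      have hdiag : ∀ j : ℕ, x ^ j * y ^ j ∈ C := by
        intro j
        induction j with
        | zero => simp
        | succ j ih =>
          obtain ⟨k, hk⟩ := K.y_pow_mul_x j
          have hyj : y ^ j ∈ LGammaL G x y := Subgroup.pow_mem _ hyM j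
          -- Moving x past y^j turns it into x^k. As x ∉ L, also x^k ∉ L, so k is odd and x^k is x
          -- times a power of x².
          have hxk : x ^ k ∉ L := by
            have h1 : x * y ^ j ∈ L ↔ y ^ j * x ^ k ∈ L := by rw [hk]
            rw [mul_mem_iff_of_relIndex_two hind hxM hyj,
              mul_mem_iff_of_relIndex_two hind hyj (Subgroup.pow_mem _ hxM k)] at h1
            tauto
          have hodd : ¬ Even k := fun he =>
            hxk ((pow_mem_iff_of_relIndex_two hind hxM k).2 (Or.inr he))
          obtain ⟨a, rfl⟩ := Nat.not_even_iff_odd.1 hodd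
          have e : x ^ (j + 1) * y ^ (j + 1) = x ^ j * y ^ j * (x ^ 2) ^ a * (x * y) := by
            calc x ^ (j + 1) * y ^ (j + 1) = x ^ j * (x * y ^ j) * y := by
                  rw [pow_succ, pow_succ]; group
              _ = x ^ j * y ^ j * (x ^ 2) ^ a * (x * y) := by
                  rw [hk, pow_succ, pow_mul]; group
          rw [e]
          exact C.mul_mem (C.mul_mem ih (C.pow_mem hx2C a)) hxyC
      intro g hg
      obtain ⟨n, hn, i, j, rfl⟩ := K.exists_normal_form (hLM hg)
      refine Subgroup.mul_mem_sup hn ?_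
      have h1 := (Subgroup.mul_mem_cancel_left L (hWZ hn)).1 hg
      rw [mul_mem_iff_of_relIndex_two hind (Subgroup.pow_mem _ hxM i) (Subgroup.pow_mem _ hyM j),
        pow_mem_iff_of_relIndex_two hind hxM, pow_mem_iff_of_relIndex_two hind hyM] at h1
      have h2 : Even i ↔ Even j := by tauto
      rcases Nat.even_or_odd' i with ⟨a, rfl | rfl⟩
      · obtain ⟨b, rfl⟩ := even_iff_two_dvd.1 (h2.1 (even_two_mul a))
        have e : x ^ (2 * a) * y ^ (2 * b) =
            (x ^ 2) ^ a * ((x ^ 2) ^ b)⁻¹ * (x ^ (2 * b) * y ^ (2 * b)) := by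
          rw [pow_mul, pow_mul x 2 b]; group
        rw [e]
        exact C.mul_mem (C.mul_mem (C.pow_mem hx2C a) (C.inv_mem (C.pow_mem hx2C b))) (hdiag _)
      · have hj : ¬ Even j := by
          rw [← h2]
          simp
        obtain ⟨b, rfl⟩ := Nat.not_even_iff_odd.1 hj
        have e : x ^ (2 * a + 1) * y ^ (2 * b + 1) =
            (x ^ 2) ^ a * ((x ^ 2) ^ b)⁻¹ * (x ^ (2 * b + 1) * y ^ (2 * b + 1)) := by
          rw [pow_succ x (2 * a), pow_succ x (2 * b), pow_mul x 2 a, pow_mul x 2 b]; group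
        rw [e]
        exact C.mul_mem (C.mul_mem (C.pow_mem hx2C a) (C.inv_mem (C.pow_mem hx2C b))) (hdiag _)

omit K in
theorem _root_.PlaneField.HasForm.le {L : Subgroup (Equiv.Perm (V F))} {dx dy : ℕ}
    (h : HasForm G x y L dx dy) : L ≤ LGammaL G x y := by
  rw [← h.semidirect.sup_eq]
  refine sup_le WZ_le_LGammaL ((Subgroup.closure_le _).2 ?_)
  rintro g (rfl | rfl)
  · exact Subgroup.pow_mem _ x_mem_LGammaL _
  · exact Subgroup.mul_mem _ (Subgroup.pow_mem _ x_mem_LGammaL _)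
      (Subgroup.pow_mem _ y_mem_LGammaL _)

omit K in
theorem _root_.PlaneField.HasForm.cases {L : Subgroup (Equiv.Perm (V F))} {dx dy : ℕ}
    (h : HasForm G x y L dx dy) :
    (dx = 1 ∧ dy = 1) ∨ (dx = 1 ∧ dy = 2) ∨ (dx = 2 ∧ dy = 1) := by
  have := h.le_two
  rcases h.dx_mem with rfl | rfl <;> rcases h.dy_mem with rfl | rfl <;> simp at this ⊢

omit K in
theorem _root_.PlaneField.HasForm.y_notMem {L : Subgroup (Equiv.Perm (V F))} {dx dy : ℕ}
    (h : HasForm G x y L dx dy) (h2 : dx * dy = 2) : y ∉ L := by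
  intro hy
  have hx : x ∈ L := by
    have h1 : ∀ g ∈ ({x ^ dx, x ^ (dx - 1) * y ^ dy} : Set (Equiv.Perm (V F))), g ∈ L := by
      intro g hg
      rw [← h.semidirect.sup_eq]
      exact Subgroup.mem_sup_right (Subgroup.subset_closure hg)
    rcases h.cases with ⟨rfl, rfl⟩ | ⟨rfl, rfl⟩ | ⟨rfl, rfl⟩
    · simp at h2
    · simpa using h1 _ (Or.inl rfl)
    · have := h1 (x ^ (2 - 1) * y ^ 1) (Or.inr rfl)
      simp only [pow_one, Nat.add_one_sub_one] at this
      exact (Subgroup.mul_mem_cancel_right L hy).1 this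
  have hle : LGammaL G x y ≤ L := by
    refine sup_le ?_ ((Subgroup.closure_le _).2 ?_)
    · rw [← h.semidirect.sup_eq]
      exact le_sup_left
    · rintro g (rfl | rfl)
      · exact hx
      · exact hy
  have h3 := h.index
  rw [Subgroup.relIndex_eq_one.2 hle] at h3
  omega

theorem mem_pointStabilizers_iff_hasForm [Finite E] [Finite F] {p e : ℕ} (hp : p.Prime)
    (hF : Nat.card F = p ^ e) (L : Subgroup (Equiv.Perm (V F))) :
    L ∈ pointStabilizers G x y ↔ ∃ dx dy : ℕ, HasForm G x y L dx dy ∧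
      (Even (fieldIndex G) → dx = 1 ∧ dy = 1) ∧ (p = 2 → dx = 1) ∧
      (t = 3 → r ≠ 0 ∧ 3 ∣ fieldIndex G ∧ p ^ (e / fieldIndex G) ≡ 1 [MOD 3]) := by
  rw [K.mem_pointStabilizers_iff]
  constructor
  · rintro ⟨hLM, hZ, hL⟩
    rw [K.isTransitiveOn_iff_of_le hLM hZ, K.isTransitiveOn_iff hp hF] at hL
    obtain ⟨h3, rfl | ⟨hind, hy, he⟩⟩ := hL
    · refine ⟨1, 1, K.hasForm_of_sup_eq (Or.inl rfl) (Or.inl rfl) ?_ ?_ (by norm_num),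
        fun _ => ⟨rfl, rfl⟩, fun _ => rfl, h3⟩
      · simp [LGammaL]
      · rw [Subgroup.relIndex_self]
    · obtain ⟨dx, dy, hform, hdx⟩ := K.exists_hasForm hLM hZ hind hy
      refine ⟨dx, dy, hform, fun h => absurd (K.fieldIndex_eq ▸ h) he, fun hp2 => hdx ?_, h3⟩
      have he0 : e ≠ 0 := by
        rintro rfl
        have : 1 < Nat.card F := Finite.one_lt_card
        rw [hF] at this
        simp at this
      rw [hF, hp2]
      exact (Nat.even_pow.2 ⟨even_two, he0⟩)
  · rintro ⟨dx, dy, hform, he, -, h3⟩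
    have hZ : Z F ≤ L := by
      rw [← hform.semidirect.sup_eq]
      exact le_sup_right.trans le_sup_left
    refine ⟨hform.le, hZ, ?_⟩
    rw [K.isTransitiveOn_iff_of_le hform.le hZ, K.isTransitiveOn_iff hp hF]
    refine ⟨h3, ?_⟩
    have hind := hform.index
    by_cases h1 : dx * dy = 1
    · left
      rw [h1] at hind
      exact le_antisymm hform.le (Subgroup.relIndex_eq_one.1 hind.symm)
    · right
      have h2 : dx * dy = 2 := by
        rcases hform.cases with ⟨rfl, rfl⟩ | ⟨rfl, rfl⟩ | ⟨rfl, rfl⟩ <;> simp at h1 ⊢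
      refine ⟨by rw [← hind, h2], hform.y_notMem h2, fun hev => h1 ?_⟩
      obtain ⟨rfl, rfl⟩ := he (K.fieldIndex_eq ▸ hev)
      rfl

end Configuration

section
variable {F : Type w} [Field F]

theorem conj_mem_Z {g z : Equiv.Perm (V F)} (hg : g ∈ GammaL F) (hz : z ∈ Z F) :
    g * z * g⁻¹ ∈ Z F := by
  obtain ⟨σ, hσ⟩ := mem_GammaL_iff.1 hg
  obtain ⟨a, ha, h⟩ := mem_Z_iff.1 hz
  refine mem_Z_iff.2 ⟨σ a, by simpa using ha, fun u => ?_⟩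
  rw [Equiv.Perm.mul_apply, Equiv.Perm.mul_apply, h, hσ.2, ← Equiv.Perm.mul_apply, mul_inv_cancel,
    Equiv.Perm.one_apply]

theorem normal_Z_subgroupOf {G : Subgroup (Equiv.Perm (V F))} (hG : G ≤ GammaL F) :
    ((Z F).subgroupOf G).Normal :=
  ⟨fun _ hn g => conj_mem_Z (hG g.2) hn⟩

end

namespace Configuration

variable {F E : Type w} [Field F] [Field E] [Algebra F E]
  {G : Subgroup (Equiv.Perm (V F))} {θ ζ : E} {c x₀ y₀ x y : Equiv.Perm (V F)}
  {τ₀ ι : RingAut E} {σ₀ : RingAut F} {l : F} {t r : ℕ}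
  (K : Configuration G θ ζ c x₀ y₀ x y τ₀ ι σ₀ l t r)
include K

/-! ### Stabilizers of distant pairs -/

theorem subgroupOf_inf_map (L : Subgroup (Equiv.Perm (V F))) :
    L.subgroupOf G ⊓ (L.subgroupOf G).map (MulAut.conj (⟨s F, K.s_mem⟩ : G)).toMonoidHom =
      (L ⊓ L.map (MulAut.conj (s F)).toMonoidHom).subgroupOf G := by
  ext g
  rw [Subgroup.mem_inf, Subgroup.mem_subgroupOf, Subgroup.mem_subgroupOf, Subgroup.mem_inf]
  refine and_congr_right fun _ => ⟨?_, ?_⟩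
  · rintro ⟨a, ha, rfl⟩
    exact ⟨a, ha, rfl⟩
  · rintro ⟨a, ha, h⟩
    have haG : a ∈ G := by
      have h1 : a = (s F)⁻¹ * g * s F := by
        rw [← h]
        simp [MulAut.conj_apply, mul_assoc]
      rw [h1]
      exact G.mul_mem (G.mul_mem (G.inv_mem K.s_mem) g.2) K.s_mem
    exact ⟨⟨a, haG⟩, ha, Subtype.ext h⟩

theorem LGammaL_le : LGammaL G x y ≤ G :=
  sup_le (sup_le (W_le G) K.Z_le) ((Subgroup.closure_le _).2 (by
    rintro g (rfl | rfl)
    · exact K.x_mem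
    · exact K.y_mem))

/-- The stabilizer of any distant pair has the same order modulo `Z` as `L ∩ sLs`. -/
theorem relIndex_stabilizer [Finite E] {L : Subgroup (Equiv.Perm (V F))}
    (hL : L ≤ LGammaL G x y) {ρ : Setoid (G ⧸ L.subgroupOf G)}
    (hρ : IsTwoByBlockTransitive G (G ⧸ L.subgroupOf G) ρ) {ω ω' : G ⧸ L.subgroupOf G}
    (h : ¬ ρ ω ω') :
    ((Z F).subgroupOf G).relIndex (MulAction.stabilizer G ω ⊓ MulAction.stabilizer G ω') =
      (Z F).relIndex (L ⊓ L.map (MulAut.conj (s F)).toMonoidHom) := by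
  obtain ⟨M, hM, hρM⟩ := hρ.exists_block
  obtain rfl := K.eq_lineStabilizer hL hM
  induction ω using QuotientGroup.induction_on with
  | H a =>
    induction ω' using QuotientGroup.induction_on with
    | H b =>
      rw [hρM] at h
      obtain ⟨g, hg⟩ := hM.exists_stabilizer_eq K.s_notMem a b h
      have hN := normal_Z_subgroupOf K.le_GammaL
      have h1 := Subgroup.relIndex_map_map_of_injective ((Z F).subgroupOf G)
        (L.subgroupOf G ⊓ (L.subgroupOf G).map (MulAut.conj (⟨s F, K.s_mem⟩ : G)).toMonoidHom)
        (f := (MulAut.conj g).toMonoidHom) (MulAut.conj g).injective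
      rw [← hg] at h1
      have h2 : ((Z F).subgroupOf G).map (MulAut.conj g).toMonoidHom = (Z F).subgroupOf G := by
        apply le_antisymm
        · rintro _ ⟨z, hz, rfl⟩
          exact hN.conj_mem z hz g
        · intro z hz
          refine ⟨g⁻¹ * z * g, ?_, ?_⟩
          · simpa using hN.conj_mem z hz g⁻¹
          · simp [MulAut.conj_apply, mul_assoc]
      rw [h2, K.subgroupOf_inf_map] at h1
      rw [h1, Subgroup.relIndex_subgroupOf (inf_le_left.trans (hL.trans K.LGammaL_le))]

theorem quotientActsSharply_iff_relIndex [Finite E] {L : Subgroup (Equiv.Perm (V F))}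
    (hLM : L ≤ LGammaL G x y) (hZ : Z F ≤ L) (hL : IsTransitiveOn G L) :
    QuotientActsSharply ((Z F).subgroupOf G) (L.subgroupOf G) ↔
      (Z F).relIndex (L ⊓ L.map (MulAut.conj (s F)).toMonoidHom) = 1 := by
  have hN : (Z F).subgroupOf G ≤ L.subgroupOf G := Subgroup.comap_mono hZ
  rw [quotientActsSharply_iff (normal_Z_subgroupOf K.le_GammaL) hN ((K.isBlockSubgroup_iff hLM).2 hL)
    (fun M hM => K.eq_lineStabilizer hLM hM) K.s_notMem, K.subgroupOf_inf_map,
    Subgroup.relIndex_eq_one]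
  exact ⟨fun h g hg => h (x := ⟨g, K.LGammaL_le (hLM hg.1)⟩) hg, fun h => Subgroup.comap_mono h⟩

/-! ### The order of `G` -/

/-- Every linear map lies in G⟨x₀⟩, and G ∩ ⟨x₀⟩ = ⟨x₀^t⟩. -/
theorem relIndex_linearGroup [Finite F] : G.relIndex (linearGroup F) = t := by
  have hx : Subgroup.zpowers x₀ ≤ linearGroup F := by
    rw [Subgroup.zpowers_le]
    simpa using (K.acts_x₀_pow 1).linear
  rw [← relIndex_eq_of_mul hx]
  · have ho : t ∣ orderOf x₀ := by
      rw [← K.x₀_pow_mem_iff, pow_orderOf_eq_one]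
      exact G.one_mem
    have h1 : G ⊓ Subgroup.zpowers x₀ = Subgroup.zpowers (x₀ ^ t) := by
      apply le_antisymm
      · rintro g ⟨hg, hgx⟩
        obtain ⟨k, rfl⟩ := mem_powers_iff_mem_zpowers.2 hgx
        obtain ⟨m, rfl⟩ := (K.x₀_pow_mem_iff k).1 hg
        simp only [pow_mul]
        exact Subgroup.pow_mem _ (Subgroup.mem_zpowers _) m
      · rw [Subgroup.zpowers_le]
        exact ⟨(K.x₀_pow_mem_iff t).2 dvd_rfl, Subgroup.pow_mem _ (Subgroup.mem_zpowers _) _⟩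
    have h2 := Subgroup.relIndex_mul_relIndex ⊥ (G ⊓ Subgroup.zpowers x₀) _ bot_le inf_le_right
    rw [Subgroup.relIndex_bot_left, Subgroup.relIndex_bot_left, Subgroup.inf_relIndex_right, h1,
      Nat.card_zpowers, Nat.card_zpowers, orderOf_pow_of_dvd K.t_pos.ne' ho] at h2
    have h3 : 0 < orderOf x₀ := orderOf_pos _
    have h4 := Nat.div_mul_cancel ho
    have h5 : 0 < orderOf x₀ / t := Nat.div_pos (Nat.le_of_dvd h3 ho) K.t_pos
    exact Nat.eq_of_mul_eq_mul_left h5 (h2.trans h4.symm)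
  · intro m hm
    obtain ⟨g, hg, i, rfl⟩ := K.exists_mul_x₀_pow hm
    exact ⟨g, hg, _, Subgroup.pow_mem _ (Subgroup.mem_zpowers _) i, rfl⟩

/-- G ∩ GL₃(q) has index e_G in G and index t in GL₃(q). -/
theorem fieldIndex_eq_iff [Finite F] :
    fieldIndex G = t ↔ Nat.card G = Nat.card (linearGroup F) := by
  have h1 := Subgroup.relIndex_mul_relIndex ⊥ (linearGroup F ⊓ G) G bot_le inf_le_right
  have h2 := Subgroup.relIndex_mul_relIndex ⊥ (linearGroup F ⊓ G) (linearGroup F) bot_le inf_le_left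
  rw [Subgroup.inf_relIndex_left, K.relIndex_linearGroup] at h2
  rw [Subgroup.inf_relIndex_right] at h1
  simp only [Subgroup.relIndex_bot_left] at h1 h2
  rw [← h1, ← h2, fieldIndex]
  exact (Nat.mul_right_inj Nat.card_pos.ne').symm

end Configuration

theorem pointStabilizers_subset {F : Type*} [Field F] {G : Subgroup (Equiv.Perm (V F))}
    {x y : Equiv.Perm (V F)}
    (h : ∀ L ∈ pointStabilizers G x y, ∃ dx dy : ℕ, HasForm G x y L dx dy) :
    pointStabilizers G x y ⊆
      (fun d : ℕ × ℕ => W G ⊔ Z F ⊔ Subgroup.closure {x ^ d.1, x ^ (d.1 - 1) * y ^ d.2}) ''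
        (({(1, 1), (1, 2), (2, 1)} : Finset (ℕ × ℕ)) : Set (ℕ × ℕ)) := by
  intro L hL
  obtain ⟨dx, dy, hd⟩ := h L hL
  refine ⟨(dx, dy), ?_, hd.semidirect.sup_eq⟩
  rcases hd.cases with ⟨rfl, rfl⟩ | ⟨rfl, rfl⟩ | ⟨rfl, rfl⟩ <;> simp

end PlaneField

theorem mainTheorem8 {F : Type*} [Field F] [Finite F] (p e : ℕ) (hp : p.Prime)
    (hF : Nat.card F = p ^ e)
    -- the group `G`, with `Z SL₃(q) ≤ G ≤ ΓL₃(q)`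
    (G : Subgroup (Equiv.Perm (PlaneField.V F)))
    (hG : G ≤ PlaneField.GammaL F) (hSG : PlaneField.Z F ⊔ PlaneField.specialLinearGroup F ≤ G)
    -- the Singer cycle `c = x̂₀`, its power `x₀`, and the field automorphism `y₀`
    (c x₀ y₀ : Equiv.Perm (PlaneField.V F))
    (hc : PlaneField.IsSingerCycle c) (hx₀ : x₀ = c ^ (Nat.card F + 1))
    (hy₀ : PlaneField.IsAdaptedFieldAut G c y₀)
    -- the parameters `t = t_G` and `r = r_G`, and the elements `x = x̂` and `y` of `G`
    (t r : ℕ) (ht : IsLeast {k : ℕ | 0 < k ∧ x₀ ^ k ∈ G} t)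
    (hrt : r < t) (hr : x₀ ^ r * y₀ ∈ G)
    (x y : Equiv.Perm (PlaneField.V F)) (hx : x = c ^ t) (hy : y = x₀ ^ r * y₀) :
    -- `L^{ΓL₁}` is the semidirect product `WZ ⋊ ⟨x̂, y⟩`
    PlaneField.IsInternalSemidirect (PlaneField.W G ⊔ PlaneField.Z F)
      (Subgroup.closure {x, y}) (PlaneField.LGammaL G x y) ∧
    -- the description of the class `𝓗`
    (∀ L : Subgroup (Equiv.Perm (PlaneField.V F)),
      L ∈ PlaneField.pointStabilizers G x y ↔
        ∃ dx dy : ℕ, PlaneField.HasForm G x y L dx dy ∧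
          (Even (PlaneField.fieldIndex G) → dx = 1 ∧ dy = 1) ∧
          (p = 2 → dx = 1) ∧
          (t = 3 → r ≠ 0 ∧ 3 ∣ PlaneField.fieldIndex G ∧
            p ^ (e / PlaneField.fieldIndex G) ≡ 1 [MOD 3])) ∧
    -- `|𝓗| ≤ 3`
    (PlaneField.pointStabilizers G x y).Finite ∧
    (PlaneField.pointStabilizers G x y).ncard ≤ 3 ∧
    -- the order modulo `Z` of the stabilizer of a distant pair
    (∀ L ∈ PlaneField.pointStabilizers G x y,
      ((PlaneField.Z F).relIndex (L ⊓ L.map (MulAut.conj (PlaneField.s F)).toMonoidHom) : ℚ) =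
          4 * PlaneField.fieldIndex G / ((L.relIndex (PlaneField.LGammaL G x y)) ^ 2 * t) ∧
      ∀ ρ : Setoid (G ⧸ L.subgroupOf G),
        PlaneField.IsTwoByBlockTransitive G (G ⧸ L.subgroupOf G) ρ →
        ∀ ω ω' : G ⧸ L.subgroupOf G, ¬ ρ ω ω' →
          (((PlaneField.Z F).subgroupOf G).relIndex
            (MulAction.stabilizer G ω ⊓ MulAction.stabilizer G ω') : ℚ) =
          4 * PlaneField.fieldIndex G / ((L.relIndex (PlaneField.LGammaL G x y)) ^ 2 * t)) ∧
    -- the sharply 2-by-block-transitive actions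
    (∀ L ∈ PlaneField.pointStabilizers G x y, ∀ dx dy : ℕ,
      PlaneField.HasForm G x y L dx dy →
        (PlaneField.QuotientActsSharply ((PlaneField.Z F).subgroupOf G) (L.subgroupOf G) ↔
          PlaneField.fieldIndex G = t ∧ dx * dy = 2)) ∧
    (PlaneField.fieldIndex G = t ↔ Nat.card G = Nat.card (PlaneField.linearGroup F)) := by
  obtain ⟨E, _, _, _, θ, ζ, τ₀, ι, σ₀, l, K⟩ :=
    PlaneField.exists_configuration hG hSG hc hx₀ hy₀ ht hrt hr hx hy
  have hmem := K.mem_pointStabilizers_iff_hasForm hp hF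
  have hsub := PlaneField.pointStabilizers_subset fun L hL =>
    let ⟨dx, dy, h, _⟩ := (hmem L).1 hL
    ⟨dx, dy, h⟩
  have hfin := (Finset.finite_toSet ({(1, 1), (1, 2), (2, 1)} : Finset (ℕ × ℕ)))
  have ht0 := K.t_pos
  refine ⟨K.isInternalSemidirect, hmem, (hfin.image _).subset hsub, ?_, ?_, ?_,
    K.fieldIndex_eq_iff⟩
  · refine (Set.ncard_le_ncard hsub (hfin.image _)).trans ((Set.ncard_image_le hfin).trans ?_)
    rw [Set.ncard_coe_finset]
    rfl
  · intro L hL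
    obtain ⟨hLM, hZ, hLt⟩ := K.mem_pointStabilizers_iff.1 hL
    have hd : L.relIndex (PlaneField.LGammaL G x y) ≠ 0 := Subgroup.index_ne_zero_of_finite
    have h1 : ((PlaneField.Z F).relIndex
        (L ⊓ L.map (MulAut.conj (PlaneField.s F)).toMonoidHom) : ℚ) =
        4 * PlaneField.fieldIndex G / ((L.relIndex (PlaneField.LGammaL G x y)) ^ 2 * t) := by
      rw [eq_div_iff (by positivity)]
      exact_mod_cast K.relIndex_Z_mul hLM hZ hLt
    refine ⟨h1, fun ρ hρ ω ω' hω => ?_⟩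
    rw [K.relIndex_stabilizer hLM hρ hω, h1]
  · intro L hL dx dy hform
    obtain ⟨hLM, hZ, hLt⟩ := K.mem_pointStabilizers_iff.1 hL
    have h1 := K.relIndex_Z_mul hLM hZ hLt
    rw [K.quotientActsSharply_iff_relIndex hLM hZ hLt]
    rw [← hform.index] at h1
    have h2 : dx * dy = 1 ∨ dx * dy = 2 := by
      rcases hform.cases with ⟨rfl, rfl⟩ | ⟨rfl, rfl⟩ | ⟨rfl, rfl⟩ <;> simp
    constructor
    · intro h
      rw [h] at h1
      -- Trivial pair stabilizers mean d²t = 4e_G with d = |M : L|. For d = 1 this contradicts t ∈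
      -- {1, 3}, and for d = 2 it reads t = e_G.
      rcases h2 with h2 | h2 <;> rw [h2] at h1 ⊢ <;> rcases K.t_eq with h3 | h3 <;> omega
    · rintro ⟨h3, h4⟩
      rw [h3, h4] at h1
      refine Nat.eq_of_mul_eq_mul_right (show 0 < 2 ^ 2 * t by positivity) ?_
      rw [h1]
      ring
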